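/- **Setting.** Let $M,d,k\ge 1$, let $n_1,\dots,n_M\ge 2$ be even integers, and put $N=\sum_{i=1}^M n_i$. Let $B^\star\in\mathbb R^{d\times k}$ have orthonormal columns and let $\alpha_1^\star,\dots,\alpha_M^\star\in\mathbb R^k$. Let $\lambda_1\ge\dots\ge\lambda_k$ be the eigenvalues of $D=\frac1N\sum_{i=1}^M n_i\alpha_i^\star(\alpha_i^\star)^\top$, and suppose $\lambda_k>0$. For $i\in[M]$, $j\in[n_i]$ let $x_{ij}$ be a random vector in $\mathbb R^d$ and $\zeta_{ij},\xi_{ij}$ real random variables such that the tuples $(x_{ij},\zeta_{ij},\xi_{ij})$ are mutually independent over all pairs $(i,j)$ (within a tuple, $\zeta_{ij}$ and $\xi_{ij}$ may depend on $x_{ij}$). A real random variable $X$ is called sub-gaussian with variance proxy $v$ if $\mathbb E\,e^{t(X-\mathbb EX)}\le e^{vt^2/2}$ for all $t\in\mathbb R$; a random vector $X$ is, if $u^\top X$ is for every unit vector $u$. **Assumptions.** Let $v_x,v_\zeta,v_\xi,m_x,m_\zeta,a$ be constants such that, for all $i,j$: 1. $x_{ij}$ is sub-gaussian with variance proxy $v_x$,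 and $\|\mathbb E x_{ij}\|\le m_x$; 2. $\zeta_{ij}$ is sub-gaussian with variance proxy $v_\zeta\|\alpha_i^\star\|^2$, and $|\mathbb E\zeta_{ij}|\le m_\zeta$; 3. $\mathbb E[\zeta_{ij}x_{ij}]=B^\star\alpha_i^\star$; 4. conditionally on $x_{ij}$, $\xi_{ij}$ is zero-mean and sub-gaussian with variance proxy $v_\xi$: $\mathbb E[\xi_{ij}\mid x_{ij}]=0$ and, for every $t\in\mathbb R$, $\mathbb E[e^{t\xi_{ij}}\mid x_{ij}]\le e^{v_\xi t^2/2}$, almost surely; 5. $\|\alpha_i^\star\|\le a$. **Estimator.** Let $y_{ij}=\zeta_{ij}+\xi_{ij}$, $\overline z_i=\frac{2}{n_i}\sum_{j=1}^{n_i/2}y_{ij}x_{ij}$, $\widetilde z_i=\frac{2}{n_i}\sum_{j=n_i/2+1}^{n_i}y_{ij}x_{ij}$ and $Z=\sum_{i=1}^M n_i\overline z_i\widetilde z_i^{\top}$. Let $\widehat B\in\mathbb R^{d\times k}$ be a matrix whose columns are top-$k$ right singular vectors of $Z$, or top-$k$ left singular vectors of $Z$ (the first $k$ columns of $V$, respectively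 of $U$, in a singular value decomposition $Z=U\,\mathrm{diag}(s_1,\dots,s_d)V^\top$ with $s_1\ge\dots\ge s_d\ge 0$). Write $\|\sin\Theta(\widehat B,B^\star)\|=\|\widehat B\widehat B^\top-B^\star(B^\star)^\top\|$ (spectral norm). **Theorem.** There is a constant $C>0$ depending only on $v_x,v_\zeta,v_\xi,m_x,m_\zeta,a$ such that in every setting as above, with probability at least $1-C(d+N)^{-10}$, every such $\widehat B$ (right or left, for any choice of the singular value decomposition) satisfies $$\|\sin\Theta(\widehat B,B^\star)\|\le C\left(\sqrt{\frac{d\lambda_1}{N\lambda_k^2}}+\sqrt{\frac{Md}{N^2\lambda_k^2}}\right)\log^3(d+N).$$ -/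

import Mathlib

open MeasureTheory ProbabilityTheory
open scoped NNReal Matrix

/-- `X ∼ subG(v)`: the real random variable `X` is sub-gaussian with variance proxy `v`, i.e.
`E[exp (t (X - E X))] ≤ exp (v t² / 2)` for every real `t` (all these exponentials being
integrable). -/
def IsSubG {Ω : Type*} [MeasurableSpace Ω] (X : Ω → ℝ) (v : ℝ≥0) (μ : Measure Ω) : Prop :=
  HasSubgaussianMGF (fun ω => X ω - ∫ ω', X ω' ∂μ) v μ

/-- `X ∼ subG_d(v)`: the random vector `X` is sub-gaussian with variance proxy `v`, i.e.
`uᵀ X ∼ subG(v)` for every unit vector `u`. -/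
def IsSubGVec {Ω : Type*} [MeasurableSpace Ω] {d : ℕ} (X : Ω → EuclideanSpace ℝ (Fin d))
    (v : ℝ≥0) (μ : Measure Ω) : Prop :=
  ∀ u : EuclideanSpace ℝ (Fin d), ‖u‖ = 1 → IsSubG (fun ω => inner ℝ u (X ω)) v μ

/-- Conditionally on the random vector `X`, the real random variable `W` has mean zero and is
sub-gaussian with variance proxy `v`: almost surely `E[W | X] = 0`, and
`E[exp (t W) | X] ≤ exp (v t² / 2)` for every real `t`. -/
structure IsCondCenteredSubG {Ω : Type*} [MeasurableSpace Ω] {d : ℕ} (W : Ω → ℝ)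
    (X : Ω → EuclideanSpace ℝ (Fin d)) (v : ℝ≥0) (μ : Measure Ω) : Prop where
  integrable_exp : ∀ t : ℝ, Integrable (fun ω => Real.exp (t * W ω)) μ
  condMean_eq_zero : μ[W | MeasurableSpace.comap X inferInstance] =ᵐ[μ] 0
  condMGF_le : ∀ t : ℝ,
    μ[fun ω => Real.exp (t * W ω) | MeasurableSpace.comap X inferInstance]
      ≤ᵐ[μ] fun _ => Real.exp (v * t ^ 2 / 2)

/-- The total number of samples `N = ∑ᵢ nᵢ`. -/
def totalSamples {M : ℕ} (n : Fin M → ℕ) : ℕ := ∑ i, n i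

/-- The client diversity matrix `D = (1 / N) ∑ᵢ nᵢ αᵢ αᵢᵀ`. -/
noncomputable def diversityMatrix {M k : ℕ} (n : Fin M → ℕ)
    (α : Fin M → EuclideanSpace ℝ (Fin k)) : Matrix (Fin k) (Fin k) ℝ :=
  (totalSamples n : ℝ)⁻¹ • ∑ i, (n i : ℝ) • Matrix.vecMulVec (α i).ofLp (α i).ofLp

theorem diversityMatrix_isHermitian {M k : ℕ} (n : Fin M → ℕ)
    (α : Fin M → EuclideanSpace ℝ (Fin k)) : (diversityMatrix n α).IsHermitian := by
  ext a b
  simp [diversityMatrix, Matrix.sum_apply, Matrix.vecMulVec_apply, mul_comm]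

/-- The eigenvalues of the client diversity matrix in decreasing order, with multiplicity
(`Matrix.IsHermitian.eigenvalues₀` is antitone). The index is 0-based: the `r`-th largest
eigenvalue has index `r - 1`. -/
noncomputable def diversityEigenvalue {M k : ℕ} (n : Fin M → ℕ)
    (α : Fin M → EuclideanSpace ℝ (Fin k)) (r : Fin k) : ℝ :=
  (diversityMatrix_isHermitian n α).eigenvalues₀ (Fin.cast (Fintype.card_fin k).symm r)

/-- Average of `y_j x_j` over the first half of the samples of a client:
`(2 / n) ∑_{j ≤ n / 2} y_j x_j`. -/
noncomputable def firstHalfAverage {n d : ℕ} (y : Fin n → ℝ)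
    (x : Fin n → EuclideanSpace ℝ (Fin d)) : EuclideanSpace ℝ (Fin d) :=
  (2 / (n : ℝ)) • ∑ j : Fin n with j.val < n / 2, y j • x j

/-- Average of `y_j x_j` over the second half of the samples of a client:
`(2 / n) ∑_{n / 2 < j ≤ n} y_j x_j`. -/
noncomputable def secondHalfAverage {n d : ℕ} (y : Fin n → ℝ)
    (x : Fin n → EuclideanSpace ℝ (Fin d)) : EuclideanSpace ℝ (Fin d) :=
  (2 / (n : ℝ)) • ∑ j : Fin n with n / 2 ≤ j.val, y j • x j

/-- The two-replica matrix `Z = ∑ᵢ nᵢ z̄ᵢ z̃ᵢᵀ` of the data `(x_ij, y_ij)`. -/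
noncomputable def replicaMatrix {M d : ℕ} (n : Fin M → ℕ) (y : (i : Fin M) → Fin (n i) → ℝ)
    (x : (i : Fin M) → Fin (n i) → EuclideanSpace ℝ (Fin d)) : Matrix (Fin d) (Fin d) ℝ :=
  ∑ i, (n i : ℝ) • Matrix.vecMulVec (firstHalfAverage (y i) (x i)).ofLp
    (secondHalfAverage (y i) (x i)).ofLp

/-- `Z = U diag(s) Vᵀ` is a singular value decomposition, with singular values in decreasing
order. -/
structure IsSVD {d : ℕ} (Z U : Matrix (Fin d) (Fin d) ℝ) (s : Fin d → ℝ)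
    (V : Matrix (Fin d) (Fin d) ℝ) : Prop where
  left_orthogonal : U ∈ Matrix.orthogonalGroup (Fin d) ℝ
  right_orthogonal : V ∈ Matrix.orthogonalGroup (Fin d) ℝ
  nonneg : ∀ r, 0 ≤ s r
  antitone : Antitone s
  eq : Z = U * Matrix.diagonal s * Vᵀ

/-- The columns of `B` are right singular vectors of `Z` for its `k` largest singular values. -/
def IsTopRightSingular {d k : ℕ} (Z : Matrix (Fin d) (Fin d) ℝ)
    (B : Matrix (Fin d) (Fin k) ℝ) : Prop :=
  ∃ U s V, IsSVD Z U s V ∧ ∃ h : k ≤ d, B = V.submatrix id (Fin.castLE h)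

/-- The columns of `B` are left singular vectors of `Z` for its `k` largest singular values. -/
def IsTopLeftSingular {d k : ℕ} (Z : Matrix (Fin d) (Fin d) ℝ)
    (B : Matrix (Fin d) (Fin k) ℝ) : Prop :=
  ∃ U s V, IsSVD Z U s V ∧ ∃ h : k ≤ d, B = U.submatrix id (Fin.castLE h)

open scoped Matrix.Norms.L2Operator in
/-- The principal angle distance `‖sin Θ(B, B')‖ = ‖B Bᵀ - B' B'ᵀ‖` (spectral norm). -/
noncomputable def sinThetaDist {d k : ℕ} (B B' : Matrix (Fin d) (Fin k) ℝ) : ℝ :=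
  ‖B * Bᵀ - B' * B'ᵀ‖

/-! Write each half average as signal plus noise, `z̄ᵢ = B αᵢ + gᵢ / √nᵢ` and `z̃ᵢ = B αᵢ + hᵢ /
√nᵢ`. The two halves use disjoint samples, so `gᵢ` and `hᵢ` are independent and centered. With `bᵢ =
√nᵢ B αᵢ` this gives `Z = N B D Bᵀ + ∑ᵢ (gᵢ bᵢᵀ + bᵢ hᵢᵀ + gᵢ hᵢᵀ)`. The mean has row and column
space `range B` and smallest nonzero singular value `N λ_k`. By Wedin's theorem
(`IsTopRightSingular.sinThetaDist_le`, transposed for left vectors) the error is at most `4 ‖noise‖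
/ (N λ_k)`.

It remains to show that the noise has norm at most `C (√(d T) + √(M d)) log³` with `T = N λ₁`
(`exists_noise_concentration`). Each sample contributes a product of sub-gaussian variables, which
is sub-exponential, and the normalized sums `gᵢ, hᵢ` are sub-exponential in every direction with
constants free of `nᵢ`. The signals enter only through `‖bᵢ‖² ≤ T`, `∑ (bᵢ · v)² ≤ T ‖v‖²` and `∑
‖bᵢ‖² ≤ k T ≤ d T`. So the variance is of order `d T` for the terms linear in the noise and `M d`
for the quadratic one. The summands are truncated where `‖gᵢ‖²` or `‖hᵢ‖²` exceeds `d` times a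
squared logarithm. The truncation changes the mean negligibly and is inactive with high probability,
and a matrix Bernstein inequality is applied to the Hermitian dilations.

The Bernstein inequality is proved in moment form by exchangeable pairs. Replacing one summand by an
independent copy, together with a mean value inequality for traces, bounds `E tr S^(n+2)` by `(n+1)
E tr (∑ (Xᵢ² + E Xᵢ²)) Sⁿ`. The fluctuation of `∑ Xᵢ²` around its mean is a sum of independent
positive semidefinite matrices and is handled by the same recursion. Young's inequality for traces
separates it from `S`, and Markov's inequality at a moment of order `log (d + N)` gives the tail.

The concentration step needs `d ≤ N λ₁`. If `N λ_k² ≤ d λ₁`, the claimed bound already exceeds the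
trivial bound `2`; otherwise `d < N λ_k ≤ N λ₁`. -/

/-! ### Trace inequalities for pairs of Hermitian matrices. -/

section TraceInequalities

variable {m : Type*} [Fintype m] [DecidableEq m]

/-- A Hermitian real matrix is orthogonally diagonalizable. -/
theorem Matrix.IsHermitian.exists_eq_conj_diagonal {A : Matrix m m ℝ} (hA : A.IsHermitian) :
    ∃ U : Matrix m m ℝ, Uᵀ * U = 1 ∧ U * Uᵀ = 1 ∧
      ∀ p : ℕ, A ^ p = U * Matrix.diagonal (fun i => hA.eigenvalues i ^ p) * Uᵀ := by
  refine ⟨hA.eigenvectorUnitary, ?_, ?_, ?_⟩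
  · have := Unitary.coe_star_mul_self hA.eigenvectorUnitary
    simpa [Matrix.star_eq_conjTranspose] using this
  · have := Unitary.coe_mul_star_self hA.eigenvectorUnitary
    simpa [Matrix.star_eq_conjTranspose] using this
  · intro p
    have h1 : (hA.eigenvectorUnitary : Matrix m m ℝ)ᵀ * hA.eigenvectorUnitary = 1 := by
      have := Unitary.coe_star_mul_self hA.eigenvectorUnitary
      simpa [Matrix.star_eq_conjTranspose] using this
    have h2 : (hA.eigenvectorUnitary : Matrix m m ℝ) * (hA.eigenvectorUnitary : Matrix m m ℝ)ᵀ
        = 1 := by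
      have := Unitary.coe_mul_star_self hA.eigenvectorUnitary
      simpa [Matrix.star_eq_conjTranspose] using this
    have h3 : A = (hA.eigenvectorUnitary : Matrix m m ℝ) * Matrix.diagonal hA.eigenvalues *
        (hA.eigenvectorUnitary : Matrix m m ℝ)ᵀ := by
      have := hA.spectral_theorem
      rw [Unitary.conjStarAlgAut_apply] at this
      simpa [Matrix.star_eq_conjTranspose, Function.comp_def] using this
    generalize (hA.eigenvectorUnitary : Matrix m m ℝ) = U at *
    induction p with
    | zero => simp [h2]
    | succ p ih =>
      rw [pow_succ, ih]
      nth_rewrite 2 [h3]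
      calc _ = U * Matrix.diagonal (fun i => hA.eigenvalues i ^ p) * (Uᵀ * U) *
            Matrix.diagonal hA.eigenvalues * Uᵀ := by simp only [Matrix.mul_assoc]
        _ = _ := by
          rw [h1, Matrix.mul_one, Matrix.mul_assoc U, Matrix.diagonal_mul_diagonal]
          simp [pow_succ]

/-- The traces `tr (A ^ p * B ^ q)` are the moments of a nonnegative weight on pairs of
eigenvalues. -/
theorem Matrix.IsHermitian.exists_trace_pow_mul_pow {A B : Matrix m m ℝ} (hA : A.IsHermitian)
    (hB : B.IsHermitian) : ∃ (a b : m → ℝ) (w : m → m → ℝ), (∀ i j, 0 ≤ w i j) ∧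
      ∀ p q : ℕ, (A ^ p * B ^ q).trace = ∑ i, ∑ j, w i j * (a i ^ p * b j ^ q) := by
  obtain ⟨U, -, -, hUA⟩ := hA.exists_eq_conj_diagonal
  obtain ⟨V, -, -, hVB⟩ := hB.exists_eq_conj_diagonal
  generalize hA.eigenvalues = a at hUA
  generalize hB.eigenvalues = b at hVB
  refine ⟨a, b, fun i j => (Uᵀ * V) i j ^ 2, fun i j => sq_nonneg _, fun p q => ?_⟩
  rw [hUA, hVB]
  have : (U * Matrix.diagonal (fun i => a i ^ p) * Uᵀ *
      (V * Matrix.diagonal (fun i => b i ^ q) * Vᵀ)).trace =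
      (Matrix.diagonal (fun i => a i ^ p) * (Uᵀ * V) * (Matrix.diagonal (fun i => b i ^ q) *
        (Uᵀ * V)ᵀ)).trace := by
    rw [Matrix.mul_assoc U, Matrix.mul_assoc U, Matrix.trace_mul_comm U]
    simp only [Matrix.mul_assoc, Matrix.transpose_mul, Matrix.transpose_transpose]
  rw [this, Matrix.trace]
  refine Finset.sum_congr rfl fun i _ => ?_
  rw [Matrix.diag_apply, Matrix.mul_apply]
  refine Finset.sum_congr rfl fun j _ => ?_
  rw [Matrix.diagonal_mul, Matrix.diagonal_mul, Matrix.transpose_apply]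
  ring

theorem pow_mul_pow_le_add_pow {a b : ℝ} {q r n : ℕ} (h : q + r = n) (hn : Even n) :
    a ^ q * b ^ r ≤ a ^ n + b ^ n := by
  subst h
  have h1 : a ^ q * b ^ r ≤ |a| ^ q * |b| ^ r := by
    rw [← abs_pow, ← abs_pow, ← abs_mul]; exact le_abs_self _
  rw [← hn.pow_abs a, ← hn.pow_abs b]
  refine h1.trans ?_
  have ha := abs_nonneg a
  have hb := abs_nonneg b
  rcases le_total |a| |b| with hab | hab
  · calc _ ≤ |b| ^ q * |b| ^ r := by gcongr
      _ = |b| ^ (q + r) := (pow_add _ _ _).symm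
      _ ≤ _ := le_add_of_nonneg_left (by positivity)
  · calc _ ≤ |a| ^ q * |a| ^ r := by gcongr
      _ = |a| ^ (q + r) := (pow_add _ _ _).symm
      _ ≤ _ := le_add_of_nonneg_right (by positivity)

/-- Factor `a^(n+1) - b^(n+1)` as `a - b` times a geometric sum of `n + 1` terms, each at most `aⁿ +
bⁿ` because `n` is even. This is the scalar case of the trace mean value inequality. -/
theorem sub_mul_pow_sub_pow_le (a b : ℝ) {n : ℕ} (hn : Even n) :
    (a - b) * (a ^ (n + 1) - b ^ (n + 1)) ≤ (n + 1) * ((a - b) ^ 2 * (a ^ n + b ^ n)) := by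
  rw [← Commute.geom_sum₂_mul (Commute.all a b) (n + 1)]
  have : ∑ i ∈ Finset.range (n + 1), a ^ i * b ^ (n + 1 - 1 - i) ≤
      ∑ i ∈ Finset.range (n + 1), (a ^ n + b ^ n) := by
    refine Finset.sum_le_sum fun i hi => ?_
    have := Finset.mem_range.1 hi
    exact pow_mul_pow_le_add_pow (by omega) hn
  rw [Finset.sum_const, Finset.card_range, nsmul_eq_mul] at this
  push_cast at this ⊢
  nlinarith [mul_le_mul_of_nonneg_left this (sq_nonneg (a - b))]

/-- Mean value inequality for the trace of an odd power. -/
theorem trace_sub_mul_pow_sub_pow_le {A B : Matrix m m ℝ} (hA : A.IsHermitian)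
    (hB : B.IsHermitian) {n : ℕ} (hn : Even n) :
    ((A - B) * (A ^ (n + 1) - B ^ (n + 1))).trace ≤
      (n + 1) * ((A - B) * (A - B) * (A ^ n + B ^ n)).trace := by
  -- By cyclicity every monomial below has the trace of some `A ^ p * B ^ q`. Both sides are
  -- therefore integrals of scalar polynomials against the same nonnegative weight, and the scalar
  -- inequality suffices.
  obtain ⟨a, b, w, hw, h⟩ := hA.exists_trace_pow_mul_pow hB
  have e1 : ((A - B) * (A ^ (n + 1) - B ^ (n + 1))).trace =
      (A ^ (n + 2) * B ^ 0).trace - (A ^ 1 * B ^ (n + 1)).trace - (A ^ (n + 1) * B ^ 1).trace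
        + (A ^ 0 * B ^ (n + 2)).trace := by
    rw [Matrix.trace_mul_comm (A ^ (n + 1))]
    simp only [← Matrix.trace_sub, ← Matrix.trace_add]
    congr 1
    simp only [pow_zero, pow_one, mul_one, one_mul]
    rw [pow_succ' A (n + 1), pow_succ' B (n + 1)]
    noncomm_ring
  have c1 : (A * B * A ^ n).trace = (A ^ (n + 1) * B ^ 1).trace := by
    rw [Matrix.trace_mul_comm, ← Matrix.mul_assoc, ← pow_succ, pow_one]
  have c2 : (B * A * A ^ n).trace = (A ^ (n + 1) * B ^ 1).trace := by
    rw [Matrix.mul_assoc, Matrix.trace_mul_comm, ← pow_succ', pow_one]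
  have c3 : (B * B * A ^ n).trace = (A ^ n * B ^ 2).trace := by
    rw [Matrix.trace_mul_comm, pow_two]
  have c4 : (A * B * B ^ n).trace = (A ^ 1 * B ^ (n + 1)).trace := by
    rw [Matrix.mul_assoc, ← pow_succ', pow_one]
  have c5 : (B * A * B ^ n).trace = (A ^ 1 * B ^ (n + 1)).trace := by
    rw [Matrix.mul_assoc, Matrix.trace_mul_comm, Matrix.mul_assoc, ← pow_succ, pow_one]
  have c6 : (A * A * B ^ n).trace = (A ^ 2 * B ^ n).trace := by rw [pow_two]
  have c7 : (A * A * A ^ n).trace = (A ^ (n + 2) * B ^ 0).trace := by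
    rw [← pow_two, ← pow_add, pow_zero, mul_one, add_comm]
  have c8 : (B * B * B ^ n).trace = (A ^ 0 * B ^ (n + 2)).trace := by
    rw [← pow_two, ← pow_add, pow_zero, one_mul, add_comm]
  have e2 : ((A - B) * (A - B) * (A ^ n + B ^ n)).trace =
      (A ^ (n + 2) * B ^ 0).trace - 2 * (A ^ (n + 1) * B ^ 1).trace + (A ^ n * B ^ 2).trace +
      ((A ^ 2 * B ^ n).trace - 2 * (A ^ 1 * B ^ (n + 1)).trace + (A ^ 0 * B ^ (n + 2)).trace) := by
    have : (A - B) * (A - B) * (A ^ n + B ^ n) = A * A * A ^ n - A * B * A ^ n - B * A * A ^ n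
        + B * B * A ^ n + (A * A * B ^ n - A * B * B ^ n - B * A * B ^ n + B * B * B ^ n) := by
      noncomm_ring
    rw [this]
    simp only [Matrix.trace_sub, Matrix.trace_add, c1, c2, c3, c4, c5, c6, c7, c8]
    ring
  rw [e1, e2]
  simp only [h, Finset.mul_sum, ← Finset.sum_sub_distrib, ← Finset.sum_add_distrib]
  refine Finset.sum_le_sum fun i _ => Finset.sum_le_sum fun j _ => ?_
  have := mul_le_mul_of_nonneg_left (sub_mul_pow_sub_pow_le (a i) (b j) hn) (hw i j)
  calc _ = w i j * ((a i - b j) * (a i ^ (n + 1) - b j ^ (n + 1))) := by ring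
    _ ≤ _ := this
    _ = _ := by ring

/-- By cyclicity the trace is that of `S^q A S^q`, which is positive semidefinite. This makes
multiplication by an even power of `S` under the trace monotone for the Loewner order. -/
theorem Matrix.PosSemidef.trace_mul_pow_two_mul_nonneg {A S : Matrix m m ℝ} (hA : A.PosSemidef)
    (hS : S.IsHermitian) (q : ℕ) : 0 ≤ (A * S ^ (2 * q)).trace := by
  have h := (hA.conjTranspose_mul_mul_same (S ^ q)).trace_nonneg
  rw [(hS.pow q).eq, Matrix.mul_assoc, Matrix.trace_mul_comm, Matrix.mul_assoc, ← pow_add] at h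
  rwa [two_mul]

/-- The square `(W - K)²` is positive semidefinite, so its trace against `W^(2q)` is nonnegative. It
serves to interpolate an odd moment between the neighbouring even ones. -/
theorem trace_pow_odd_le {W : Matrix m m ℝ} (hW : W.IsHermitian) (K : ℝ) (q : ℕ) :
    2 * K * (W ^ (2 * q + 1)).trace ≤ (W ^ (2 * q + 2)).trace + K ^ 2 * (W ^ (2 * q)).trace := by
  have hH : (W - K • (1 : Matrix m m ℝ)).IsHermitian :=
    hW.sub (by simp [Matrix.IsHermitian])
  have h1 : ((W - K • (1 : Matrix m m ℝ)) * (W - K • (1 : Matrix m m ℝ))).PosSemidef := by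
    have := Matrix.posSemidef_conjTranspose_mul_self (W - K • (1 : Matrix m m ℝ))
    rwa [hH.eq] at this
  have h2 := h1.trace_mul_pow_two_mul_nonneg hW q
  have : (W - K • (1 : Matrix m m ℝ)) * (W - K • (1 : Matrix m m ℝ)) * W ^ (2 * q) =
      W ^ (2 * q + 2) - (2 * K) • W ^ (2 * q + 1) + K ^ 2 • W ^ (2 * q) := by
    rw [show 2 * q + 2 = 2 * q + 1 + 1 from rfl, pow_succ' W (2 * q + 1), pow_succ' W (2 * q)]
    simp only [sub_mul, mul_sub, smul_mul_assoc, mul_smul_comm, one_mul, mul_one, smul_sub,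
      smul_smul, mul_assoc]
    module
  rw [this, Matrix.trace_add, Matrix.trace_sub, Matrix.trace_smul, Matrix.trace_smul,
    smul_eq_mul, smul_eq_mul] at h2
  linarith

/-- If `y ≤ 4x` the first term dominates, otherwise the second. The factor `1/4` lets two such error
terms be absorbed on the left in the moment recursion. -/
theorem mul_pow_le_pow_add_pow {x y : ℝ} (hx : 0 ≤ x) (hy : 0 ≤ y) (p : ℕ) :
    x * y ^ p ≤ 4 ^ p * x ^ (p + 1) + y ^ (p + 1) / 4 := by
  rcases le_total y (4 * x) with h | h
  · calc x * y ^ p ≤ x * (4 * x) ^ p := by gcongr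
      _ = 4 ^ p * x ^ (p + 1) := by ring
      _ ≤ _ := le_add_of_nonneg_right (by positivity)
  · calc x * y ^ p ≤ y / 4 * y ^ p := by gcongr; linarith
      _ = y ^ (p + 1) / 4 := by ring
      _ ≤ _ := le_add_of_nonneg_left (by positivity)

/-- Young's inequality holds termwise in the joint spectral representation of `W` and `S`. Evenness
of `p + 1` removes the absolute value from the eigenvalues of `W`. -/
theorem trace_mul_pow_le_young {W S : Matrix m m ℝ} (hW : W.IsHermitian) (hS : S.IsHermitian)
    {K : ℝ} (hK : 0 ≤ K) {p : ℕ} (hp : Even (p + 1)) :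
    K * (W * S ^ (2 * p)).trace ≤
      4 ^ p * K ^ (p + 1) * (W ^ (p + 1)).trace + (S ^ (2 * (p + 1))).trace / 4 := by
  obtain ⟨a, b, w, hw, h⟩ := hW.exists_trace_pow_mul_pow hS
  have h1 := h 1 (2 * p)
  have h2 := h (p + 1) 0
  have h3 := h 0 (2 * (p + 1))
  simp only [pow_zero, pow_one, one_mul, mul_one] at h1 h2 h3
  rw [h1, h2, h3]
  simp only [Finset.mul_sum, Finset.sum_div, ← Finset.sum_add_distrib]
  refine Finset.sum_le_sum fun i _ => Finset.sum_le_sum fun j _ => ?_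
  have := mul_le_mul_of_nonneg_left
    (mul_pow_le_pow_add_pow (mul_nonneg hK (abs_nonneg (a i))) (sq_nonneg (b j)) p) (hw i j)
  rw [mul_pow, hp.pow_abs, ← pow_mul, ← pow_mul] at this
  have h5 : w i j * (K * (a i * b j ^ (2 * p))) ≤ w i j * (K * (|a i| * b j ^ (2 * p))) := by
    have h6 : (0 : ℝ) ≤ b j ^ (2 * p) := by rw [pow_mul]; positivity
    have h7 := hw i j
    gcongr
    exact le_abs_self _
  linarith

/-- The quadratic form of the square of a Hermitian matrix is controlled by the trace of an even
power. -/
theorem dotProduct_sq_mulVec_le_of_trace_pow_le {S : Matrix m m ℝ} (hS : S.IsHermitian) {T : ℝ}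
    {p : ℕ} (hp : p ≠ 0) (h : (S ^ (2 * p)).trace ≤ T ^ (2 * p)) (v : m → ℝ) :
    (S *ᵥ v) ⬝ᵥ (S *ᵥ v) ≤ T ^ 2 * (v ⬝ᵥ v) := by
  obtain ⟨U, h1, h2, hpow⟩ := hS.exists_eq_conj_diagonal
  generalize hS.eigenvalues = a at hpow
  have ha : ∀ i, a i ^ 2 ≤ T ^ 2 := by
    intro i
    rw [hpow, Matrix.trace_mul_comm, ← Matrix.mul_assoc, h1, Matrix.one_mul,
      Matrix.trace_diagonal] at h
    -- One eigenvalue is controlled by the whole trace, since even powers are nonnegative.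
    have h4 : a i ^ (2 * p) ≤ T ^ (2 * p) :=
      (Finset.single_le_sum (f := fun i => a i ^ (2 * p))
        (fun j _ => by rw [pow_mul]; positivity) (Finset.mem_univ i)).trans h
    rw [pow_mul, pow_mul] at h4
    exact le_of_pow_le_pow_left₀ hp (sq_nonneg _) h4
  have e1 : (S *ᵥ v) ⬝ᵥ (S *ᵥ v) = v ⬝ᵥ (S ^ 2 *ᵥ v) := by
    rw [Matrix.dotProduct_mulVec, Matrix.vecMul_mulVec, ← Matrix.dotProduct_mulVec, pow_two]
    congr 3
  have e2 : v ⬝ᵥ (S ^ 2 *ᵥ v) = ∑ i, a i ^ 2 * (Uᵀ *ᵥ v) i ^ 2 := by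
    rw [hpow, ← Matrix.mulVec_mulVec, ← Matrix.mulVec_mulVec, Matrix.dotProduct_mulVec,
      ← Matrix.mulVec_transpose, dotProduct]
    refine Finset.sum_congr rfl fun i _ => ?_
    rw [Matrix.mulVec_diagonal]; ring
  have e3 : v ⬝ᵥ v = ∑ i, (Uᵀ *ᵥ v) i ^ 2 := by
    have : v ⬝ᵥ v = (Uᵀ *ᵥ v) ⬝ᵥ (Uᵀ *ᵥ v) := by
      rw [Matrix.dotProduct_mulVec, Matrix.vecMul_mulVec, Matrix.transpose_transpose,
        h2, Matrix.vecMul_one]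
    rw [this, dotProduct]
    simp only [pow_two]
  rw [e1, e2, e3, Finset.mul_sum]
  refine Finset.sum_le_sum fun i _ => ?_
  exact mul_le_mul_of_nonneg_right (ha i) (sq_nonneg _)

end TraceInequalities

/-! ### Bounded random matrices, their means, and the exchangeable pair argument. -/

section RandomMatrices

instance Matrix.instMeasurableSpacePi {m n : Type*} : MeasurableSpace (Matrix m n ℝ) :=
  inferInstanceAs (MeasurableSpace (m → n → ℝ))

theorem Matrix.measurable_iff {Ω m n : Type*} [MeasurableSpace Ω] {X : Ω → Matrix m n ℝ} :
    Measurable X ↔ ∀ a b, Measurable fun ω => X ω a b := by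
  refine ⟨fun h a b => (measurable_pi_apply b).comp ((measurable_pi_apply a).comp h), fun h => ?_⟩
  exact measurable_pi_lambda _ fun a => measurable_pi_lambda _ fun b => h a b

variable {Ω : Type*} [MeasurableSpace Ω] {m : Type*}

/-- A random matrix that is measurable with uniformly bounded entries. -/
structure IsBddMeas (X : Ω → Matrix m m ℝ) : Prop where
  measurable : Measurable X
  bdd : ∃ K, ∀ ω a b, |X ω a b| ≤ K

/-- The entrywise expectation of a random matrix. -/
noncomputable def meanMatrix (X : Ω → Matrix m m ℝ) (μ : Measure Ω) : Matrix m m ℝ :=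
  Matrix.of fun a b => ∫ ω, X ω a b ∂μ

namespace IsBddMeas

variable {X Y : Ω → Matrix m m ℝ} {μ : Measure Ω}

theorem const (A : Matrix m m ℝ) [Finite m] : IsBddMeas fun _ : Ω => A := by
  have := Fintype.ofFinite m
  refine ⟨measurable_const, ∑ a, ∑ b, |A a b|, fun _ a b => ?_⟩
  refine (Finset.single_le_sum (f := fun b => |A a b|) (fun _ _ => abs_nonneg _)
    (Finset.mem_univ b)).trans ?_
  exact Finset.single_le_sum (f := fun a => ∑ b, |A a b|)
    (fun _ _ => Finset.sum_nonneg fun _ _ => abs_nonneg _) (Finset.mem_univ a)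

theorem add (hX : IsBddMeas X) (hY : IsBddMeas Y) : IsBddMeas fun ω => X ω + Y ω := by
  obtain ⟨K, hK⟩ := hX.bdd
  obtain ⟨L, hL⟩ := hY.bdd
  refine ⟨Matrix.measurable_iff.2 fun a b => ?_, K + L, fun ω a b => ?_⟩
  · exact (Matrix.measurable_iff.1 hX.measurable a b).add
      (Matrix.measurable_iff.1 hY.measurable a b)
  · exact (abs_add_le _ _).trans (add_le_add (hK ω a b) (hL ω a b))

theorem neg (hX : IsBddMeas X) : IsBddMeas fun ω => -X ω := by
  obtain ⟨K, hK⟩ := hX.bdd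
  refine ⟨Matrix.measurable_iff.2 fun a b => ?_, K, fun ω a b => ?_⟩
  · exact (Matrix.measurable_iff.1 hX.measurable a b).neg
  · simpa using hK ω a b

theorem sub (hX : IsBddMeas X) (hY : IsBddMeas Y) : IsBddMeas fun ω => X ω - Y ω := by
  simpa [sub_eq_add_neg] using hX.add hY.neg

theorem smul (hX : IsBddMeas X) (c : ℝ) : IsBddMeas fun ω => c • X ω := by
  obtain ⟨K, hK⟩ := hX.bdd
  refine ⟨Matrix.measurable_iff.2 fun a b => ?_, |c| * K, fun ω a b => ?_⟩
  · exact (Matrix.measurable_iff.1 hX.measurable a b).const_mul c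
  · simpa [abs_mul] using mul_le_mul_of_nonneg_left (hK ω a b) (abs_nonneg c)

theorem sum {ι : Type*} (s : Finset ι) {X : ι → Ω → Matrix m m ℝ} [Finite m]
    (h : ∀ i ∈ s, IsBddMeas (X i)) : IsBddMeas fun ω => ∑ i ∈ s, X i ω := by
  classical
  induction s using Finset.induction_on with
  | empty => simpa using const 0
  | insert i s hi ih =>
    simp only [Finset.sum_insert hi]
    exact (h i (Finset.mem_insert_self _ _)).add
      (ih fun j hj => h j (Finset.mem_insert_of_mem hj))

theorem comp {Ω' : Type*} [MeasurableSpace Ω'] (hX : IsBddMeas X) {f : Ω' → Ω}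
    (hf : Measurable f) : IsBddMeas fun ω => X (f ω) :=
  ⟨hX.measurable.comp hf, hX.bdd.imp fun _ hK ω => hK (f ω)⟩

theorem integrable_apply [IsFiniteMeasure μ] (hX : IsBddMeas X) (a b : m) :
    Integrable (fun ω => X ω a b) μ := by
  obtain ⟨K, hK⟩ := hX.bdd
  exact Integrable.of_bound (Matrix.measurable_iff.1 hX.measurable a b).aestronglyMeasurable K
    (ae_of_all _ fun ω => hK ω a b)

theorem meanMatrix_add [IsFiniteMeasure μ] (hX : IsBddMeas X) (hY : IsBddMeas Y) :
    meanMatrix (fun ω => X ω + Y ω) μ = meanMatrix X μ + meanMatrix Y μ := by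
  ext a b
  exact integral_add (hX.integrable_apply a b) (hY.integrable_apply a b)

theorem meanMatrix_sub [IsFiniteMeasure μ] (hX : IsBddMeas X) (hY : IsBddMeas Y) :
    meanMatrix (fun ω => X ω - Y ω) μ = meanMatrix X μ - meanMatrix Y μ := by
  ext a b
  exact integral_sub (hX.integrable_apply a b) (hY.integrable_apply a b)

theorem meanMatrix_smul (c : ℝ) :
    meanMatrix (fun ω => c • X ω) μ = c • meanMatrix X μ := by
  ext a b
  exact integral_const_mul _ _

theorem meanMatrix_const [IsProbabilityMeasure μ] (A : Matrix m m ℝ) :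
    meanMatrix (fun _ => A) μ = A := by
  ext a b
  simp [meanMatrix]

theorem isHermitian_meanMatrix (h : ∀ ω, (X ω).IsHermitian) : (meanMatrix X μ).IsHermitian := by
  ext a b
  simp only [Matrix.conjTranspose_apply, meanMatrix, Matrix.of_apply, star_trivial]
  exact integral_congr_ae (ae_of_all _ fun ω => by simpa using (h ω).apply a b)

variable [Fintype m]

theorem mul (hX : IsBddMeas X) (hY : IsBddMeas Y) : IsBddMeas fun ω => X ω * Y ω := by
  obtain ⟨K, hK⟩ := hX.bdd
  obtain ⟨L, hL⟩ := hY.bdd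
  refine ⟨Matrix.measurable_iff.2 fun a b => ?_, Fintype.card m * (K * L), fun ω a b => ?_⟩
  · simp only [Matrix.mul_apply]
    exact Finset.measurable_fun_sum _ fun j _ => (Matrix.measurable_iff.1 hX.measurable a j).mul
      (Matrix.measurable_iff.1 hY.measurable j b)
  · rw [Matrix.mul_apply]
    refine (Finset.abs_sum_le_sum_abs _ _).trans ?_
    rw [← nsmul_eq_mul, ← Finset.card_univ, ← Finset.sum_const]
    refine Finset.sum_le_sum fun j _ => ?_
    rw [abs_mul]
    exact mul_le_mul (hK ω a j) (hL ω j b) (abs_nonneg _) ((abs_nonneg _).trans (hK ω a j))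

theorem pow [DecidableEq m] (hX : IsBddMeas X) (n : ℕ) : IsBddMeas fun ω => X ω ^ n := by
  induction n with
  | zero => simpa using const 1
  | succ n ih => simpa only [pow_succ] using ih.mul hX

theorem integrable_trace [IsFiniteMeasure μ] (hX : IsBddMeas X) :
    Integrable (fun ω => (X ω).trace) μ := by
  simp only [Matrix.trace, Matrix.diag_apply]
  exact integrable_finsetSum _ fun a _ => hX.integrable_apply a a

theorem integral_trace_mul [IsFiniteMeasure μ] (hX : IsBddMeas X) (A : Matrix m m ℝ) :
    ∫ ω, (X ω * A).trace ∂μ = (meanMatrix X μ * A).trace := by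
  simp only [Matrix.trace, Matrix.diag_apply, Matrix.mul_apply, meanMatrix, Matrix.of_apply]
  rw [integral_finsetSum _ fun a _ => integrable_finsetSum _ fun b _ =>
    (hX.integrable_apply a b).mul_const _]
  refine Finset.sum_congr rfl fun a _ => ?_
  rw [integral_finsetSum _ fun b _ => (hX.integrable_apply a b).mul_const _]
  exact Finset.sum_congr rfl fun b _ => integral_mul_const _ _

theorem meanMatrix_mul_const [IsFiniteMeasure μ] (hX : IsBddMeas X) (A : Matrix m m ℝ) :
    meanMatrix (fun ω => X ω * A) μ = meanMatrix X μ * A := by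
  ext a b
  simp only [meanMatrix, Matrix.of_apply, Matrix.mul_apply]
  rw [integral_finsetSum _ fun c _ => (hX.integrable_apply a c).mul_const _]
  exact Finset.sum_congr rfl fun c _ => integral_mul_const _ _

theorem meanMatrix_const_mul [IsFiniteMeasure μ] (hX : IsBddMeas X) (A : Matrix m m ℝ) :
    meanMatrix (fun ω => A * X ω) μ = A * meanMatrix X μ := by
  ext a b
  simp only [meanMatrix, Matrix.of_apply, Matrix.mul_apply]
  rw [integral_finsetSum _ fun c _ => (hX.integrable_apply c b).const_mul _]
  exact Finset.sum_congr rfl fun c _ => integral_const_mul _ _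

theorem dotProduct_meanMatrix_mulVec [IsFiniteMeasure μ] (hX : IsBddMeas X) (v : m → ℝ) :
    v ⬝ᵥ (meanMatrix X μ *ᵥ v) = ∫ ω, v ⬝ᵥ (X ω *ᵥ v) ∂μ := by
  simp only [dotProduct, Matrix.mulVec, meanMatrix, Matrix.of_apply, Finset.mul_sum]
  rw [integral_finsetSum _ fun a _ => integrable_finsetSum _ fun b _ =>
    ((hX.integrable_apply a b).mul_const _).const_mul _]
  refine Finset.sum_congr rfl fun a _ => ?_
  rw [integral_finsetSum _ fun b _ => ((hX.integrable_apply a b).mul_const _).const_mul _]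
  refine Finset.sum_congr rfl fun b _ => ?_
  rw [integral_const_mul, integral_mul_const]

theorem posSemidef_meanMatrix [IsFiniteMeasure μ] (hX : IsBddMeas X)
    (h : ∀ ω, (X ω).PosSemidef) : (meanMatrix X μ).PosSemidef := by
  refine Matrix.PosSemidef.of_dotProduct_mulVec_nonneg
    (isHermitian_meanMatrix fun ω => (h ω).isHermitian) fun v => ?_
  rw [star_trivial, hX.dotProduct_meanMatrix_mulVec]
  exact integral_nonneg fun ω => by simpa using (h ω).dotProduct_mulVec_nonneg v

end IsBddMeas

variable {μ : Measure Ω} [IsProbabilityMeasure μ]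

/-- If `X` and `T` are independent and `X'` is an independent copy of `X`, then `(X', X, T)` and
`(X, X', T)` have the same law. -/
theorem ProbabilityTheory.IndepFun.identDistrib_exchange {E E' : Type*} [MeasurableSpace E]
    [MeasurableSpace E'] {X : Ω → E} {T : Ω → E'} (hX : Measurable X) (hT : Measurable T)
    (h : IndepFun X T μ) :
    IdentDistrib (fun z : Ω × Ω => (X z.2, (X z.1, T z.1)))
      (fun z : Ω × Ω => (X z.1, (X z.2, T z.1))) (μ.prod μ) (μ.prod μ) := by
  have : IsProbabilityMeasure (μ.map X) := Measure.isProbabilityMeasure_map hX.aemeasurable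
  have : IsProbabilityMeasure (μ.map T) := Measure.isProbabilityMeasure_map hT.aemeasurable
  have hlaw : (μ.prod μ).map (fun z : Ω × Ω => (X z.2, (X z.1, T z.1))) =
      (μ.map X).prod ((μ.map X).prod (μ.map T)) := by
    rw [← (indepFun_iff_map_prod_eq_prod_map_map hX.aemeasurable hT.aemeasurable).1 h,
      Measure.map_prod_map _ _ hX (hX.prodMk hT)]
    nth_rewrite 2 [← Measure.prod_swap]
    rw [Measure.map_map (by fun_prop) measurable_swap]
    rfl
  -- Exchanging the two `X`-coordinates preserves the product of the laws of `X'`, `X` and `T`.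
  have hσ : MeasurePreserving (fun z : E × E × E' => (z.2.1, (z.1, z.2.2)))
      ((μ.map X).prod ((μ.map X).prod (μ.map T))) ((μ.map X).prod ((μ.map X).prod (μ.map T))) := by
    have h1 := (measurePreserving_prodAssoc (μ.map X) (μ.map X) (μ.map T)).symm
    have h2 := (Measure.measurePreserving_swap (μ := μ.map X) (ν := μ.map X)).prod
      (MeasurePreserving.id (μ.map T))
    have h3 := measurePreserving_prodAssoc (μ.map X) (μ.map X) (μ.map T)
    exact h3.comp (h2.comp h1)
  refine ⟨by fun_prop, by fun_prop, ?_⟩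
  rw [hlaw]
  nth_rewrite 1 [← hσ.map_eq]
  rw [← hlaw, Measure.map_map hσ.measurable (by fun_prop)]
  rfl

variable [Fintype m]

/-- On the product space the second coordinate carries an independent copy of `X`, so integrating it
out first replaces it by its mean. -/
theorem integral_prod_trace_mul {X G : Ω → Matrix m m ℝ} (hX : IsBddMeas X) (hG : IsBddMeas G) :
    ∫ z : Ω × Ω, (X z.2 * G z.1).trace ∂(μ.prod μ) = ∫ ω, (meanMatrix X μ * G ω).trace ∂μ := by
  rw [integral_prod _ ((hX.comp measurable_snd).mul (hG.comp measurable_fst)).integrable_trace]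
  exact integral_congr_ae (.of_forall fun ω => by exact hX.integral_trace_mul (G ω))

variable [DecidableEq m]

/-- Exchangeable pairs bound for one independent centered summand. -/
theorem integral_trace_mul_add_pow_le {X T : Ω → Matrix m m ℝ} (hX : IsBddMeas X)
    (hT : IsBddMeas T) (hXh : ∀ ω, (X ω).IsHermitian) (hTh : ∀ ω, (T ω).IsHermitian)
    (hind : IndepFun X T μ) (hmean : meanMatrix X μ = 0) {n : ℕ} (hn : Even n) :
    ∫ ω, (X ω * (X ω + T ω) ^ (n + 1)).trace ∂μ ≤
      (n + 1) * ∫ ω, ((X ω * X ω + meanMatrix (fun ω => X ω * X ω) μ) *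
        (X ω + T ω) ^ n).trace ∂μ := by
  have hX1 := hX.comp (f := fun z : Ω × Ω => z.1) measurable_fst
  have hX2 := hX.comp (f := fun z : Ω × Ω => z.2) measurable_snd
  have hT1 := hT.comp (f := fun z : Ω × Ω => z.1) measurable_fst
  have exch : ∀ {F : Matrix m m ℝ × Matrix m m ℝ × Matrix m m ℝ → ℝ}, Measurable F →
      ∫ z : Ω × Ω, F (X z.2, X z.1, T z.1) ∂(μ.prod μ) =
        ∫ z : Ω × Ω, F (X z.1, X z.2, T z.1) ∂(μ.prod μ) := fun {F} hF =>
    ((hind.identDistrib_exchange hX.measurable hT.measurable).comp hF).integral_eq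
  have fst_int : ∀ f : Ω → ℝ, ∫ z : Ω × Ω, f z.1 ∂(μ.prod μ) = ∫ ω, f ω ∂μ := fun f => by
    simp [integral_fun_fst (μ := μ) (ν := μ) f]
  have hmm : ∀ (f g : (Matrix m m ℝ × Matrix m m ℝ × Matrix m m ℝ) → Matrix m m ℝ),
      Measurable f → Measurable g → Measurable fun z => f z * g z := by
    intro f g hf hg
    refine Matrix.measurable_iff.2 fun a b => ?_
    simp only [Matrix.mul_apply]
    exact Finset.measurable_fun_sum _ fun j _ =>
      (Matrix.measurable_iff.1 hf a j).mul (Matrix.measurable_iff.1 hg j b)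
  have hma : ∀ (f g : (Matrix m m ℝ × Matrix m m ℝ × Matrix m m ℝ) → Matrix m m ℝ),
      Measurable f → Measurable g → Measurable fun z => f z + g z := fun f g hf hg =>
    Matrix.measurable_iff.2 fun a b =>
      (Matrix.measurable_iff.1 hf a b).add (Matrix.measurable_iff.1 hg a b)
  have hms : ∀ (f g : (Matrix m m ℝ × Matrix m m ℝ × Matrix m m ℝ) → Matrix m m ℝ),
      Measurable f → Measurable g → Measurable fun z => f z - g z := fun f g hf hg =>
    Matrix.measurable_iff.2 fun a b =>
      (Matrix.measurable_iff.1 hf a b).sub (Matrix.measurable_iff.1 hg a b)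
  have hmp : ∀ (k : ℕ) (f : (Matrix m m ℝ × Matrix m m ℝ × Matrix m m ℝ) → Matrix m m ℝ),
      Measurable f → Measurable fun z => f z ^ k := by
    intro k f hf
    induction k with
    | zero => simp
    | succ k ih => simpa only [pow_succ] using hmm _ _ ih hf
  have hmt : ∀ (f : (Matrix m m ℝ × Matrix m m ℝ × Matrix m m ℝ) → Matrix m m ℝ),
      Measurable f → Measurable fun z => (f z).trace := by
    intro f hf
    simp only [Matrix.trace, Matrix.diag_apply]
    exact Finset.measurable_fun_sum _ fun a _ => Matrix.measurable_iff.1 hf a a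
  have m1 : Measurable fun z : Matrix m m ℝ × Matrix m m ℝ × Matrix m m ℝ => z.1 := measurable_fst
  have m2 : Measurable fun z : Matrix m m ℝ × Matrix m m ℝ × Matrix m m ℝ => z.2.1 := by fun_prop
  have m3 : Measurable fun z : Matrix m m ℝ × Matrix m m ℝ × Matrix m m ℝ => z.2.2 := by fun_prop
  -- Subtracting the copy costs nothing, as it is centered and independent of `X + T`.
  have s1 : ∫ ω, (X ω * (X ω + T ω) ^ (n + 1)).trace ∂μ =
      ∫ z : Ω × Ω, ((X z.1 - X z.2) * (X z.1 + T z.1) ^ (n + 1)).trace ∂(μ.prod μ) := by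
    simp only [sub_mul, Matrix.trace_sub]
    rw [integral_sub (hX1.mul ((hX1.add hT1).pow _)).integrable_trace
      (hX2.mul ((hX1.add hT1).pow _)).integrable_trace,
      integral_prod_trace_mul (G := fun ω => (X ω + T ω) ^ (n + 1)) hX ((hX.add hT).pow _),
      fst_int fun ω => (X ω * (X ω + T ω) ^ (n + 1)).trace]
    simp [hmean]
  -- Swapping `X` and its copy flips the sign of the first factor. The quantity in `s1` is therefore
  -- half the integral of `tr (X - X') ((X + T)^(n+1) - (X' + T)^(n+1))`, to which the mean value
  -- inequality applies.
  have s2 : ∫ z : Ω × Ω, ((X z.1 - X z.2) * (X z.2 + T z.1) ^ (n + 1)).trace ∂(μ.prod μ) =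
      - ∫ z : Ω × Ω, ((X z.1 - X z.2) * (X z.1 + T z.1) ^ (n + 1)).trace ∂(μ.prod μ) := by
    have := exch (F := fun z => ((z.1 - z.2.1) * (z.2.1 + z.2.2) ^ (n + 1)).trace)
      (hmt _ (hmm _ _ (hms _ _ m1 m2) (hmp _ _ (hma _ _ m2 m3))))
    simp only at this
    rw [← this, ← integral_neg]
    refine integral_congr_ae (ae_of_all _ fun z => ?_)
    simp only
    rw [← Matrix.trace_neg, ← neg_mul, neg_sub]
  have s3 : ∫ z : Ω × Ω, ((X z.1 - X z.2) * (X z.1 - X z.2) * (X z.2 + T z.1) ^ n).trace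
        ∂(μ.prod μ) =
      ∫ z : Ω × Ω, ((X z.1 - X z.2) * (X z.1 - X z.2) * (X z.1 + T z.1) ^ n).trace
        ∂(μ.prod μ) := by
    have := exch (F := fun z => ((z.1 - z.2.1) * (z.1 - z.2.1) * (z.2.1 + z.2.2) ^ n).trace)
      (hmt _ (hmm _ _ (hmm _ _ (hms _ _ m1 m2) (hms _ _ m1 m2)) (hmp _ _ (hma _ _ m2 m3))))
    simp only at this
    rw [← this]
    refine integral_congr_ae (ae_of_all _ fun z => ?_)
    simp only
    rw [← neg_sub (X z.1), neg_mul_neg]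
  have s4 : ∫ z : Ω × Ω, ((X z.1 - X z.2) * (X z.1 - X z.2) * (X z.1 + T z.1) ^ n).trace
        ∂(μ.prod μ) =
      ∫ ω, ((X ω * X ω + meanMatrix (fun ω => X ω * X ω) μ) * (X ω + T ω) ^ n).trace ∂μ := by
    have hG : IsBddMeas fun ω => (X ω + T ω) ^ n := (hX.add hT).pow n
    have hG1 := hG.comp (f := fun z : Ω × Ω => z.1) measurable_fst
    -- Expand the square. The two cross terms are linear in the copy and vanish; its square
    -- contributes the mean of `X²`.
    have e : ∀ z : Ω × Ω, ((X z.1 - X z.2) * (X z.1 - X z.2) * (X z.1 + T z.1) ^ n).trace =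
        (X z.1 * X z.1 * (X z.1 + T z.1) ^ n).trace
        - (X z.2 * ((X z.1 + T z.1) ^ n * X z.1)).trace
        - (X z.2 * (X z.1 * (X z.1 + T z.1) ^ n)).trace
        + (X z.2 * X z.2 * (X z.1 + T z.1) ^ n).trace := by
      intro z
      have : (X z.2 * ((X z.1 + T z.1) ^ n * X z.1)).trace =
          (X z.1 * X z.2 * (X z.1 + T z.1) ^ n).trace := by
        rw [← Matrix.mul_assoc, Matrix.trace_mul_comm, Matrix.mul_assoc]
      rw [this]
      simp only [← Matrix.trace_sub, ← Matrix.trace_add]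
      congr 1
      noncomm_ring
    simp only [e]
    have i1 := ((hX1.mul hX1).mul hG1).integrable_trace (μ := μ.prod μ)
    have i2 := (hX2.mul (hG1.mul hX1)).integrable_trace (μ := μ.prod μ)
    have i3 := (hX2.mul (hX1.mul hG1)).integrable_trace (μ := μ.prod μ)
    have i4 := ((hX2.mul hX2).mul hG1).integrable_trace (μ := μ.prod μ)
    rw [integral_add (by exact (i1.sub i2).sub i3) i4, integral_sub (by exact i1.sub i2) i3,
      integral_sub i1 i2,
      fst_int fun ω => (X ω * X ω * (X ω + T ω) ^ n).trace,
      integral_prod_trace_mul (G := fun ω => (X ω + T ω) ^ n * X ω) hX (hG.mul hX),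
      integral_prod_trace_mul (G := fun ω => X ω * (X ω + T ω) ^ n) hX (hX.mul hG),
      integral_prod_trace_mul (X := fun ω => X ω * X ω) (G := fun ω => (X ω + T ω) ^ n)
        (hX.mul hX) hG]
    simp only [hmean, Matrix.zero_mul, Matrix.trace_zero, integral_zero, sub_zero, add_mul,
      Matrix.trace_add]
    rw [integral_add ((hX.mul hX).mul hG).integrable_trace
      ((IsBddMeas.const _).mul hG).integrable_trace]
  have j1 := ((hX1.sub hX2).mul ((hX1.add hT1).pow (n + 1))).integrable_trace (μ := μ.prod μ)
  have j2 := ((hX1.sub hX2).mul ((hX2.add hT1).pow (n + 1))).integrable_trace (μ := μ.prod μ)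
  have j3 := (((hX1.sub hX2).mul (hX1.sub hX2)).mul
    ((hX1.add hT1).pow n)).integrable_trace (μ := μ.prod μ)
  have j4 := (((hX1.sub hX2).mul (hX1.sub hX2)).mul
    ((hX2.add hT1).pow n)).integrable_trace (μ := μ.prod μ)
  have key := integral_mono (j1.sub j2) ((j3.add j4).const_mul ((n : ℝ) + 1)) fun z => by
    have := trace_sub_mul_pow_sub_pow_le ((hXh z.1).add (hTh z.1)) ((hXh z.2).add (hTh z.1)) hn
    rw [add_sub_add_right_eq_sub, mul_sub, mul_add, Matrix.trace_sub, Matrix.trace_add] at this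
    exact this
  rw [integral_const_mul] at key
  simp only [Pi.sub_apply, Pi.add_apply] at key
  rw [integral_sub j1 j2, integral_add j3 j4, s2, s3, s4] at key
  rw [s1]
  linarith

end RandomMatrices

/-! ### Matrix Bernstein inequality in moment form. -/

section MatrixBernstein

theorem indepFun_comp_others {Ω E F ι : Type*} [MeasurableSpace Ω] [MeasurableSpace E]
    [MeasurableSpace F] {μ : Measure Ω} {X : ι → Ω → E} {φ : ι → E → F}
    (hind : ∀ i, IndepFun (X i) (fun ω (j : {j // j ≠ i}) => X j ω) μ)
    (hφ : ∀ i, Measurable (φ i)) (i : ι) :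
    IndepFun (fun ω => φ i (X i ω)) (fun ω (j : {j // j ≠ i}) => φ j (X j ω)) μ :=
  (hind i).comp (hφ i) (measurable_pi_lambda (fun (f : {j // j ≠ i} → E) (j : {j // j ≠ i}) => φ j (f j))
    fun j => (hφ j).comp (measurable_pi_apply j))

theorem measurable_sub_matrix {m : Type*} (A : Matrix m m ℝ) :
    Measurable fun M : Matrix m m ℝ => M - A :=
  Matrix.measurable_iff.2 fun a b => (Matrix.measurable_iff.1 measurable_id a b).sub_const _

variable {m : Type*}

theorem isHermitian_sum {ι : Type*} {s : Finset ι} {A : ι → Matrix m m ℝ} (h : ∀ i, (A i).IsHermitian) :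
    (∑ i ∈ s, A i).IsHermitian := by
  rw [Matrix.IsHermitian, Matrix.conjTranspose_sum]
  exact Finset.sum_congr rfl fun i _ => h i

theorem Matrix.IsHermitian.mul_self_posSemidef [Fintype m] {A : Matrix m m ℝ} (h : A.IsHermitian) :
    (A * A).PosSemidef := by
  have := Matrix.posSemidef_conjTranspose_mul_self A
  rwa [h.eq] at this

variable [Fintype m] [DecidableEq m] {Ω : Type*} [MeasurableSpace Ω] {μ : Measure Ω}
  [IsProbabilityMeasure μ] {ι : Type*} [Fintype ι] [DecidableEq ι]

/-- Comparison of expected traces against an even power of a random Hermitian matrix. -/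
theorem integral_trace_mul_pow_le {C D S : Ω → Matrix m m ℝ} (hC : IsBddMeas C)
    (hD : IsBddMeas D) (hS : IsBddMeas S) (hSh : ∀ ω, (S ω).IsHermitian)
    (h : ∀ ω, (D ω - C ω).PosSemidef) (q : ℕ) :
    ∫ ω, (C ω * S ω ^ (2 * q)).trace ∂μ ≤ ∫ ω, (D ω * S ω ^ (2 * q)).trace ∂μ := by
  refine integral_mono (hC.mul (hS.pow _)).integrable_trace (hD.mul (hS.pow _)).integrable_trace
    fun ω => ?_
  have := (h ω).trace_mul_pow_two_mul_nonneg (hSh ω) q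
  rw [sub_mul, Matrix.trace_sub] at this
  simpa using this

/-- Moment recursion for a sum of independent centered Hermitian matrices. -/
theorem integral_trace_sum_pow_le {X : ι → Ω → Matrix m m ℝ} (hX : ∀ i, IsBddMeas (X i))
    (hXh : ∀ i ω, (X i ω).IsHermitian)
    (hind : ∀ i, IndepFun (X i) (fun ω (j : {j // j ≠ i}) => X j ω) μ)
    (hmean : ∀ i, meanMatrix (X i) μ = 0) {n : ℕ} (hn : Even n) :
    ∫ ω, ((∑ i, X i ω) ^ (n + 2)).trace ∂μ ≤
      (n + 1) * ∫ ω, ((∑ i, (X i ω * X i ω + meanMatrix (fun ω => X i ω * X i ω) μ)) *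
        (∑ i, X i ω) ^ n).trace ∂μ := by
  have hS : IsBddMeas fun ω => ∑ i, X i ω := .sum _ fun i _ => hX i
  have e1 : ∀ ω, ((∑ i, X i ω) ^ (n + 2)).trace =
      ∑ i, (X i ω * (∑ i, X i ω) ^ (n + 1)).trace := by
    intro ω
    rw [pow_succ', ← Matrix.trace_sum, Finset.sum_mul]
  simp only [e1, Finset.sum_mul, Matrix.trace_sum]
  rw [integral_finsetSum _ fun i _ => ((hX i).mul (hS.pow _)).integrable_trace,
    integral_finsetSum _ fun i _ => ((((hX i).mul (hX i)).add (.const _)).mul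
      (hS.pow _)).integrable_trace, Finset.mul_sum]
  refine Finset.sum_le_sum fun i _ => ?_
  -- The pair bound is applied to each summand, with the sum of all the others as the independent
  -- part.
  have hsplit : ∀ ω, ∑ j, X j ω = X i ω + ∑ j : {j // j ≠ i}, X j ω := by
    intro ω
    rw [← Finset.add_sum_erase _ _ (Finset.mem_univ i)]
    congr 1
    refine Finset.sum_subtype (p := fun j => j ≠ i) _ (by simp) _
  simp only [hsplit]
  have hT : IsBddMeas fun ω => ∑ j : {j // j ≠ i}, X j ω := .sum _ fun j _ => hX j
  refine integral_trace_mul_add_pow_le (hX i) hT (hXh i) (fun ω => ?_) ?_ (hmean i) hn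
  · exact isHermitian_sum fun j => hXh _ _
  · refine (hind i).comp (φ := id) (ψ := fun f => ∑ j : {j // j ≠ i}, f j) measurable_id ?_
    refine Matrix.measurable_iff.2 fun a b => ?_
    simp only [Matrix.sum_apply]
    exact Finset.measurable_fun_sum _ fun j _ =>
      Matrix.measurable_iff.1 (measurable_pi_apply j) a b

/-- The difference is the square `(A + B)²`. -/
theorem two_mul_add_sub_sub_mul_sub_posSemidef {A B : Matrix m m ℝ} (hA : A.IsHermitian)
    (hB : B.IsHermitian) : ((2 : ℝ) • (A * A + B * B) - (A - B) * (A - B)).PosSemidef := by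
  have : (2 : ℝ) • (A * A + B * B) - (A - B) * (A - B) = (A + B) * (A + B) := by
    rw [two_smul]
    noncomm_ring
  rw [this]
  exact (hA.add hB).mul_self_posSemidef

theorem meanMatrix_mul_self_sub_posSemidef {X : Ω → Matrix m m ℝ} (hX : IsBddMeas X)
    (hXh : ∀ ω, (X ω).IsHermitian) :
    meanMatrix (fun ω => (X ω - meanMatrix X μ) * (X ω - meanMatrix X μ)) μ =
      meanMatrix (fun ω => X ω * X ω) μ - meanMatrix X μ * meanMatrix X μ ∧
    (meanMatrix (fun ω => X ω * X ω) μ - meanMatrix X μ * meanMatrix X μ).PosSemidef := by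
  have hc : IsBddMeas fun _ : Ω => meanMatrix X μ := .const _
  have e : meanMatrix (fun ω => (X ω - meanMatrix X μ) * (X ω - meanMatrix X μ)) μ =
      meanMatrix (fun ω => X ω * X ω) μ - meanMatrix X μ * meanMatrix X μ := by
    have : ∀ ω, (X ω - meanMatrix X μ) * (X ω - meanMatrix X μ) =
        X ω * X ω - (X ω * meanMatrix X μ + meanMatrix X μ * X ω -
          meanMatrix X μ * meanMatrix X μ) := fun ω => by noncomm_ring
    simp only [this]
    rw [IsBddMeas.meanMatrix_sub (hX.mul hX) (((hX.mul hc).add (hc.mul hX)).sub (hc.mul hc)),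
      IsBddMeas.meanMatrix_sub ((hX.mul hc).add (hc.mul hX)) (hc.mul hc),
      IsBddMeas.meanMatrix_add (hX.mul hc) (hc.mul hX), IsBddMeas.meanMatrix_mul_const hX,
      IsBddMeas.meanMatrix_const_mul hX, IsBddMeas.meanMatrix_const]
    simp
  refine ⟨e, ?_⟩
  rw [← e]
  exact ((hX.sub hc).mul (hX.sub hc)).posSemidef_meanMatrix fun ω =>
    ((hXh ω).sub (IsBddMeas.isHermitian_meanMatrix hXh)).mul_self_posSemidef

/-- Even trace moments of a sum of independent positive semidefinite matrices around its mean. -/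
theorem integral_trace_sum_sub_mean_pow_le {A : ι → Ω → Matrix m m ℝ}
    (hA : ∀ i, IsBddMeas (A i)) (hAh : ∀ i ω, (A i ω).IsHermitian)
    (hind : ∀ i, IndepFun (A i) (fun ω (j : {j // j ≠ i}) => A j ω) μ) {ρ v : ℝ} (hρ : 0 ≤ ρ)
    (hv : 0 ≤ v) (hAρ : ∀ i ω, (ρ • A i ω - A i ω * A i ω).PosSemidef)
    (hAv : (v • (1 : Matrix m m ℝ) - ∑ i, meanMatrix (A i) μ).PosSemidef) (p q : ℕ)
    (hq : 2 * q ≤ p) :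
    ∫ ω, ((∑ i, (A i ω - meanMatrix (A i) μ)) ^ (2 * q)).trace ∂μ ≤
      Fintype.card m * (2 * p * ρ + 2 * v) ^ (2 * q) := by
  induction q with
  | zero => simp
  | succ q ih =>
    have ih := ih (by omega)
    set W : Ω → Matrix m m ℝ := fun ω => ∑ i, (A i ω - meanMatrix (A i) μ) with hW
    have hY : ∀ i, IsBddMeas fun ω => A i ω - meanMatrix (A i) μ := fun i => (hA i).sub (.const _)
    have hWb : IsBddMeas W := .sum _ fun i _ => hY i
    have hmh : ∀ i, (meanMatrix (A i) μ).IsHermitian := fun i =>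
      IsBddMeas.isHermitian_meanMatrix (hAh i)
    have hYh : ∀ i ω, (A i ω - meanMatrix (A i) μ).IsHermitian := fun i ω =>
      (hAh i ω).sub (hmh i)
    have hWh : ∀ ω, (W ω).IsHermitian := fun ω => isHermitian_sum fun i => hYh i ω
    have h1 := integral_trace_sum_pow_le (μ := μ) (n := 2 * q) hY hYh
      (fun i => indepFun_comp_others (φ := fun i M => M - meanMatrix (A i) μ) hind
      (fun j => measurable_sub_matrix _) i)
      (fun i => by
        rw [IsBddMeas.meanMatrix_sub (hA i) (.const _), IsBddMeas.meanMatrix_const, sub_self])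
      (even_two_mul q)
    -- Since `A² ≤ ρ A`, each `(A - E A)² + E (A - E A)²` is at most `2ρ (A + E A)`. Summation gives
    -- `2ρ W + 4ρ ∑ E Aᵢ ≤ 2ρ W + 4ρ v`, which closes the recursion in terms of `W` itself.
    have h2 := integral_trace_mul_pow_le (μ := μ)
      (C := fun ω => ∑ i, ((A i ω - meanMatrix (A i) μ) * (A i ω - meanMatrix (A i) μ) +
        meanMatrix (fun ω => (A i ω - meanMatrix (A i) μ) * (A i ω - meanMatrix (A i) μ)) μ))
      (D := fun ω => (2 * ρ) • W ω + (4 * ρ * v) • (1 : Matrix m m ℝ)) (S := W)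
      (.sum _ fun i _ => ((hY i).mul (hY i)).add (.const _))
      ((hWb.smul _).add (.const _)) hWb hWh (fun ω => by
        have hsum : (∑ i, ((2 * ρ) • (A i ω + meanMatrix (A i) μ) -
            ((A i ω - meanMatrix (A i) μ) * (A i ω - meanMatrix (A i) μ) +
              meanMatrix (fun ω => (A i ω - meanMatrix (A i) μ) *
                (A i ω - meanMatrix (A i) μ)) μ))).PosSemidef := by
          refine Matrix.posSemidef_sum _ fun i _ => ?_
          obtain ⟨e, hp⟩ := meanMatrix_mul_self_sub_posSemidef (μ := μ) (hA i) (hAh i)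
          have p1 := two_mul_add_sub_sub_mul_sub_posSemidef (hAh i ω) (hmh i)
          have p2 := (((hA i).smul ρ).sub ((hA i).mul (hA i))).posSemidef_meanMatrix (μ := μ)
            (hAρ i)
          rw [IsBddMeas.meanMatrix_sub ((hA i).smul ρ) ((hA i).mul (hA i)),
            IsBddMeas.meanMatrix_smul] at p2
          have p3 := hAρ i ω
          rw [e]
          have := (p1.add ((p3.add p2).smul (zero_le_two (α := ℝ)))).add hp
          convert this using 1
          module
        have := hsum.add (hAv.smul (α := ℝ) (show (0 : ℝ) ≤ 4 * ρ by positivity))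
        convert this using 1
        simp only [hW, Finset.sum_sub_distrib, Finset.sum_add_distrib, ← Finset.smul_sum]
        module) q
    have e3 : ∀ ω, (((2 * ρ) • W ω + (4 * ρ * v) • (1 : Matrix m m ℝ)) * W ω ^ (2 * q)).trace =
        (2 * ρ) * (W ω ^ (2 * q + 1)).trace + (4 * ρ * v) * (W ω ^ (2 * q)).trace := by
      intro ω
      rw [add_mul, smul_mul_assoc, smul_mul_assoc, one_mul, Matrix.trace_add, Matrix.trace_smul,
        Matrix.trace_smul, pow_succ']
      rfl
    have i0 := (hWb.pow (2 * q)).integrable_trace (μ := μ)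
    have i1 := (hWb.pow (2 * q + 1)).integrable_trace (μ := μ)
    have i2 := (hWb.pow (2 * q + 2)).integrable_trace (μ := μ)
    simp only [e3] at h2
    rw [integral_add (i1.const_mul _) (i0.const_mul _), integral_const_mul,
      integral_const_mul] at h2
    -- With this `K` the recursion reads `m₂ ≤ K m₁ + 2 K v m₀` for consecutive moments. The odd one
    -- satisfies `K m₁ ≤ m₂ / 2 + K² m₀ / 2`, so `m₂ ≤ (K² + 4 K v) m₀`.
    set K : ℝ := (2 * q + 1) * (2 * ρ) with hK
    have hKp : K ≤ 2 * p * ρ := by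
      have : (2 * q + 1 : ℝ) ≤ p := by exact_mod_cast (by omega : 2 * q + 1 ≤ p)
      rw [hK]
      nlinarith
    have hK0 : 0 ≤ K := by positivity
    have h3 : 2 * K * ∫ ω, (W ω ^ (2 * q + 1)).trace ∂μ ≤
        ∫ ω, (W ω ^ (2 * q + 2)).trace ∂μ + K ^ 2 * ∫ ω, (W ω ^ (2 * q)).trace ∂μ := by
      rw [← integral_const_mul, ← integral_const_mul, ← integral_add i2 (i0.const_mul _)]
      exact integral_mono (i1.const_mul _) (i2.add (i0.const_mul _)) fun ω =>
        trace_pow_odd_le (hWh ω) K q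
    have h4 : 0 ≤ ∫ ω, (W ω ^ (2 * q)).trace ∂μ := integral_nonneg fun ω => by
      have := Matrix.PosSemidef.one.trace_mul_pow_two_mul_nonneg (hWh ω) q
      simpa using this
    have h5 := h1.trans (mul_le_mul_of_nonneg_left h2 (by positivity))
    push_cast at h5
    have h6 : ∫ ω, (W ω ^ (2 * q + 2)).trace ∂μ ≤
        (2 * p * ρ + 2 * v) ^ 2 * ∫ ω, (W ω ^ (2 * q)).trace ∂μ := by
      have : (K ^ 2 + 4 * K * v) ≤ (2 * p * ρ + 2 * v) ^ 2 := by
        calc K ^ 2 + 4 * K * v ≤ (K + 2 * v) ^ 2 := by nlinarith [sq_nonneg v]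
          _ ≤ _ := by gcongr
      have := mul_le_mul_of_nonneg_right this h4
      simp only [hK] at *
      nlinarith
    rw [show 2 * (q + 1) = 2 * q + 2 from rfl]
    calc _ ≤ _ := h6
      _ ≤ (2 * p * ρ + 2 * v) ^ 2 * (Fintype.card m * (2 * p * ρ + 2 * v) ^ (2 * q)) := by
        gcongr
      _ = _ := by ring

/-- The recursion leaves `∑ Xᵢ²` in front of a power of `S`. It is split into its mean, bounded by
`v`, and its fluctuation `W`. Young's inequality detaches both from `S`, and the moments of `W` are
known from the positive semidefinite case. -/
theorem integral_trace_centered_sum_pow_le {X : ι → Ω → Matrix m m ℝ}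
    (hX : ∀ i, IsBddMeas (X i)) (hXh : ∀ i ω, (X i ω).IsHermitian)
    (hind : ∀ i, IndepFun (X i) (fun ω (j : {j // j ≠ i}) => X j ω) μ)
    (hmean : ∀ i, meanMatrix (X i) μ = 0) {ρ v : ℝ} (hρ : 0 ≤ ρ)
    (hv : 0 ≤ v) (hXρ : ∀ i ω, (ρ • (1 : Matrix m m ℝ) - X i ω * X i ω).PosSemidef)
    (hXv : (v • (1 : Matrix m m ℝ) - ∑ i, meanMatrix (fun ω => X i ω * X i ω) μ).PosSemidef)
    {p : ℕ} (hp : Even p) (hp0 : p ≠ 0) :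
    ∫ ω, ((∑ i, X i ω) ^ (2 * p)).trace ∂μ ≤
      Fintype.card m * (16 * p * (p * ρ + v)) ^ p := by
  obtain ⟨r, rfl⟩ : ∃ r, p = r + 1 := Nat.exists_eq_succ_of_ne_zero hp0
  obtain ⟨q, hq⟩ := hp
  set S : Ω → Matrix m m ℝ := fun ω => ∑ i, X i ω with hS
  have hSb : IsBddMeas S := .sum _ fun i _ => hX i
  have hSh : ∀ ω, (S ω).IsHermitian := fun ω => isHermitian_sum fun i => hXh i ω
  have hA : ∀ i, IsBddMeas fun ω => X i ω * X i ω := fun i => (hX i).mul (hX i)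
  have hAh : ∀ i ω, (X i ω * X i ω).IsHermitian := fun i ω =>
    (hXh i ω).mul_self_posSemidef.isHermitian
  set W : Ω → Matrix m m ℝ := fun ω =>
    ∑ i, (X i ω * X i ω - meanMatrix (fun ω => X i ω * X i ω) μ) with hW
  have hWb : IsBddMeas W := .sum _ fun i _ => (hA i).sub (.const _)
  have hWh : ∀ ω, (W ω).IsHermitian := fun ω => isHermitian_sum fun i =>
    (hAh i ω).sub (IsBddMeas.isHermitian_meanMatrix (hAh i))
  have hsq : Measurable fun M : Matrix m m ℝ => M * M := Matrix.measurable_iff.2 fun a b => by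
    simp only [Matrix.mul_apply]
    exact Finset.measurable_fun_sum _ fun c _ =>
      (Matrix.measurable_iff.1 measurable_id a c).mul (Matrix.measurable_iff.1 measurable_id c b)
  -- The squares qualify because `ρ X² - X⁴ = X (ρ - X²) X` is positive semidefinite. Evenness of
  -- `p` makes `p = 2q` an admissible moment of `W`.
  have hWq := integral_trace_sum_sub_mean_pow_le (μ := μ) hA hAh
    (fun i => indepFun_comp_others (φ := fun _ M => M * M) hind (fun _ => hsq) i) hρ hv
    (fun i ω => by
      have := (hXρ i ω).conjTranspose_mul_mul_same (X i ω)
      rw [(hXh i ω).eq] at this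
      convert this using 1
      simp only [mul_sub, sub_mul, mul_smul_comm, smul_mul_assoc, mul_one, mul_assoc]) hXv
    (r + 1) q (by omega)
  rw [show 2 * q = r + 1 by omega] at hWq
  have h1 := integral_trace_sum_pow_le (μ := μ) hX hXh hind hmean (even_two_mul r)
  have h2 := integral_trace_mul_pow_le (μ := μ)
      (C := fun ω => ∑ i, (X i ω * X i ω + meanMatrix (fun ω => X i ω * X i ω) μ))
      (D := fun ω => W ω + (2 : ℝ) • (v • (1 : Matrix m m ℝ))) (S := S)
      (.sum _ fun i _ => (hA i).add (.const _)) (hWb.add (.const _)) hSb hSh (fun ω => by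
        convert hXv.smul (α := ℝ) (show (0 : ℝ) ≤ 2 by positivity) using 1
        simp only [hW, Finset.sum_sub_distrib, Finset.sum_add_distrib]
        module) r
  set K : ℝ := 2 * r + 1 with hK
  have hK0 : 0 ≤ K := by positivity
  have i1 := (hWb.mul (hSb.pow (2 * r))).integrable_trace (μ := μ)
  have i2 := ((IsBddMeas.const (v • (1 : Matrix m m ℝ))).mul
    (hSb.pow (2 * r))).integrable_trace (μ := μ)
  have i3 := (hWb.pow (r + 1)).integrable_trace (μ := μ)
  have i4 := (hSb.pow (2 * (r + 1))).integrable_trace (μ := μ)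
  have hev : Even (r + 1) := ⟨q, hq⟩
  have y1 : K * ∫ ω, (W ω * S ω ^ (2 * r)).trace ∂μ ≤
      4 ^ r * K ^ (r + 1) * ∫ ω, (W ω ^ (r + 1)).trace ∂μ +
        (∫ ω, (S ω ^ (2 * (r + 1))).trace ∂μ) / 4 := by
    rw [← integral_const_mul, ← integral_const_mul, ← integral_div,
      ← integral_add (i3.const_mul _) (i4.div_const _)]
    exact integral_mono (i1.const_mul _) ((i3.const_mul _).add (i4.div_const _)) fun ω =>
      trace_mul_pow_le_young (hWh ω) (hSh ω) hK0 hev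
  have y2 : (2 * K) * ∫ ω, ((v • (1 : Matrix m m ℝ)) * S ω ^ (2 * r)).trace ∂μ ≤
      4 ^ r * (2 * K) ^ (r + 1) * (v ^ (r + 1) * Fintype.card m) +
        (∫ ω, (S ω ^ (2 * (r + 1))).trace ∂μ) / 4 := by
    have e : v ^ (r + 1) * (Fintype.card m : ℝ) =
        ∫ _ω, ((v • (1 : Matrix m m ℝ)) ^ (r + 1)).trace ∂μ := by
      simp [smul_pow, Matrix.trace_smul]
    rw [e, ← integral_const_mul, ← integral_const_mul, ← integral_div,
      ← integral_add ((integrable_const _).const_mul _) (i4.div_const _)]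
    refine integral_mono (i2.const_mul _)
      (((integrable_const _).const_mul _).add (i4.div_const _)) fun ω =>
      trace_mul_pow_le_young ?_ (hSh ω) (by positivity) hev
    simp [Matrix.IsHermitian]
  have e2 : ∫ ω, ((W ω + (2 : ℝ) • (v • (1 : Matrix m m ℝ))) * S ω ^ (2 * r)).trace ∂μ =
      ∫ ω, (W ω * S ω ^ (2 * r)).trace ∂μ +
        2 * ∫ ω, ((v • (1 : Matrix m m ℝ)) * S ω ^ (2 * r)).trace ∂μ := by
    rw [← integral_const_mul, ← integral_add i1 (i2.const_mul _)]
    refine integral_congr_ae (.of_forall fun ω => ?_)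
    simp only
    rw [add_mul, smul_mul_assoc (2 : ℝ), Matrix.trace_add, Matrix.trace_smul, smul_eq_mul]
  rw [e2] at h2
  have h3 := h1.trans (mul_le_mul_of_nonneg_left h2 (by positivity))
  push_cast at h3
  rw [← hK, show 2 * r + 2 = 2 * (r + 1) from rfl] at h3
  set τ : ℝ := 2 * (r + 1 : ℕ) * ρ + 2 * v with hτ
  have hτ0 : 0 ≤ τ := by positivity
  -- The two applications of Young each return a quarter of the left side. Absorbing them costs the
  -- factor 2.
  have h4 : ∫ ω, (S ω ^ (2 * (r + 1))).trace ∂μ ≤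
      2 * (4 ^ r * K ^ (r + 1) * (Fintype.card m * τ ^ (r + 1)) +
        4 ^ r * (2 * K) ^ (r + 1) * (v ^ (r + 1) * Fintype.card m)) := by
    have := mul_le_mul_of_nonneg_left hWq (show 0 ≤ 4 ^ r * K ^ (r + 1) by positivity)
    simp only [hS] at *
    linarith
  refine h4.trans ?_
  have h5 : (2 * v) ^ (r + 1) ≤ τ ^ (r + 1) := by
    gcongr
    rw [hτ]
    have : 0 ≤ 2 * ((r + 1 : ℕ) : ℝ) * ρ := by positivity
    linarith
  calc _ = 2 * 4 ^ r * Fintype.card m * K ^ (r + 1) * (τ ^ (r + 1) + (2 * v) ^ (r + 1)) := by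
        rw [mul_pow 2 K, mul_pow 2 v]; ring
    _ ≤ 2 * 4 ^ r * Fintype.card m * K ^ (r + 1) * (τ ^ (r + 1) + τ ^ (r + 1)) := by gcongr
    _ = Fintype.card m * (4 * K * τ) ^ (r + 1) := by rw [mul_pow, mul_pow]; ring
    _ ≤ Fintype.card m * (4 * (2 * (r + 1 : ℕ)) * τ) ^ (r + 1) := by
        gcongr
        rw [hK]; push_cast; linarith
    _ = _ := by rw [hτ]; congr 2; ring

/-- **Matrix Bernstein inequality**, in moment form. -/
theorem integral_trace_sum_sub_meanMatrix_pow_le {X : ι → Ω → Matrix m m ℝ}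
    (hX : ∀ i, IsBddMeas (X i)) (hXh : ∀ i ω, (X i ω).IsHermitian)
    (hind : ∀ i, IndepFun (X i) (fun ω (j : {j // j ≠ i}) => X j ω) μ) {ρ v : ℝ} (hρ : 0 ≤ ρ)
    (hv : 0 ≤ v) (hXρ : ∀ i ω, (ρ • (1 : Matrix m m ℝ) - X i ω * X i ω).PosSemidef)
    (hXv : (v • (1 : Matrix m m ℝ) - ∑ i, meanMatrix (fun ω => X i ω * X i ω) μ).PosSemidef)
    {p : ℕ} (hp : Even p) (hp0 : p ≠ 0) :
    ∫ ω, ((∑ i, (X i ω - meanMatrix (X i) μ)) ^ (2 * p)).trace ∂μ ≤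
      Fintype.card m * (16 * p * (p * (4 * ρ) + v)) ^ p := by
  have hmh : ∀ i, (meanMatrix (X i) μ).IsHermitian := fun i =>
    IsBddMeas.isHermitian_meanMatrix (hXh i)
  refine integral_trace_centered_sum_pow_le (fun i => (hX i).sub (.const _))
    (fun i ω => (hXh i ω).sub (hmh i))
    (fun i => indepFun_comp_others (φ := fun i M => M - meanMatrix (X i) μ) hind
      (fun j => measurable_sub_matrix _) i)
    (fun i => by
        rw [IsBddMeas.meanMatrix_sub (hX i) (.const _), IsBddMeas.meanMatrix_const, sub_self])
    (by positivity) hv (fun i ω => ?_) ?_ hp hp0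
  -- Centering costs a factor 4: `(X - E X)² ≤ 2 X² + 2 (E X)² ≤ 4ρ`.
  · have p1 := two_mul_add_sub_sub_mul_sub_posSemidef (hXh i ω) (hmh i)
    have p2 := (meanMatrix_mul_self_sub_posSemidef (μ := μ) (hX i) (hXh i)).2
    have p3 := ((IsBddMeas.const (ρ • (1 : Matrix m m ℝ))).sub
      ((hX i).mul (hX i))).posSemidef_meanMatrix (μ := μ) (hXρ i)
    rw [IsBddMeas.meanMatrix_sub (.const _) ((hX i).mul (hX i)), IsBddMeas.meanMatrix_const] at p3
    have := p1.add (((hXρ i ω).add (p3.add p2)).smul (zero_le_two (α := ℝ)))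
    convert this using 1
    module
  -- Centering only lowers the second moments.
  · have : (∑ i, meanMatrix (X i) μ * meanMatrix (X i) μ).PosSemidef :=
      Matrix.posSemidef_sum _ fun i _ => (hmh i).mul_self_posSemidef
    convert hXv.add this using 1
    simp only [fun i => (meanMatrix_mul_self_sub_posSemidef (μ := μ) (hX i) (hXh i)).1,
      Finset.sum_sub_distrib]
    module

end MatrixBernstein

/-! ### Perturbation of singular subspaces. -/

section SinTheta

variable {d k : ℕ}

theorem norm_toLp_sq {m : Type*} [Fintype m] (v : m → ℝ) :
    ‖WithLp.toLp 2 v‖ ^ 2 = ∑ i, v i ^ 2 := by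
  simp [EuclideanSpace.norm_sq_eq]

theorem norm_toLp_sq_eq_dotProduct {m : Type*} [Fintype m] (v : m → ℝ) :
    ‖WithLp.toLp 2 v‖ ^ 2 = v ⬝ᵥ v := by
  rw [norm_toLp_sq, dotProduct]
  simp only [pow_two]

theorem norm_toLp_mulVec_of_transpose_mul_self {m n : Type*} [Fintype m] [Fintype n]
    [DecidableEq n] {U : Matrix m n ℝ} (h : Uᵀ * U = 1) (v : n → ℝ) :
    ‖WithLp.toLp 2 (U *ᵥ v)‖ = ‖WithLp.toLp 2 v‖ := by
  rw [← sq_eq_sq₀ (norm_nonneg _) (norm_nonneg _), norm_toLp_sq_eq_dotProduct,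
    norm_toLp_sq_eq_dotProduct, Matrix.dotProduct_mulVec, Matrix.vecMul_mulVec, h,
    Matrix.vecMul_one]

theorem norm_toLp_le_of_abs_le {m : Type*} [Fintype m] {v w : m → ℝ} {c : ℝ} (hc : 0 ≤ c)
    (h : ∀ i, |v i| ≤ c * |w i|) : ‖WithLp.toLp 2 v‖ ≤ c * ‖WithLp.toLp 2 w‖ := by
  rw [← sq_le_sq₀ (norm_nonneg _) (by positivity), mul_pow, norm_toLp_sq, norm_toLp_sq,
    Finset.mul_sum]
  refine Finset.sum_le_sum fun i _ => ?_
  rw [← sq_abs, ← sq_abs (w i), ← mul_pow]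
  exact pow_le_pow_left₀ (abs_nonneg _) (h i) 2

open scoped Matrix.Norms.L2Operator in
theorem Matrix.l2_opNorm_le_of_forall {m n : Type*} [Fintype m] [Fintype n] [DecidableEq n]
    {A : Matrix m n ℝ} {c : ℝ} (hc : 0 ≤ c)
    (h : ∀ v : n → ℝ, ‖WithLp.toLp 2 (A *ᵥ v)‖ ≤ c * ‖WithLp.toLp 2 v‖) : ‖A‖ ≤ c := by
  rw [Matrix.l2_opNorm_def]
  refine ContinuousLinearMap.opNorm_le_bound _ hc fun v => ?_
  exact h v.ofLp

open scoped Matrix.Norms.L2Operator in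
theorem Matrix.norm_toLp_mulVec_le {m n : Type*} [Fintype m] [Fintype n] [DecidableEq n]
    {A : Matrix m n ℝ} {c : ℝ} (h : ‖A‖ ≤ c) (v : n → ℝ) :
    ‖WithLp.toLp 2 (A *ᵥ v)‖ ≤ c * ‖WithLp.toLp 2 v‖ :=
  (Matrix.l2_opNorm_mulVec A (WithLp.toLp 2 v)).trans
    (mul_le_mul_of_nonneg_right h (norm_nonneg _))

/-- A wide real matrix has a nonzero null vector. -/
theorem Matrix.exists_ne_zero_mulVec_eq_zero {a b : ℕ} (h : b < a)
    (A : Matrix (Fin b) (Fin a) ℝ) : ∃ c : Fin a → ℝ, c ≠ 0 ∧ A *ᵥ c = 0 := by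
  have := LinearMap.ker_ne_bot_of_finrank_lt (f := A.mulVecLin) (by simpa using h)
  obtain ⟨c, hc, h0⟩ := (Submodule.ne_bot_iff _).1 this
  exact ⟨c, h0, by simpa using hc⟩

/-- Weyl-type bounds on the singular values around the gap, when `Z` is close to a matrix
vanishing on the orthogonal complement of `range B` and bounded below on `range B`. -/
theorem IsSVD.singular_gap {Z E U V : Matrix (Fin d) (Fin d) ℝ} {s : Fin d → ℝ}
    (h : IsSVD Z U s V) {B : Matrix (Fin d) (Fin k) ℝ} (hB : Bᵀ * B = 1) {γ ε : ℝ}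
    (hEB : E * (B * Bᵀ) = E)
    (hγ : ∀ v : Fin d → ℝ, γ * ‖WithLp.toLp 2 ((B * Bᵀ) *ᵥ v)‖ ≤ ‖WithLp.toLp 2 (E *ᵥ v)‖)
    (hZ : ∀ v : Fin d → ℝ, ‖WithLp.toLp 2 ((Z - E) *ᵥ v)‖ ≤ ε * ‖WithLp.toLp 2 v‖) (r : Fin d) :
    (k ≤ r.val → s r ≤ ε) ∧ (r.val < k → γ - ε ≤ s r) := by
  have hU : Uᵀ * U = 1 := (Matrix.mem_orthogonalGroup_iff' _ _).1 h.left_orthogonal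
  have hV : Vᵀ * V = 1 := (Matrix.mem_orthogonalGroup_iff' _ _).1 h.right_orthogonal
  have hV' : V * Vᵀ = 1 := (Matrix.mem_orthogonalGroup_iff _ _).1 h.right_orthogonal
  have hVt : Vᵀᵀ * Vᵀ = 1 := by rwa [Matrix.transpose_transpose]
  have hZv : ∀ v : Fin d → ℝ, ‖WithLp.toLp 2 (Z *ᵥ v)‖ =
      ‖WithLp.toLp 2 (fun i => s i * (Vᵀ *ᵥ v) i)‖ := by
    intro v
    rw [h.eq, ← Matrix.mulVec_mulVec, ← Matrix.mulVec_mulVec,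
      norm_toLp_mulVec_of_transpose_mul_self hU]
    congr 2
    ext i
    rw [Matrix.mulVec_diagonal]
  constructor
  · intro hr
    -- The span of the first `r + 1 > k` right singular vectors contains a nonzero `w` with `Bᵀ w =
    -- 0`. There `E w = 0`, so `s r ‖w‖ ≤ ‖Z w‖ ≤ ε ‖w‖`.
    obtain ⟨c, hc0, hc⟩ := Matrix.exists_ne_zero_mulVec_eq_zero (Nat.lt_succ_of_le hr)
      (Bᵀ * V.submatrix id (Fin.castLE r.isLt))
    set w : Fin d → ℝ := V.submatrix id (Fin.castLE r.isLt) *ᵥ c with hw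
    have hVw : ∀ i, (Vᵀ *ᵥ w) i = ∑ j, if Fin.castLE r.isLt j = i then c j else 0 := by
      intro i
      have e : V.submatrix id (Fin.castLE r.isLt) =
          V * (1 : Matrix (Fin d) (Fin d) ℝ).submatrix id (Fin.castLE r.isLt) := by
        ext a b; simp [Matrix.mul_apply, Matrix.one_apply]
      rw [hw, e, Matrix.mulVec_mulVec, ← Matrix.mul_assoc, hV, Matrix.one_mul]
      simp only [Matrix.mulVec, dotProduct, Matrix.submatrix_apply, Matrix.one_apply, id]
      refine Finset.sum_congr rfl fun j _ => ?_
      split_ifs with h1 h2 h2 <;> simp_all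
    have hVw0 : ∀ i : Fin d, r < i → (Vᵀ *ᵥ w) i = 0 := by
      intro i hi
      rw [hVw]
      refine Finset.sum_eq_zero fun j _ => if_neg fun hj => ?_
      have : (i : ℕ) = j := by rw [← hj]; rfl
      have := j.isLt
      have : (r : ℕ) < i := hi
      omega
    have hw0 : 0 < ‖WithLp.toLp 2 w‖ := by
      rw [norm_pos_iff]
      intro h0
      have hw00 : w = 0 := by simpa using congrArg WithLp.ofLp h0
      refine hc0 (funext fun j => ?_)
      have := hVw (Fin.castLE r.isLt j)
      rw [hw00, Matrix.mulVec_zero] at this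
      simpa [Fin.castLE_inj] using this.symm
    have hEw : E *ᵥ w = 0 := by
      rw [← hEB, hw, ← Matrix.mulVec_mulVec, ← Matrix.mulVec_mulVec, Matrix.mulVec_mulVec c,
        hc, Matrix.mulVec_zero, Matrix.mulVec_zero]
    have h1 := hZ w
    rw [Matrix.sub_mulVec, hEw, sub_zero, hZv] at h1
    have h2 : s r * ‖WithLp.toLp 2 w‖ ≤ ‖WithLp.toLp 2 (fun i => s i * (Vᵀ *ᵥ w) i)‖ := by
      rw [← norm_toLp_mulVec_of_transpose_mul_self hVt w,
        ← sq_le_sq₀ (mul_nonneg (h.nonneg r) (norm_nonneg _)) (norm_nonneg _), mul_pow,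
        norm_toLp_sq, norm_toLp_sq, Finset.mul_sum]
      refine Finset.sum_le_sum fun i _ => ?_
      rcases lt_or_ge r i with hi | hi
      · simp [hVw0 i hi]
      · rw [← mul_pow]
        rw [mul_pow, mul_pow]
        have := pow_le_pow_left₀ (h.nonneg r) (h.antitone hi) 2
        exact mul_le_mul_of_nonneg_right this (sq_nonneg _)
    exact le_of_mul_le_mul_right (h2.trans h1) hw0
  · intro hr
    -- The range of `B` has dimension `k > r`, so it contains a nonzero `w` orthogonal to the first
    -- `r` right singular vectors (indices below `r`). There `‖Z w‖ ≤ s r ‖w‖`, while `‖E w‖ ≥ γ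
    -- ‖w‖`.
    obtain ⟨c, hc0, hc⟩ := Matrix.exists_ne_zero_mulVec_eq_zero hr
      ((Vᵀ * B).submatrix (Fin.castLE r.isLt.le) id)
    set w : Fin d → ℝ := B *ᵥ c with hw
    have hwn : ‖WithLp.toLp 2 w‖ = ‖WithLp.toLp 2 c‖ :=
      norm_toLp_mulVec_of_transpose_mul_self hB c
    have hw0 : 0 < ‖WithLp.toLp 2 w‖ := by
      rw [hwn, norm_pos_iff]
      intro h0
      exact hc0 (by simpa using congrArg WithLp.ofLp h0)
    have hVw0 : ∀ i : Fin d, i < r → (Vᵀ *ᵥ w) i = 0 := by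
      intro i hi
      have := congrFun hc ⟨i, hi⟩
      rw [hw, Matrix.mulVec_mulVec]
      exact this
    have hPw : (B * Bᵀ) *ᵥ w = w := by
      rw [hw, Matrix.mulVec_mulVec, Matrix.mul_assoc, hB, Matrix.mul_one]
    have h1 := hγ w
    rw [hPw] at h1
    have h2 : ‖WithLp.toLp 2 (Z *ᵥ w)‖ ≤ s r * ‖WithLp.toLp 2 w‖ := by
      rw [hZv, ← norm_toLp_mulVec_of_transpose_mul_self hVt w]
      refine norm_toLp_le_of_abs_le (h.nonneg r) fun i => ?_
      rcases lt_or_ge i r with hi | hi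
      · simp [hVw0 i hi]
      · rw [abs_mul, abs_of_nonneg (h.nonneg i)]
        exact mul_le_mul_of_nonneg_right (h.antitone hi) (abs_nonneg _)
    have h3 := hZ w
    have h4 : ‖WithLp.toLp 2 (E *ᵥ w)‖ ≤
        ‖WithLp.toLp 2 (Z *ᵥ w)‖ + ‖WithLp.toLp 2 ((Z - E) *ᵥ w)‖ := by
      have : WithLp.toLp 2 (E *ᵥ w) =
          WithLp.toLp 2 (Z *ᵥ w) - WithLp.toLp 2 ((Z - E) *ᵥ w) := by
        rw [← WithLp.toLp_sub, Matrix.sub_mulVec, sub_sub_cancel]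
      rw [this]
      exact norm_sub_le _ _
    refine le_of_mul_le_mul_right ?_ hw0
    linarith

open scoped Matrix.Norms.L2Operator in
theorem l2_opNorm_projection_le {B : Matrix (Fin d) (Fin k) ℝ} (hB : Bᵀ * B = 1) :
    ‖B * Bᵀ‖ ≤ 1 := by
  have h1 : ‖B‖ ≤ 1 := Matrix.l2_opNorm_le_of_forall zero_le_one fun v => by
    rw [norm_toLp_mulVec_of_transpose_mul_self hB, one_mul]
  have h2 : ‖Bᵀ‖ = ‖B‖ := by
    rw [← Matrix.l2_opNorm_conjTranspose B, Matrix.conjTranspose_eq_transpose_of_trivial]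
  calc _ ≤ ‖B‖ * ‖Bᵀ‖ := Matrix.l2_opNorm_mul _ _
    _ ≤ 1 := by rw [h2]; nlinarith [norm_nonneg B]

open scoped Matrix.Norms.L2Operator in
theorem sinThetaDist_le_two {B B' : Matrix (Fin d) (Fin k) ℝ} (hB : Bᵀ * B = 1)
    (hB' : B'ᵀ * B' = 1) : sinThetaDist B B' ≤ 2 := by
  rw [sinThetaDist]
  refine (norm_sub_le _ _).trans ?_
  linarith [l2_opNorm_projection_le hB, l2_opNorm_projection_le hB']

theorem IsTopRightSingular.transpose_mul_self {Z : Matrix (Fin d) (Fin d) ℝ}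
    {B : Matrix (Fin d) (Fin k) ℝ} (h : IsTopRightSingular Z B) : Bᵀ * B = 1 := by
  obtain ⟨U, s, V, hsvd, hkd, rfl⟩ := h
  have hV : Vᵀ * V = 1 := (Matrix.mem_orthogonalGroup_iff' _ _).1 hsvd.right_orthogonal
  ext a b
  have := congrFun (congrFun hV (Fin.castLE hkd a)) (Fin.castLE hkd b)
  simpa [Matrix.mul_apply, Matrix.one_apply, Fin.castLE_inj] using this

/-- Transposing a decomposition exchanges `U` and `V`, so only right singular vectors need a
perturbation bound. -/
theorem IsTopLeftSingular.isTopRightSingular_transpose {Z : Matrix (Fin d) (Fin d) ℝ}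
    {B : Matrix (Fin d) (Fin k) ℝ} (h : IsTopLeftSingular Z B) : IsTopRightSingular Zᵀ B := by
  obtain ⟨U, s, V, hsvd, hkd, rfl⟩ := h
  refine ⟨V, s, U, ⟨hsvd.right_orthogonal, hsvd.left_orthogonal, hsvd.nonneg, hsvd.antitone, ?_⟩,
    hkd, rfl⟩
  rw [hsvd.eq]
  simp [Matrix.transpose_mul, Matrix.mul_assoc]

open scoped Matrix.Norms.L2Operator in
/-- **Wedin's sin Θ theorem** for top right singular vectors, up to the constant. -/
theorem IsTopRightSingular.sinThetaDist_le {Z E : Matrix (Fin d) (Fin d) ℝ}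
    {Bhat B : Matrix (Fin d) (Fin k) ℝ} (h : IsTopRightSingular Z Bhat)
    (hB : Bᵀ * B = 1) {γ ε : ℝ} (hγ0 : 0 < γ) (hEB : E * (B * Bᵀ) = E)
    (hγ : ∀ v : Fin d → ℝ, γ * ‖WithLp.toLp 2 ((B * Bᵀ) *ᵥ v)‖ ≤ ‖WithLp.toLp 2 (E *ᵥ v)‖)
    (hZ : ‖Z - E‖ ≤ ε) : sinThetaDist Bhat B ≤ 4 * ε / γ := by
  have hε : 0 ≤ ε := (norm_nonneg _).trans hZ
  -- For `γ ≤ 2ε` the claim is weaker than the trivial bound 2. Otherwise the top `k` singular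
  -- values are at least `γ - ε ≥ γ / 2` and the remaining ones at most `ε`.
  rcases le_or_gt γ (2 * ε) with hlt | hlt
  · refine (sinThetaDist_le_two h.transpose_mul_self hB).trans ?_
    rw [le_div_iff₀ hγ0]
    linarith
  obtain ⟨U, s, V, hsvd, hkd, rfl⟩ := h
  have hV : Vᵀ * V = 1 := (Matrix.mem_orthogonalGroup_iff' _ _).1 hsvd.right_orthogonal
  have hV' : V * Vᵀ = 1 := (Matrix.mem_orthogonalGroup_iff _ _).1 hsvd.right_orthogonal
  have hU : Uᵀ * U = 1 := (Matrix.mem_orthogonalGroup_iff' _ _).1 hsvd.left_orthogonal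
  have hVt : Vᵀᵀ * Vᵀ = 1 := by rwa [Matrix.transpose_transpose]
  have hgap := hsvd.singular_gap hB hEB hγ (Matrix.norm_toLp_mulVec_le hZ)
  set P := B * Bᵀ with hP
  set e : Fin d → ℝ := fun i => if i.val < k then 1 else 0 with he
  have hPh : V.submatrix id (Fin.castLE hkd) * (V.submatrix id (Fin.castLE hkd))ᵀ =
      V * Matrix.diagonal e * Vᵀ := by
    ext a b
    rw [Matrix.mul_apply, Matrix.mul_apply]
    simp only [Matrix.mul_diagonal, he, Matrix.transpose_apply, Matrix.submatrix_apply, id,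
      mul_ite, mul_one, mul_zero, ite_mul, zero_mul]
    rw [← Finset.sum_filter]
    refine Finset.sum_bij (fun c _ => Fin.castLE hkd c) (fun c _ => by simp)
      (fun c _ c' _ hcc => by simpa using hcc) (fun c hc => ?_) (fun c _ => rfl)
    exact ⟨⟨c, by simpa using hc⟩, Finset.mem_univ _, rfl⟩
  set Q := V * Matrix.diagonal e * Vᵀ with hQ
  have hQt : Qᵀ = Q := by simp [hQ, Matrix.transpose_mul, Matrix.mul_assoc]
  have hPt : Pᵀ = P := by simp [hP, Matrix.transpose_mul]
  have hVQ : ∀ v i, (Vᵀ *ᵥ (Q *ᵥ v)) i = e i * (Vᵀ *ᵥ v) i := by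
    intro v i
    rw [hQ, Matrix.mulVec_mulVec, ← Matrix.mul_assoc, ← Matrix.mul_assoc, hV, Matrix.one_mul,
      ← Matrix.mulVec_mulVec, Matrix.mulVec_diagonal]
  have hZv : ∀ v : Fin d → ℝ, ‖WithLp.toLp 2 (Z *ᵥ v)‖ =
      ‖WithLp.toLp 2 (fun i => s i * (Vᵀ *ᵥ v) i)‖ := by
    intro v
    rw [hsvd.eq, ← Matrix.mulVec_mulVec, ← Matrix.mulVec_mulVec,
      norm_toLp_mulVec_of_transpose_mul_self hU]
    congr 2
    ext i
    rw [Matrix.mulVec_diagonal]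
  -- Off the top singular space `Z` has norm at most `ε`, hence `E` at most `2ε`, and `E` dominates
  -- `γ P`.
  have b1 : ‖P * (1 - Q)‖ ≤ 2 * ε / γ := by
    refine Matrix.l2_opNorm_le_of_forall (by positivity) fun v => ?_
    set w := (1 - Q) *ᵥ v with hw
    have hVw : ∀ i, (Vᵀ *ᵥ w) i = (1 - e i) * (Vᵀ *ᵥ v) i := by
      intro i
      rw [hw, Matrix.sub_mulVec, Matrix.one_mulVec, Matrix.mulVec_sub, Pi.sub_apply, hVQ]
      ring
    have h1 : ‖WithLp.toLp 2 (Z *ᵥ w)‖ ≤ ε * ‖WithLp.toLp 2 v‖ := by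
      rw [hZv, ← norm_toLp_mulVec_of_transpose_mul_self hVt v]
      refine norm_toLp_le_of_abs_le hε fun i => ?_
      rw [hVw, he]
      by_cases hi : i.val < k
      · simp only [hi, if_true, sub_self, zero_mul, mul_zero, abs_zero]
        positivity
      · simp only [hi, if_false, sub_zero, one_mul, abs_mul, abs_of_nonneg (hsvd.nonneg i)]
        exact mul_le_mul_of_nonneg_right ((hgap i).1 (not_lt.1 hi)) (abs_nonneg _)
    have h2 : ‖WithLp.toLp 2 w‖ ≤ 1 * ‖WithLp.toLp 2 v‖ := by
      rw [← norm_toLp_mulVec_of_transpose_mul_self hVt v,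
        ← norm_toLp_mulVec_of_transpose_mul_self hVt w]
      refine norm_toLp_le_of_abs_le zero_le_one fun i => ?_
      rw [hVw, he]
      by_cases hi : i.val < k <;> simp [hi]
    have h3 := Matrix.norm_toLp_mulVec_le hZ w
    have h4 : ‖WithLp.toLp 2 (E *ᵥ w)‖ ≤
        ‖WithLp.toLp 2 (Z *ᵥ w)‖ + ‖WithLp.toLp 2 ((Z - E) *ᵥ w)‖ := by
      have : WithLp.toLp 2 (E *ᵥ w) =
          WithLp.toLp 2 (Z *ᵥ w) - WithLp.toLp 2 ((Z - E) *ᵥ w) := by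
        rw [← WithLp.toLp_sub, Matrix.sub_mulVec, sub_sub_cancel]
      rw [this]
      exact norm_sub_le _ _
    have h5 := hγ w
    rw [← Matrix.mulVec_mulVec, div_mul_eq_mul_div, le_div_iff₀ hγ0]
    nlinarith
  -- On the complement of `range B` the matrix `E` vanishes, so `Z` has norm at most `ε` there,
  -- whereas `Z` dominates `γ / 2` times `Q`.
  have b2 : ‖Q * (1 - P)‖ ≤ 2 * ε / γ := by
    refine Matrix.l2_opNorm_le_of_forall (by positivity) fun v => ?_
    set w := (1 - P) *ᵥ v with hw
    have hEw : E *ᵥ w = 0 := by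
      rw [hw, Matrix.mulVec_mulVec, mul_sub, hEB, mul_one, sub_self, Matrix.zero_mulVec]
    have h1 : ‖WithLp.toLp 2 (Z *ᵥ w)‖ ≤ ε * ‖WithLp.toLp 2 w‖ := by
      have := Matrix.norm_toLp_mulVec_le hZ w
      rwa [Matrix.sub_mulVec, hEw, sub_zero] at this
    have hPP : P * P = P := by
      rw [hP, Matrix.mul_assoc, ← Matrix.mul_assoc Bᵀ, hB, Matrix.one_mul]
    have h2 : ‖WithLp.toLp 2 w‖ ≤ ‖WithLp.toLp 2 v‖ := by
      rw [← sq_le_sq₀ (norm_nonneg _) (norm_nonneg _), norm_toLp_sq_eq_dotProduct,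
        norm_toLp_sq_eq_dotProduct]
      have e1 : w ⬝ᵥ w = v ⬝ᵥ v - (P *ᵥ v) ⬝ᵥ (P *ᵥ v) := by
        have e2 : v ⬝ᵥ (P *ᵥ v) = (P *ᵥ v) ⬝ᵥ (P *ᵥ v) := by
          rw [Matrix.dotProduct_mulVec (P *ᵥ v), Matrix.vecMul_mulVec, hPt, hPP,
            ← Matrix.dotProduct_mulVec]
        rw [hw, Matrix.sub_mulVec, Matrix.one_mulVec, sub_dotProduct, dotProduct_sub,
          dotProduct_sub, dotProduct_comm (P *ᵥ v) v, e2]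
        ring
      have e3 : 0 ≤ (P *ᵥ v) ⬝ᵥ (P *ᵥ v) := by
        rw [← norm_toLp_sq_eq_dotProduct]; positivity
      rw [e1]
      linarith
    have h3 : γ / 2 * ‖WithLp.toLp 2 (Q *ᵥ w)‖ ≤ ‖WithLp.toLp 2 (Z *ᵥ w)‖ := by
      rw [hZv, ← norm_toLp_mulVec_of_transpose_mul_self hVt (Q *ᵥ w),
        ← le_div_iff₀' (by positivity), div_eq_inv_mul]
      refine norm_toLp_le_of_abs_le (by positivity) fun i => ?_
      rw [hVQ, he]
      by_cases hi : i.val < k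
      · simp only [hi, if_true, one_mul, abs_mul, abs_of_nonneg (hsvd.nonneg i)]
        rw [← div_eq_inv_mul, le_div_iff₀' (by positivity)]
        refine mul_le_mul_of_nonneg_right ?_ (abs_nonneg _)
        linarith [(hgap i).2 hi]
      · simp only [hi, if_false, zero_mul, abs_zero]
        positivity
    rw [← Matrix.mulVec_mulVec, div_mul_eq_mul_div, le_div_iff₀ hγ0]
    nlinarith
  have b3 : ‖(1 - Q) * P‖ ≤ 2 * ε / γ := by
    rw [← Matrix.l2_opNorm_conjTranspose, Matrix.conjTranspose_eq_transpose_of_trivial,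
      Matrix.transpose_mul, Matrix.transpose_sub, hPt, hQt, Matrix.transpose_one]
    exact b1
  rw [sinThetaDist, hPh]
  have : Q - P = Q * (1 - P) - (1 - Q) * P := by noncomm_ring
  rw [this]
  refine (norm_sub_le _ _).trans ((add_le_add b2 b3).trans (le_of_eq ?_))
  ring

end SinTheta

/-! ### Spectral bounds for the diversity matrix and the signal. -/

section DiversityMatrix

theorem Matrix.dotProduct_transpose_mulVec_self {m : Type*} [Fintype m] [DecidableEq m]
    {U : Matrix m m ℝ} (h : U * Uᵀ = 1) (v : m → ℝ) : (Uᵀ *ᵥ v) ⬝ᵥ (Uᵀ *ᵥ v) = v ⬝ᵥ v := by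
  rw [Matrix.dotProduct_mulVec, Matrix.vecMul_mulVec, Matrix.transpose_transpose, h,
    Matrix.vecMul_one]

theorem Matrix.IsHermitian.dotProduct_mulVec_le {m : Type*} [Fintype m] [DecidableEq m]
    {A : Matrix m m ℝ} (hA : A.IsHermitian) {c : ℝ} (h : ∀ i, hA.eigenvalues i ≤ c) (v : m → ℝ) :
    v ⬝ᵥ (A *ᵥ v) ≤ c * (v ⬝ᵥ v) := by
  obtain ⟨U, h1, h2, hpow⟩ := hA.exists_eq_conj_diagonal
  have e := hpow 1
  simp only [pow_one] at e
  rw [← Matrix.dotProduct_transpose_mulVec_self h2 v]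
  nth_rewrite 1 [e]
  rw [← Matrix.mulVec_mulVec, ← Matrix.mulVec_mulVec, Matrix.dotProduct_mulVec,
    ← Matrix.mulVec_transpose, dotProduct, dotProduct, Finset.mul_sum]
  refine Finset.sum_le_sum fun i _ => ?_
  rw [Matrix.mulVec_diagonal]
  nlinarith [mul_le_mul_of_nonneg_right (h i) (mul_self_nonneg ((Uᵀ *ᵥ v) i))]

theorem Matrix.IsHermitian.le_norm_mulVec {m : Type*} [Fintype m] [DecidableEq m]
    {A : Matrix m m ℝ} (hA : A.IsHermitian) {c : ℝ} (hc : 0 ≤ c)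
    (h : ∀ i, c ≤ hA.eigenvalues i) (v : m → ℝ) :
    c * ‖WithLp.toLp 2 v‖ ≤ ‖WithLp.toLp 2 (A *ᵥ v)‖ := by
  obtain ⟨U, h1, h2, hpow⟩ := hA.exists_eq_conj_diagonal
  have e := hpow 1
  simp only [pow_one] at e
  rw [← sq_le_sq₀ (by positivity) (norm_nonneg _), mul_pow, norm_toLp_sq_eq_dotProduct,
    ← Matrix.dotProduct_transpose_mulVec_self h2 v]
  nth_rewrite 1 [e]
  rw [← Matrix.mulVec_mulVec, ← Matrix.mulVec_mulVec,
    norm_toLp_mulVec_of_transpose_mul_self h1, norm_toLp_sq, dotProduct, Finset.mul_sum]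
  refine Finset.sum_le_sum fun i _ => ?_
  rw [Matrix.mulVec_diagonal, mul_pow, ← pow_two]
  exact mul_le_mul_of_nonneg_right (pow_le_pow_left₀ hc (h i) 2) (sq_nonneg _)

variable {M k : ℕ} (n : Fin M → ℕ) (α : Fin M → EuclideanSpace ℝ (Fin k))

/-- The family `eigenvalues` lists `eigenvalues₀` through an unspecified bijection of indices; only
the extreme values survive this relabelling. -/
theorem eigenvalues_diversityMatrix_mem (hk : 0 < k) (i : Fin k) :
    diversityEigenvalue n α ⟨k - 1, Nat.sub_one_lt_of_lt hk⟩ ≤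
        (diversityMatrix_isHermitian n α).eigenvalues i ∧
      (diversityMatrix_isHermitian n α).eigenvalues i ≤ diversityEigenvalue n α ⟨0, hk⟩ := by
  unfold diversityEigenvalue Matrix.IsHermitian.eigenvalues
  refine ⟨(diversityMatrix_isHermitian n α).eigenvalues₀_antitone ?_,
    (diversityMatrix_isHermitian n α).eigenvalues₀_antitone ?_⟩
  · rw [Fin.le_def]
    have := ((Fintype.equivOfCardEq (Fintype.card_fin _)).symm i :
      Fin (Fintype.card (Fin k))).isLt
    simp only [Fintype.card_fin] at this
    simp only [Fin.val_cast]
    omega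
  · rw [Fin.le_def]
    simp

theorem diversityEigenvalue_last_le_first (hk : 0 < k) :
    diversityEigenvalue n α ⟨k - 1, Nat.sub_one_lt_of_lt hk⟩ ≤
      diversityEigenvalue n α ⟨0, hk⟩ :=
  (eigenvalues_diversityMatrix_mem n α hk ⟨0, hk⟩).1.trans
    (eigenvalues_diversityMatrix_mem n α hk ⟨0, hk⟩).2

theorem dotProduct_diversityMatrix_mulVec (v : Fin k → ℝ) :
    v ⬝ᵥ (diversityMatrix n α *ᵥ v) =
      (totalSamples n : ℝ)⁻¹ * ∑ i, (n i : ℝ) * ((α i).ofLp ⬝ᵥ v) ^ 2 := by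
  rw [diversityMatrix, Matrix.smul_mulVec, dotProduct_smul, smul_eq_mul, Matrix.sum_mulVec,
    dotProduct_sum]
  congr 1
  refine Finset.sum_congr rfl fun i _ => ?_
  rw [Matrix.smul_mulVec, dotProduct_smul, smul_eq_mul, Matrix.vecMulVec_mulVec,
    dotProduct_smul, dotProduct_comm v]
  simp [pow_two]

theorem trace_diversityMatrix :
    (diversityMatrix n α).trace = (totalSamples n : ℝ)⁻¹ * ∑ i, (n i : ℝ) * ‖α i‖ ^ 2 := by
  rw [diversityMatrix, Matrix.trace_smul, smul_eq_mul, Matrix.trace_sum]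
  congr 1
  refine Finset.sum_congr rfl fun i _ => ?_
  rw [Matrix.trace_smul, smul_eq_mul, Matrix.trace_vecMulVec, EuclideanSpace.norm_sq_eq]
  simp [dotProduct, pow_two]

variable {n α}

/-- `∑ nᵢ ⟨αᵢ, v⟩² ≤ N λ₁ ‖v‖²`. -/
theorem sum_mul_dotProduct_sq_le (hk : 0 < k) (hN : 0 < totalSamples n) (v : Fin k → ℝ) :
    ∑ i, (n i : ℝ) * ((α i).ofLp ⬝ᵥ v) ^ 2 ≤
      totalSamples n * diversityEigenvalue n α ⟨0, hk⟩ * (v ⬝ᵥ v) := by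
  have h := (diversityMatrix_isHermitian n α).dotProduct_mulVec_le
    (fun i => (eigenvalues_diversityMatrix_mem n α hk i).2) v
  have hN' : (0 : ℝ) < totalSamples n := by exact_mod_cast hN
  rw [dotProduct_diversityMatrix_mulVec, inv_mul_le_iff₀ hN'] at h
  linarith

/-- `∑ nᵢ ‖αᵢ‖² ≤ N k λ₁`. -/
theorem sum_mul_norm_sq_le (hk : 0 < k) (hN : 0 < totalSamples n) :
    ∑ i, (n i : ℝ) * ‖α i‖ ^ 2 ≤
      totalSamples n * (k * diversityEigenvalue n α ⟨0, hk⟩) := by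
  have hN' : (0 : ℝ) < totalSamples n := by exact_mod_cast hN
  rw [← inv_mul_le_iff₀ hN', ← trace_diversityMatrix,
    (diversityMatrix_isHermitian n α).trace_eq_sum_eigenvalues]
  calc _ ≤ ∑ _i : Fin k, diversityEigenvalue n α ⟨0, hk⟩ :=
        Finset.sum_le_sum fun i _ => (eigenvalues_diversityMatrix_mem n α hk i).2
    _ = _ := by simp

/-- `nᵢ ‖αᵢ‖² ≤ N λ₁`. -/
theorem mul_norm_sq_le (hk : 0 < k) (hN : 0 < totalSamples n) (i : Fin M) :
    (n i : ℝ) * ‖α i‖ ^ 2 ≤ totalSamples n * diversityEigenvalue n α ⟨0, hk⟩ := by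
  have h := sum_mul_dotProduct_sq_le (α := α) hk hN (α i).ofLp
  -- Testing the quadratic form on `αᵢ` and keeping one term gives `nᵢ ‖αᵢ‖⁴ ≤ N λ₁ ‖αᵢ‖²`.
  have h1 : (n i : ℝ) * ((α i).ofLp ⬝ᵥ (α i).ofLp) ^ 2 ≤ _ :=
    (Finset.single_le_sum (f := fun j => (n j : ℝ) * ((α j).ofLp ⬝ᵥ (α i).ofLp) ^ 2)
      (fun j _ => by positivity) (Finset.mem_univ i)).trans h
  have e : (α i).ofLp ⬝ᵥ (α i).ofLp = ‖α i‖ ^ 2 := by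
    rw [← norm_toLp_sq_eq_dotProduct]
  rw [e] at h1
  rcases eq_or_ne (‖α i‖ ^ 2) 0 with h0 | h0
  · rw [h0, mul_zero]
    -- If `αᵢ = 0` one cannot divide, and the claim is `0 ≤ N λ₁`; a basis vector as test vector
    -- shows it.
    have h2 : 0 ≤ ∑ j, (n j : ℝ) * ((α j).ofLp ⬝ᵥ (Pi.single ⟨0, hk⟩ 1)) ^ 2 :=
      Finset.sum_nonneg fun j _ => by positivity
    simpa using h2.trans (sum_mul_dotProduct_sq_le (α := α) hk hN _)
  · have hp : 0 < ‖α i‖ ^ 2 := lt_of_le_of_ne (by positivity) (Ne.symm h0)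
    refine le_of_mul_le_mul_right ?_ hp
    linarith

open scoped Matrix.Norms.L2Operator in
/-- Perturbation bound for the top singular vectors of the two-replica matrix. -/
theorem sinThetaDist_le_of_norm_sub_le {d : ℕ} (hk : 0 < k) (hN : 0 < totalSamples n)
    {Z : Matrix (Fin d) (Fin d) ℝ} {Bhat B : Matrix (Fin d) (Fin k) ℝ} (hB : Bᵀ * B = 1)
    (hlk : 0 < diversityEigenvalue n α ⟨k - 1, Nat.sub_one_lt_of_lt hk⟩) {ε : ℝ}
    (hZ : ‖Z - (totalSamples n : ℝ) • (B * diversityMatrix n α * Bᵀ)‖ ≤ ε)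
    (h : IsTopRightSingular Z Bhat ∨ IsTopLeftSingular Z Bhat) :
    sinThetaDist Bhat B ≤
      4 * ε / (totalSamples n * diversityEigenvalue n α ⟨k - 1, Nat.sub_one_lt_of_lt hk⟩) := by
  have hN' : (0 : ℝ) < totalSamples n := by exact_mod_cast hN
  have hDt : (diversityMatrix n α)ᵀ = diversityMatrix n α := by
    simpa using (diversityMatrix_isHermitian n α).eq
  set E := (totalSamples n : ℝ) • (B * diversityMatrix n α * Bᵀ) with hE
  have hEt : Eᵀ = E := by
    simp [hE, Matrix.transpose_mul, hDt, Matrix.mul_assoc]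
  have hEB : E * (B * Bᵀ) = E := by
    rw [hE, Matrix.smul_mul, Matrix.mul_assoc (B * _), ← Matrix.mul_assoc Bᵀ, hB, Matrix.one_mul]
  have hγ : ∀ v : Fin d → ℝ,
      (totalSamples n * diversityEigenvalue n α ⟨k - 1, Nat.sub_one_lt_of_lt hk⟩) *
        ‖WithLp.toLp 2 ((B * Bᵀ) *ᵥ v)‖ ≤ ‖WithLp.toLp 2 (E *ᵥ v)‖ := by
    intro v
    rw [hE, Matrix.smul_mulVec, WithLp.toLp_smul, norm_smul, Real.norm_of_nonneg hN'.le,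
      mul_assoc, ← Matrix.mulVec_mulVec, ← Matrix.mulVec_mulVec, ← Matrix.mulVec_mulVec,
      norm_toLp_mulVec_of_transpose_mul_self hB, norm_toLp_mulVec_of_transpose_mul_self hB]
    exact mul_le_mul_of_nonneg_left ((diversityMatrix_isHermitian n α).le_norm_mulVec hlk.le
      (fun i => (eigenvalues_diversityMatrix_mem n α hk i).1) _) hN'.le
  rcases h with h | h
  · exact h.sinThetaDist_le hB (by positivity) hEB hγ hZ
  · refine h.isTopRightSingular_transpose.sinThetaDist_le hB (by positivity) hEB hγ ?_
    rw [← hEt, ← Matrix.transpose_sub, ← Matrix.conjTranspose_eq_transpose_of_trivial,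
      Matrix.l2_opNorm_conjTranspose]
    exact hZ

end DiversityMatrix

/-! ### Sub-gaussian squares and sums of sub-exponential variables. -/

section SubExponential

variable {Ω : Type*} [MeasurableSpace Ω] {μ : Measure Ω}

/-- The integrand times the density is at most a multiple of `exp (-g²/4)`, whose integral is `√2 ≤
2`. -/
theorem lintegral_exp_sq_gaussianReal_le {b : ℝ} (hb : b ≤ 1 / 4) :
    ∫⁻ g, ENNReal.ofReal (Real.exp (b * g ^ 2)) ∂(gaussianReal 0 1) ≤ 2 := by
  rw [gaussianReal_of_var_ne_zero _ one_ne_zero,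
    lintegral_withDensity_eq_lintegral_mul _ (measurable_gaussianPDF _ _) (by fun_prop)]
  have h1 : ∀ g : ℝ, (gaussianPDF 0 1 * fun g => ENNReal.ofReal (Real.exp (b * g ^ 2))) g ≤
      ENNReal.ofReal ((√(2 * Real.pi))⁻¹ * Real.exp (-(1 / 4) * g ^ 2)) := by
    intro g
    rw [Pi.mul_apply, gaussianPDF, ← ENNReal.ofReal_mul (gaussianPDFReal_nonneg _ _ _)]
    refine ENNReal.ofReal_le_ofReal ?_
    rw [gaussianPDFReal]
    simp only [NNReal.coe_one, mul_one, sub_zero]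
    rw [mul_assoc, ← Real.exp_add]
    gcongr
    nlinarith [sq_nonneg g]
  refine (lintegral_mono h1).trans ?_
  rw [← ofReal_integral_eq_lintegral_ofReal
    ((integrable_exp_neg_mul_sq (by norm_num)).const_mul _) (.of_forall fun g => by positivity),
    integral_const_mul, integral_gaussian]
  have : (√(2 * Real.pi))⁻¹ * √(Real.pi / (1 / 4)) ≤ 2 := by
    have hpi := Real.pi_pos
    rw [inv_mul_le_iff₀ (by positivity)]
    have : √(Real.pi / (1 / 4)) = √(2 * Real.pi) * √2 := by
      rw [← Real.sqrt_mul (by positivity)]; congr 1; ring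
    rw [this]
    gcongr
    rw [Real.sqrt_le_left] <;> norm_num
  calc _ ≤ ENNReal.ofReal 2 := ENNReal.ofReal_le_ofReal this
    _ = 2 := by simp

/-- The square of a sub-gaussian variable has an exponential moment. -/
theorem ProbabilityTheory.HasSubgaussianMGF.integral_exp_sq_le [IsProbabilityMeasure μ] {X : Ω → ℝ} {v : ℝ≥0}
    (h : HasSubgaussianMGF X v μ) (hX : Measurable X) {c : ℝ} (hc : 0 ≤ c) (hcv : v * c ≤ 1 / 4) :
    Integrable (fun ω => Real.exp (c * X ω ^ 2)) μ ∧ ∫ ω, Real.exp (c * X ω ^ 2) ∂μ ≤ 2 := by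
  have key : ∫⁻ ω, ENNReal.ofReal (Real.exp (c * X ω ^ 2)) ∂μ ≤ 2 := by
    -- Linearize the square by an auxiliary standard Gaussian `g`. After exchanging the integrals,
    -- the sub-gaussian bound in `X` leaves `exp (v c g²)`, integrable since `v c ≤ 1/4`.
    have e1 : ∀ a : ℝ, ENNReal.ofReal (Real.exp (c * a ^ 2)) =
        ∫⁻ g, ENNReal.ofReal (Real.exp (√(2 * c) * a * g)) ∂(gaussianReal 0 1) := by
      intro a
      rw [← ofReal_integral_eq_lintegral_ofReal (integrable_exp_mul_gaussianReal _)
        (.of_forall fun g => by positivity)]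
      have := mgf_gaussianReal (p := gaussianReal 0 1) (X := id) (μ := 0) (v := 1)
        (by simp) (√(2 * c) * a)
      simp only [mgf, id] at this
      rw [this]
      congr 2
      rw [mul_pow, Real.sq_sqrt (by positivity)]
      simp only [NNReal.coe_one]
      ring
    simp only [e1]
    rw [lintegral_lintegral_swap (by fun_prop)]
    refine (lintegral_mono fun g => ?_).trans (lintegral_exp_sq_gaussianReal_le hcv)
    have e2 : ∀ ω, √(2 * c) * X ω * g = (√(2 * c) * g) * X ω := fun ω => by ring
    simp only [e2]
    rw [← ofReal_integral_eq_lintegral_ofReal (h.integrable_exp_mul _)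
      (.of_forall fun g => by positivity)]
    refine ENNReal.ofReal_le_ofReal ((h.mgf_le _).trans (le_of_eq ?_))
    rw [mul_pow, Real.sq_sqrt (by positivity)]
    congr 1
    ring
  have hm : Measurable fun ω => Real.exp (c * X ω ^ 2) := by fun_prop
  have hint : Integrable (fun ω => Real.exp (c * X ω ^ 2)) μ := by
    refine ⟨hm.aestronglyMeasurable, ?_⟩
    rw [hasFiniteIntegral_iff_ofReal (.of_forall fun ω => by positivity)]
    exact key.trans_lt (by simp)
  refine ⟨hint, ?_⟩
  rw [integral_eq_lintegral_of_nonneg_ae (.of_forall fun ω => by positivity)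
    hm.aestronglyMeasurable]
  exact ENNReal.toReal_le_of_le_ofReal (by norm_num) (by simpa using key)

/-- `E exp (c |X|) ≤ K`. -/
structure IsSubExp (X : Ω → ℝ) (c K : ℝ) (μ : Measure Ω) : Prop where
  measurable : Measurable X
  integrable : Integrable (fun ω => Real.exp (c * |X ω|)) μ
  le : ∫ ω, Real.exp (c * |X ω|) ∂μ ≤ K

theorem sq_le_mul_exp {c : ℝ} (hc : 0 < c) (x : ℝ) : x ^ 2 ≤ 2 / c ^ 2 * Real.exp (c * |x|) := by
  have h := Real.quadratic_le_exp_of_nonneg (mul_nonneg hc.le (abs_nonneg x))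
  have h0 := mul_nonneg hc.le (abs_nonneg x)
  rw [div_mul_eq_mul_div, le_div_iff₀ (by positivity), ← sq_abs x, ← mul_pow, mul_comm |x|]
  linarith

namespace IsSubExp

variable {X : Ω → ℝ} {c K : ℝ}

theorem integrable_sq (h : IsSubExp X c K μ) (hc : 0 < c) : Integrable (fun ω => X ω ^ 2) μ :=
  (h.integrable.const_mul (2 / c ^ 2)).mono' (h.measurable.pow_const 2).aestronglyMeasurable
    (.of_forall fun ω => by
      rw [Real.norm_of_nonneg (sq_nonneg _)]; exact sq_le_mul_exp hc _)

theorem integral_sq_le (h : IsSubExp X c K μ) (hc : 0 < c) :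
    ∫ ω, X ω ^ 2 ∂μ ≤ 2 / c ^ 2 * K := by
  refine (integral_mono (h.integrable_sq hc) (h.integrable.const_mul (2 / c ^ 2))
    fun ω => sq_le_mul_exp hc _).trans ?_
  rw [integral_const_mul]
  exact mul_le_mul_of_nonneg_left h.le (by positivity)

theorem memLp_two (h : IsSubExp X c K μ) (hc : 0 < c) : MemLp X 2 μ :=
  (memLp_two_iff_integrable_sq h.measurable.aestronglyMeasurable).2 (h.integrable_sq hc)

theorem measureReal_gt_le [IsFiniteMeasure μ] (h : IsSubExp X c K μ) (hc : 0 < c) (s : ℝ) :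
    μ.real {ω | s < |X ω|} ≤ K * Real.exp (-(c * s)) := by
  have h1 := mul_meas_ge_le_integral_of_nonneg (μ := μ)
    (f := fun ω => Real.exp (c * |X ω|)) (.of_forall fun ω => (Real.exp_pos _).le)
    h.integrable (Real.exp (c * s))
  have h2 : μ.real {ω | s < |X ω|} ≤ μ.real {ω | Real.exp (c * s) ≤ Real.exp (c * |X ω|)} := by
    refine measureReal_mono fun ω hω => ?_
    simp only [Set.mem_ofPred_eq] at hω ⊢
    gcongr
  rw [Real.exp_neg, ← div_eq_mul_inv, le_div_iff₀ (Real.exp_pos _)]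
  have h3 := h.le
  have := mul_le_mul_of_nonneg_left h2 (Real.exp_pos (c * s)).le
  linarith

end IsSubExp

/-- The remainder `eˣ - 1 - x` only grows when `x` is replaced by `|x|`, because `y ≤ sinh y` for `y
≥ 0`. Applying `1 - y ≤ e^(-y)` then bounds the remainder at `|x|`. -/
theorem exp_le_one_add_add_sq_mul_exp_abs (x : ℝ) :
    Real.exp x ≤ 1 + x + x ^ 2 * Real.exp |x| := by
  have h1 : Real.exp x ≤ 1 + x + (Real.exp |x| - 1 - |x|) := by
    rcases le_total 0 x with h | h
    · rw [abs_of_nonneg h]; linarith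
    · have := Real.cosh_sq x
      have h2 := Real.self_le_sinh_iff.2 (neg_nonneg.2 h)
      rw [Real.sinh_eq, neg_neg] at h2
      rw [abs_of_nonpos h]
      linarith
  have h3 : Real.exp |x| - 1 - |x| ≤ x ^ 2 * Real.exp |x| := by
    have h4 := Real.add_one_le_exp (-|x|)
    have h5 : Real.exp |x| - 1 ≤ |x| * Real.exp |x| := by
      have : Real.exp |x| * Real.exp (-|x|) = 1 := by rw [← Real.exp_add]; simp
      nlinarith [Real.exp_pos |x|]
    have h6 := mul_le_mul_of_nonneg_left h5 (abs_nonneg x)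
    rw [← sq_abs x]
    nlinarith [abs_nonneg x]
  linarith

/-- A centered sub-exponential variable has a locally sub-gaussian moment generating function. -/
theorem IsSubExp.mgf_le [IsProbabilityMeasure μ] {X : Ω → ℝ} {c K : ℝ} (h : IsSubExp X c K μ) (hc : 0 < c)
    (hmean : ∫ ω, X ω ∂μ = 0) {t : ℝ} (ht : |t| ≤ c / 2) :
    Integrable (fun ω => Real.exp (t * X ω)) μ ∧
      mgf X μ t ≤ Real.exp (8 * K / c ^ 2 * t ^ 2) := by
  have hX : Integrable X μ := (h.memLp_two hc).integrable one_le_two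
  have hb : ∀ ω, Real.exp (t * X ω) ≤
      1 + t * X ω + t ^ 2 * (8 / c ^ 2) * Real.exp (c * |X ω|) := by
    intro ω
    refine (exp_le_one_add_add_sq_mul_exp_abs _).trans ?_
    have h1 := sq_le_mul_exp (half_pos hc) (X ω)
    have h2 : Real.exp |t * X ω| ≤ Real.exp (c / 2 * |X ω|) := by
      rw [abs_mul]; gcongr
    -- Half of the exponent `c` pays for `X²`, the other half for `exp |tX|`.
    have h3 : X ω ^ 2 * Real.exp |t * X ω| ≤ 8 / c ^ 2 * Real.exp (c * |X ω|) := by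
      calc _ ≤ 2 / (c / 2) ^ 2 * Real.exp (c / 2 * |X ω|) * Real.exp (c / 2 * |X ω|) := by gcongr
        _ = 8 / c ^ 2 * (Real.exp (c / 2 * |X ω|) * Real.exp (c / 2 * |X ω|)) := by ring
        _ = _ := by rw [← Real.exp_add]; ring_nf
    have h4 := mul_le_mul_of_nonneg_left h3 (sq_nonneg t)
    rw [mul_pow]
    linarith
  have hint2 : Integrable
      (fun ω => 1 + t * X ω + t ^ 2 * (8 / c ^ 2) * Real.exp (c * |X ω|)) μ :=
    ((integrable_const _).add (hX.const_mul t)).add (h.integrable.const_mul _)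
  have hint : Integrable (fun ω => Real.exp (t * X ω)) μ :=
    hint2.mono' (h.measurable.const_mul t).exp.aestronglyMeasurable (.of_forall fun ω => by
      rw [Real.norm_of_nonneg (Real.exp_pos _).le]; exact hb ω)
  refine ⟨hint, (integral_mono hint hint2 hb).trans ?_⟩
  rw [integral_add (by exact (integrable_const _).add (hX.const_mul t)) (h.integrable.const_mul _),
    integral_add (integrable_const _) (hX.const_mul t), integral_const_mul, integral_const_mul,
    hmean]
  simp only [integral_const, probReal_univ, smul_eq_mul, mul_one, mul_zero, add_zero]
  have h5 := Real.add_one_le_exp (8 * K / c ^ 2 * t ^ 2)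
  have h6 := mul_le_mul_of_nonneg_left h.le (show 0 ≤ t ^ 2 * (8 / c ^ 2) by positivity)
  calc _ ≤ 1 + t ^ 2 * (8 / c ^ 2) * K := by linarith
    _ = 8 * K / c ^ 2 * t ^ 2 + 1 := by ring
    _ ≤ _ := h5

/-- Normalized sums of independent centered sub-exponential variables are sub-exponential. -/
theorem IsSubExp.sum_div_sqrt [IsProbabilityMeasure μ] {ι : Type*} {X : ι → Ω → ℝ} {c K : ℝ}
    (h : ∀ i, IsSubExp (X i) c K μ) (hc : 0 < c) (hmean : ∀ i, ∫ ω, X i ω ∂μ = 0)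
    (hind : iIndepFun X μ) (s : Finset ι) {n : ℕ} (hn : 0 < n) (hs : s.card ≤ n) (hK : 0 ≤ K) :
    IsSubExp (fun ω => (√n)⁻¹ * ∑ i ∈ s, X i ω) (c / 2) (2 * Real.exp (2 * K)) μ := by
  have hn' : (1 : ℝ) ≤ n := by exact_mod_cast hn
  have hsq : 1 ≤ √(n : ℝ) := Real.one_le_sqrt.2 hn'
  have hm : Measurable fun ω => (√n)⁻¹ * ∑ i ∈ s, X i ω :=
    (Finset.measurable_fun_sum _ fun i _ => (h i).measurable).const_mul _
  -- At this `t` each of the at most `n` factors is bounded by `exp (2K / n)`. Using both signs of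
  -- `t` bounds the exponential of the absolute value.
  have key : ∀ t : ℝ, |t| = c / 2 * (√n)⁻¹ →
      Integrable (fun ω => Real.exp (t * ∑ i ∈ s, X i ω)) μ ∧
        ∫ ω, Real.exp (t * ∑ i ∈ s, X i ω) ∂μ ≤ Real.exp (2 * K) := by
    intro t ht
    have ht' : |t| ≤ c / 2 := by
      rw [ht]
      exact mul_le_of_le_one_right (by positivity) (inv_le_one_of_one_le₀ hsq)
    have e1 : ∫ ω, Real.exp (t * ∑ i ∈ s, X i ω) ∂μ = ∏ i ∈ s, mgf (X i) μ t := by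
      rw [← hind.mgf_sum (fun i => (h i).measurable)]
      simp [mgf]
    refine ⟨?_, ?_⟩
    · have := hind.integrable_exp_mul_sum (t := t) (fun i => (h i).measurable) (s := s)
        fun i _ => ((h i).mgf_le hc (hmean i) ht').1
      simpa using this
    · rw [e1]
      have ht2 : t ^ 2 = c ^ 2 / 4 * (n : ℝ)⁻¹ := by
        rw [← sq_abs, ht, mul_pow, inv_pow, Real.sq_sqrt (by positivity)]; ring
      calc _ ≤ ∏ _i ∈ s, Real.exp (8 * K / c ^ 2 * t ^ 2) :=
            Finset.prod_le_prod (fun i _ => mgf_nonneg)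
              fun i _ => ((h i).mgf_le hc (hmean i) ht').2
        _ = Real.exp (s.card * (2 * K * (n : ℝ)⁻¹)) := by
            rw [Finset.prod_const, ← Real.exp_nat_mul, ht2]
            congr 2
            field_simp
            ring
        _ ≤ _ := by
            have hs' : (s.card : ℝ) ≤ n := by exact_mod_cast hs
            have : (s.card : ℝ) * (n : ℝ)⁻¹ ≤ 1 := by
              rw [← div_eq_mul_inv]; exact div_le_one_of_le₀ hs' (by positivity)
            rw [Real.exp_le_exp]
            nlinarith [mul_le_mul_of_nonneg_left this hK]
  have hpos : 0 < c / 2 * (√(n : ℝ))⁻¹ := by positivity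
  obtain ⟨i1, l1⟩ := key (c / 2 * (√n)⁻¹) (abs_of_pos hpos)
  obtain ⟨i2, l2⟩ := key (-(c / 2 * (√n)⁻¹)) (by rw [abs_neg, abs_of_pos hpos])
  have hb : ∀ ω, Real.exp (c / 2 * |(√n)⁻¹ * ∑ i ∈ s, X i ω|) ≤
      Real.exp (c / 2 * (√n)⁻¹ * ∑ i ∈ s, X i ω) +
        Real.exp (-(c / 2 * (√n)⁻¹) * ∑ i ∈ s, X i ω) := by
    intro ω
    rcases abs_choice ((√n)⁻¹ * ∑ i ∈ s, X i ω) with h' | h'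
    · rw [h', ← mul_assoc]; exact le_add_of_nonneg_right (Real.exp_pos _).le
    · rw [h', mul_neg, ← mul_assoc, ← neg_mul]; exact le_add_of_nonneg_left (Real.exp_pos _).le
  have hint : Integrable (fun ω => Real.exp (c / 2 * |(√n)⁻¹ * ∑ i ∈ s, X i ω|)) μ :=
    (i1.add i2).mono' ((continuous_abs.measurable.comp hm).const_mul _).exp.aestronglyMeasurable
      (.of_forall fun ω => by
      rw [Real.norm_of_nonneg (Real.exp_pos _).le]; exact hb ω)
  refine ⟨hm, hint, (integral_mono hint (i1.add i2) hb).trans ?_⟩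
  simp only [Pi.add_apply]
  rw [integral_add i1 i2]
  linarith

end SubExponential

/-! ### Hermitian dilation and pointwise bounds for the noise matrix. -/

section Dilation

variable {m : Type*} [Fintype m]

/-- The Hermitian dilation of a square matrix. -/
def dilation (X : Matrix m m ℝ) : Matrix (m ⊕ m) (m ⊕ m) ℝ := Matrix.fromBlocks 0 X Xᵀ 0

omit [Fintype m] in
theorem isHermitian_dilation (X : Matrix m m ℝ) : (dilation X).IsHermitian := by
  rw [dilation, Matrix.isHermitian_fromBlocks_iff]
  simp

theorem dilation_mulVec (X : Matrix m m ℝ) (w : m ⊕ m → ℝ) :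
    dilation X *ᵥ w = Sum.elim (X *ᵥ (w ∘ Sum.inr)) (Xᵀ *ᵥ (w ∘ Sum.inl)) := by
  rw [dilation, Matrix.fromBlocks_mulVec]
  simp

theorem dotProduct_dilation_sq (X : Matrix m m ℝ) (w : m ⊕ m → ℝ) :
    w ⬝ᵥ ((dilation X * dilation X) *ᵥ w) =
      (X *ᵥ (w ∘ Sum.inr)) ⬝ᵥ (X *ᵥ (w ∘ Sum.inr)) +
        (Xᵀ *ᵥ (w ∘ Sum.inl)) ⬝ᵥ (Xᵀ *ᵥ (w ∘ Sum.inl)) := by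
  have : w ⬝ᵥ ((dilation X * dilation X) *ᵥ w) = (dilation X *ᵥ w) ⬝ᵥ (dilation X *ᵥ w) := by
    have ht : (dilation X)ᵀ = dilation X := by simpa using (isHermitian_dilation X).eq
    rw [Matrix.dotProduct_mulVec (dilation X *ᵥ w), Matrix.vecMul_mulVec, ht,
      ← Matrix.dotProduct_mulVec]
  rw [this, dilation_mulVec]
  simp [dotProduct]

theorem dotProduct_self_sum (w : m ⊕ m → ℝ) :
    w ⬝ᵥ w = (w ∘ Sum.inr) ⬝ᵥ (w ∘ Sum.inr) + (w ∘ Sum.inl) ⬝ᵥ (w ∘ Sum.inl) := by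
  simp [dotProduct, add_comm]

theorem posSemidef_smul_one_sub_of_le [DecidableEq m] {A : Matrix m m ℝ} (hA : A.IsHermitian)
    {ρ : ℝ} (h : ∀ w : m → ℝ, w ⬝ᵥ (A *ᵥ w) ≤ ρ * (w ⬝ᵥ w)) :
    (ρ • (1 : Matrix m m ℝ) - A).PosSemidef := by
  refine Matrix.PosSemidef.of_dotProduct_mulVec_nonneg ?_ fun w => ?_
  · exact Matrix.IsHermitian.sub (by simp [Matrix.IsHermitian]) hA
  · rw [star_trivial, Matrix.sub_mulVec, dotProduct_sub, Matrix.smul_mulVec, Matrix.one_mulVec,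
      dotProduct_smul, smul_eq_mul]
    linarith [h w]

/-- A diagonal entry of `ρ - A²` is `ρ` minus the squared norm of a row. This supplies the entrywise
boundedness required by `IsBddMeas`. -/
theorem abs_apply_le_of_posSemidef [DecidableEq m] {A : Matrix m m ℝ} (hA : A.IsHermitian) {ρ : ℝ}
    (h : (ρ • (1 : Matrix m m ℝ) - A * A).PosSemidef) (a b : m) : |A a b| ≤ √ρ := by
  refine Real.abs_le_sqrt ?_
  have h1 := h.diag_nonneg (i := a)
  simp only [Matrix.sub_apply, Matrix.smul_apply, Matrix.one_apply_eq, smul_eq_mul, mul_one,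
    Matrix.mul_apply] at h1
  have h2 : A a b ^ 2 ≤ ∑ j, A a j * A j a := by
    have e : ∀ j, A a j * A j a = A a j ^ 2 := fun j => by
      have := hA.apply a j
      simp only [star_trivial] at this
      rw [this, pow_two]
    simp only [e]
    exact Finset.single_le_sum (f := fun j => A a j ^ 2) (fun j _ => sq_nonneg _)
      (Finset.mem_univ b)
  linarith

theorem dotProduct_sq_le_mul (v w : m → ℝ) : (v ⬝ᵥ w) ^ 2 ≤ (v ⬝ᵥ v) * (w ⬝ᵥ w) := by
  have := Finset.sum_mul_sq_le_sq_mul_sq Finset.univ v w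
  simpa [dotProduct, pow_two] using this

theorem dotProduct_self_nonneg' (v : m → ℝ) : 0 ≤ v ⬝ᵥ v :=
  Finset.sum_nonneg fun _ _ => mul_self_nonneg _

/-- The noise matrix `g bᵀ + b hᵀ + g hᵀ` of one client. -/
def noiseMatrix (g h b : m → ℝ) : Matrix m m ℝ :=
  Matrix.vecMulVec g b + Matrix.vecMulVec b h + Matrix.vecMulVec g h

omit [Fintype m] in
theorem transpose_noiseMatrix (g h b : m → ℝ) : (noiseMatrix g h b)ᵀ = noiseMatrix h g b := by
  simp only [noiseMatrix, Matrix.transpose_add, Matrix.transpose_vecMulVec]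
  abel

theorem noiseMatrix_mulVec_sq_le (g h b v : m → ℝ) :
    (noiseMatrix g h b *ᵥ v) ⬝ᵥ (noiseMatrix g h b *ᵥ v) ≤
      3 * ((b ⬝ᵥ v) ^ 2 * (g ⬝ᵥ g) + (h ⬝ᵥ v) ^ 2 * (b ⬝ᵥ b) + (h ⬝ᵥ v) ^ 2 * (g ⬝ᵥ g)) := by
  have e : noiseMatrix g h b *ᵥ v = (b ⬝ᵥ v) • g + (h ⬝ᵥ v) • b + (h ⬝ᵥ v) • g := by
    simp [noiseMatrix, Matrix.add_mulVec, Matrix.vecMulVec_mulVec]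
  rw [e]
  generalize b ⬝ᵥ v = p
  generalize h ⬝ᵥ v = q
  simp only [dotProduct, Finset.mul_sum, ← Finset.sum_add_distrib]
  refine Finset.sum_le_sum fun i _ => ?_
  simp only [Pi.add_apply, Pi.smul_apply, smul_eq_mul]
  nlinarith [sq_nonneg (p * g i - q * b i), sq_nonneg (p * g i - q * g i),
    sq_nonneg (q * b i - q * g i)]

theorem noiseMatrix_mulVec_sq_le_of_le {g h b : m → ℝ} {ρ T : ℝ} (hg : g ⬝ᵥ g ≤ ρ)
    (hh : h ⬝ᵥ h ≤ ρ) (hb : b ⬝ᵥ b ≤ T) (v : m → ℝ) :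
    (noiseMatrix g h b *ᵥ v) ⬝ᵥ (noiseMatrix g h b *ᵥ v) ≤ 3 * (2 * T * ρ + ρ ^ 2) * (v ⬝ᵥ v) := by
  refine (noiseMatrix_mulVec_sq_le g h b v).trans ?_
  have hv := dotProduct_self_nonneg' v
  have hg0 := dotProduct_self_nonneg' g
  have hh0 := dotProduct_self_nonneg' h
  have hb0 := dotProduct_self_nonneg' b
  have hρ : 0 ≤ ρ := hg0.trans hg
  have hT : 0 ≤ T := hb0.trans hb
  have h1 : (b ⬝ᵥ v) ^ 2 * (g ⬝ᵥ g) ≤ (T * (v ⬝ᵥ v)) * ρ :=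
    mul_le_mul ((dotProduct_sq_le_mul b v).trans (by gcongr)) hg hg0 (by positivity)
  have h2 : (h ⬝ᵥ v) ^ 2 * (b ⬝ᵥ b) ≤ (ρ * (v ⬝ᵥ v)) * T :=
    mul_le_mul ((dotProduct_sq_le_mul h v).trans (by gcongr)) hb hb0 (by positivity)
  have h3 : (h ⬝ᵥ v) ^ 2 * (g ⬝ᵥ g) ≤ (ρ * (v ⬝ᵥ v)) * ρ :=
    mul_le_mul ((dotProduct_sq_le_mul h v).trans (by gcongr)) hg hg0 (by positivity)
  linarith

open scoped Matrix.Norms.L2Operator in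
theorem l2_opNorm_le_card_mul [DecidableEq m] {A : Matrix m m ℝ} {e : ℝ} (he : 0 ≤ e)
    (h : ∀ a b, |A a b| ≤ e) : ‖A‖ ≤ Fintype.card m * e := by
  refine Matrix.l2_opNorm_le_of_forall (by positivity) fun v => ?_
  rw [← sq_le_sq₀ (norm_nonneg _) (by positivity), mul_pow, norm_toLp_sq, norm_toLp_sq]
  calc _ ≤ ∑ _a : m, (Fintype.card m * e ^ 2) * ∑ i, v i ^ 2 := by
        refine Finset.sum_le_sum fun a _ => ?_
        have h1 := dotProduct_sq_le_mul (A a) v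
        have h2 : A a ⬝ᵥ A a ≤ Fintype.card m * e ^ 2 := by
          rw [dotProduct, ← nsmul_eq_mul, ← Finset.card_univ, ← Finset.sum_const]
          refine Finset.sum_le_sum fun b _ => ?_
          rw [← pow_two, ← sq_abs]
          exact pow_le_pow_left₀ (abs_nonneg _) (h a b) 2
        have h3 : v ⬝ᵥ v = ∑ i, v i ^ 2 := by simp [dotProduct, pow_two]
        rw [h3] at h1
        exact h1.trans (mul_le_mul_of_nonneg_right h2 (Finset.sum_nonneg fun _ _ => sq_nonneg _))
    _ = _ := by
        rw [Finset.sum_const, Finset.card_univ, nsmul_eq_mul]; ring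

end Dilation

/-! ### Moments and tails of sub-exponential noise. -/

section NoiseMoments

variable {Ω : Type*} [MeasurableSpace Ω] {μ : Measure Ω} {d : ℕ} {c K : ℝ}

/-- All one-dimensional marginals in unit directions are centered and uniformly sub-exponential. -/
structure IsSubExpVec (g : Ω → Fin d → ℝ) (c K : ℝ) (μ : Measure Ω) : Prop where
  subExp : ∀ u : Fin d → ℝ, u ⬝ᵥ u = 1 → IsSubExp (fun ω => g ω ⬝ᵥ u) c K μ
  mean : ∀ u : Fin d → ℝ, u ⬝ᵥ u = 1 → ∫ ω, g ω ⬝ᵥ u ∂μ = 0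

namespace IsSubExpVec

variable {g h : Ω → Fin d → ℝ}

theorem apply (hg : IsSubExpVec g c K μ) (a : Fin d) : IsSubExp (fun ω => g ω a) c K μ := by
  simpa using hg.subExp (Pi.single a 1) (by simp)

theorem mean_apply (hg : IsSubExpVec g c K μ) (a : Fin d) : ∫ ω, g ω a ∂μ = 0 := by
  simpa using hg.mean (Pi.single a 1) (by simp)

theorem measurable (hg : IsSubExpVec g c K μ) : Measurable g :=
  measurable_pi_lambda _ fun a => (hg.apply a).measurable

theorem integral_dotProduct_sq_le (hg : IsSubExpVec g c K μ) (hc : 0 < c) (v : Fin d → ℝ) :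
    Integrable (fun ω => (g ω ⬝ᵥ v) ^ 2) μ ∧
      ∫ ω, (g ω ⬝ᵥ v) ^ 2 ∂μ ≤ 2 / c ^ 2 * K * (v ⬝ᵥ v) := by
  rcases eq_or_lt_of_le (dotProduct_self_nonneg' v) with h0 | h0
  · have : v = 0 := dotProduct_self_eq_zero.1 h0.symm
    simp [this]
  · have hs : 0 < √(v ⬝ᵥ v) := Real.sqrt_pos.2 h0
    have hu : ((√(v ⬝ᵥ v))⁻¹ • v) ⬝ᵥ ((√(v ⬝ᵥ v))⁻¹ • v) = 1 := by
      rw [smul_dotProduct, dotProduct_smul, smul_eq_mul, smul_eq_mul, ← mul_assoc, ← mul_inv,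
        Real.mul_self_sqrt h0.le, inv_mul_cancel₀ h0.ne']
    have e : ∀ ω, (g ω ⬝ᵥ v) ^ 2 = (v ⬝ᵥ v) * (g ω ⬝ᵥ ((√(v ⬝ᵥ v))⁻¹ • v)) ^ 2 := by
      intro ω
      rw [dotProduct_smul, smul_eq_mul, mul_pow, inv_pow, Real.sq_sqrt h0.le, ← mul_assoc,
        mul_inv_cancel₀ h0.ne', one_mul]
    simp only [e]
    refine ⟨((hg.subExp _ hu).integrable_sq hc).const_mul _, ?_⟩
    rw [integral_const_mul, mul_comm]
    exact mul_le_mul_of_nonneg_right ((hg.subExp _ hu).integral_sq_le hc) h0.le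

theorem integral_dotProduct_self_le (hg : IsSubExpVec g c K μ) (hc : 0 < c) :
    Integrable (fun ω => g ω ⬝ᵥ g ω) μ ∧ ∫ ω, g ω ⬝ᵥ g ω ∂μ ≤ d * (2 / c ^ 2 * K) := by
  have e : ∀ ω, g ω ⬝ᵥ g ω = ∑ a, g ω a ^ 2 := fun ω => by simp [dotProduct, pow_two]
  simp only [e]
  refine ⟨integrable_finsetSum _ fun a _ => (hg.apply a).integrable_sq hc, ?_⟩
  rw [integral_finsetSum _ fun a _ => (hg.apply a).integrable_sq hc]
  calc _ ≤ ∑ _a : Fin d, 2 / c ^ 2 * K :=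
        Finset.sum_le_sum fun a _ => (hg.apply a).integral_sq_le hc
    _ = _ := by simp

/-- If `‖g‖² > d r²`, some coordinate exceeds `r` in absolute value; a union bound over coordinates
concludes. -/
theorem measureReal_gt_le [IsFiniteMeasure μ] (hg : IsSubExpVec g c K μ) (hc : 0 < c) (r : ℝ) :
    μ.real {ω | d * r ^ 2 < g ω ⬝ᵥ g ω} ≤ d * (K * Real.exp (-(c * r))) := by
  have hsub : {ω | d * r ^ 2 < g ω ⬝ᵥ g ω} ⊆ ⋃ a : Fin d, {ω | r < |g ω a|} := by
    intro ω hω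
    by_contra hcon
    simp only [Set.mem_iUnion, Set.mem_ofPred_eq, not_exists, not_lt] at hcon hω
    have : g ω ⬝ᵥ g ω ≤ ∑ _a : Fin d, r ^ 2 := by
      rw [dotProduct]
      refine Finset.sum_le_sum fun a _ => ?_
      rw [← pow_two, ← sq_abs]
      exact pow_le_pow_left₀ (abs_nonneg _) (hcon a) 2
    simp at this
    linarith
  calc _ ≤ μ.real (⋃ a : Fin d, {ω | r < |g ω a|}) := measureReal_mono hsub
    _ ≤ ∑ a : Fin d, μ.real {ω | r < |g ω a|} := measureReal_iUnion_fintype_le _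
    _ ≤ ∑ _a : Fin d, K * Real.exp (-(c * r)) :=
        Finset.sum_le_sum fun a _ => (hg.apply a).measureReal_gt_le hc r
    _ = _ := by simp

/-- Second moment of the noise matrix applied to a vector. -/
theorem integral_noiseMatrix_mulVec_sq_le (hg : IsSubExpVec g c K μ) (hh : IsSubExpVec h c K μ)
    (hind : IndepFun g h μ) (hc : 0 < c) (hK : 0 ≤ K) (b v : Fin d → ℝ) :
    Integrable (fun ω => 3 * ((b ⬝ᵥ v) ^ 2 * (g ω ⬝ᵥ g ω) + (h ω ⬝ᵥ v) ^ 2 * (b ⬝ᵥ b) +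
        (h ω ⬝ᵥ v) ^ 2 * (g ω ⬝ᵥ g ω))) μ ∧
    ∫ ω, 3 * ((b ⬝ᵥ v) ^ 2 * (g ω ⬝ᵥ g ω) + (h ω ⬝ᵥ v) ^ 2 * (b ⬝ᵥ b) +
        (h ω ⬝ᵥ v) ^ 2 * (g ω ⬝ᵥ g ω)) ∂μ ≤
      3 * ((b ⬝ᵥ v) ^ 2 * (d * (2 / c ^ 2 * K)) + (2 / c ^ 2 * K) * (v ⬝ᵥ v) * (b ⬝ᵥ b) +
        (2 / c ^ 2 * K) * (v ⬝ᵥ v) * (d * (2 / c ^ 2 * K))) := by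
  obtain ⟨i1, l1⟩ := hg.integral_dotProduct_self_le hc
  obtain ⟨i2, l2⟩ := hh.integral_dotProduct_sq_le hc v
  -- Independence factors the quadratic noise term, so second moments of `g` and `h` suffice.
  have hind' : IndepFun (fun ω => (h ω ⬝ᵥ v) ^ 2) (fun ω => g ω ⬝ᵥ g ω) μ := by
    refine hind.symm.comp (φ := fun x => (x ⬝ᵥ v) ^ 2) (ψ := fun x => x ⬝ᵥ x) ?_ ?_
    · simp only [dotProduct]; fun_prop
    · simp only [dotProduct]; fun_prop
  have i3 : Integrable (fun ω => (h ω ⬝ᵥ v) ^ 2 * (g ω ⬝ᵥ g ω)) μ := hind'.integrable_mul i2 i1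
  have l3 : ∫ ω, (h ω ⬝ᵥ v) ^ 2 * (g ω ⬝ᵥ g ω) ∂μ =
      (∫ ω, (h ω ⬝ᵥ v) ^ 2 ∂μ) * ∫ ω, g ω ⬝ᵥ g ω ∂μ :=
    hind'.integral_fun_mul_eq_mul_integral i2.aestronglyMeasurable i1.aestronglyMeasurable
  have hv := dotProduct_self_nonneg' v
  have hb := dotProduct_self_nonneg' b
  have j1 := (i1.const_mul ((b ⬝ᵥ v) ^ 2)).add (i2.mul_const (b ⬝ᵥ b))
  refine ⟨(j1.add i3).const_mul 3, ?_⟩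
  rw [integral_const_mul, integral_add (by exact j1) i3,
    integral_add (i1.const_mul _) (i2.mul_const _), integral_const_mul, integral_mul_const, l3]
  have h0 : 0 ≤ ∫ ω, g ω ⬝ᵥ g ω ∂μ := integral_nonneg fun ω => dotProduct_self_nonneg' _
  gcongr

/-- Entrywise first and second moments, used to estimate the bias created by truncation. The product
term is centered because `g` and `h` are independent and centered. -/
theorem noiseMatrix_apply_moments [IsProbabilityMeasure μ] (hg : IsSubExpVec g c K μ) (hh : IsSubExpVec h c K μ)
    (hind : IndepFun g h μ) (hc : 0 < c) (hK : 0 ≤ K) (b : Fin d → ℝ) {T : ℝ}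
    (hT : b ⬝ᵥ b ≤ T) (i j : Fin d) :
    Integrable (fun ω => noiseMatrix (g ω) (h ω) b i j) μ ∧
    ∫ ω, noiseMatrix (g ω) (h ω) b i j ∂μ = 0 ∧
    Integrable (fun ω => noiseMatrix (g ω) (h ω) b i j ^ 2) μ ∧
    ∫ ω, noiseMatrix (g ω) (h ω) b i j ^ 2 ∂μ ≤
      3 * (2 * (2 / c ^ 2 * K) * T + (2 / c ^ 2 * K) ^ 2) := by
  have e : ∀ ω, noiseMatrix (g ω) (h ω) b i j = g ω i * b j + b i * h ω j + g ω i * h ω j := by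
    intro ω; simp [noiseMatrix, Matrix.vecMulVec_apply]
  have hindij : IndepFun (fun ω => g ω i) (fun ω => h ω j) μ :=
    hind.comp (measurable_pi_apply i) (measurable_pi_apply j)
  have hind2 : IndepFun (fun ω => g ω i ^ 2) (fun ω => h ω j ^ 2) μ :=
    hindij.comp (φ := fun x => x ^ 2) (ψ := fun x => x ^ 2) (by fun_prop) (by fun_prop)
  have ig := ((hg.apply i).memLp_two hc).integrable one_le_two
  have ih := ((hh.apply j).memLp_two hc).integrable one_le_two
  have igh : Integrable (fun ω => g ω i * h ω j) μ := hindij.integrable_mul ig ih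
  have sg := (hg.apply i).integrable_sq hc
  have sh := (hh.apply j).integrable_sq hc
  have sgh : Integrable (fun ω => g ω i ^ 2 * h ω j ^ 2) μ := hind2.integrable_mul sg sh
  have lg := (hg.apply i).integral_sq_le hc
  have lh := (hh.apply j).integral_sq_le hc
  have lgh : ∫ ω, g ω i ^ 2 * h ω j ^ 2 ∂μ = (∫ ω, g ω i ^ 2 ∂μ) * ∫ ω, h ω j ^ 2 ∂μ :=
    hind2.integral_fun_mul_eq_mul_integral sg.aestronglyMeasurable sh.aestronglyMeasurable
  have hbnd : ∀ ω, noiseMatrix (g ω) (h ω) b i j ^ 2 ≤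
      3 * (g ω i ^ 2 * b j ^ 2 + b i ^ 2 * h ω j ^ 2 + g ω i ^ 2 * h ω j ^ 2) := by
    intro ω
    rw [e]
    nlinarith [sq_nonneg (g ω i * b j - b i * h ω j), sq_nonneg (g ω i * b j - g ω i * h ω j),
      sq_nonneg (b i * h ω j - g ω i * h ω j)]
  have i0 : Integrable (fun ω => noiseMatrix (g ω) (h ω) b i j) μ := by
    simp only [e]
    exact ((ig.mul_const _).add (ih.const_mul _)).add igh
  have ib : Integrable (fun ω => 3 * (g ω i ^ 2 * b j ^ 2 + b i ^ 2 * h ω j ^ 2 +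
      g ω i ^ 2 * h ω j ^ 2)) μ :=
    (((sg.mul_const _).add (sh.const_mul _)).add sgh).const_mul 3
  have is : Integrable (fun ω => noiseMatrix (g ω) (h ω) b i j ^ 2) μ :=
    ib.mono' (i0.aestronglyMeasurable.pow 2) (.of_forall fun ω => by
      rw [Real.norm_of_nonneg (sq_nonneg _)]; exact hbnd ω)
  refine ⟨i0, ?_, is, (integral_mono is ib hbnd).trans ?_⟩
  · simp only [e]
    rw [integral_add (by exact (ig.mul_const _).add (ih.const_mul _)) igh,
      integral_add (ig.mul_const _) (ih.const_mul _), integral_mul_const, integral_const_mul,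
      hindij.integral_fun_mul_eq_mul_integral ig.aestronglyMeasurable ih.aestronglyMeasurable,
      hg.mean_apply, hh.mean_apply]
    simp
  · rw [integral_const_mul,
      integral_add (by exact (sg.mul_const _).add (sh.const_mul _)) sgh,
      integral_add (sg.mul_const _) (sh.const_mul _), integral_mul_const, integral_const_mul, lgh]
    have hbj : ∀ j, b j ^ 2 ≤ T := fun j => by
      refine le_trans ?_ hT
      rw [dotProduct, pow_two]
      exact Finset.single_le_sum (f := fun j => b j * b j) (fun _ _ => mul_self_nonneg _)
        (Finset.mem_univ j)
    have g0 : 0 ≤ ∫ ω, g ω i ^ 2 ∂μ := integral_nonneg fun ω => sq_nonneg _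
    have h0 : 0 ≤ ∫ ω, h ω j ^ 2 ∂μ := integral_nonneg fun ω => sq_nonneg _
    have t1 := mul_le_mul lg (hbj j) (sq_nonneg _) (by positivity)
    have t2 := mul_le_mul (hbj i) lh h0 ((sq_nonneg _).trans (hbj i))
    have t3 := mul_le_mul lg lh h0 (by positivity)
    nlinarith

end IsSubExpVec

end NoiseMoments

/-! ### Truncated noise: size, variance, bias and trace moments. -/

section NoiseConcentration

theorem dilation_sub {m : Type*} (X Y : Matrix m m ℝ) :
    dilation (X - Y) = dilation X - dilation Y := by
  ext (a | a) (b | b) <;> simp [dilation]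

theorem dilation_sum {m ι : Type*} (s : Finset ι) (X : ι → Matrix m m ℝ) :
    dilation (∑ i ∈ s, X i) = ∑ i ∈ s, dilation (X i) := by
  ext (a | a) (b | b) <;> simp [dilation, Matrix.sum_apply]

theorem meanMatrix_dilation {Ω m : Type*} [MeasurableSpace Ω] (μ : Measure Ω)
    (X : Ω → Matrix m m ℝ) :
    meanMatrix (fun ω => dilation (X ω)) μ = dilation (meanMatrix X μ) := by
  ext (a | a) (b | b) <;> simp [dilation, meanMatrix]

/-- An even trace moment of the dilation controls the operator norm. -/
theorem l2_opNorm_le_of_trace_dilation_pow_le {m : Type*} [Fintype m] [DecidableEq m]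
    {X : Matrix m m ℝ} {T : ℝ} (hT : 0 ≤ T) {p : ℕ} (hp : p ≠ 0)
    (h : (dilation X ^ (2 * p)).trace ≤ T ^ (2 * p)) (v : m → ℝ) :
    ‖WithLp.toLp 2 (X *ᵥ v)‖ ≤ T * ‖WithLp.toLp 2 v‖ := by
  have h1 := dotProduct_sq_mulVec_le_of_trace_pow_le (isHermitian_dilation X) hp h (Sum.elim 0 v)
  rw [dilation_mulVec] at h1
  simp only [Sum.elim_comp_inr, Sum.elim_comp_inl, Matrix.mulVec_zero] at h1
  rw [← sq_le_sq₀ (norm_nonneg _) (by positivity), mul_pow, norm_toLp_sq_eq_dotProduct,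
    norm_toLp_sq_eq_dotProduct]
  simpa [dotProduct] using h1

variable {d : ℕ}

open Classical in
/-- The noise matrix, set to zero when one of the two noise vectors is large. -/
noncomputable def truncNoise (ρ : ℝ) (b : Fin d → ℝ) (p : (Fin d → ℝ) × (Fin d → ℝ)) :
    Matrix (Fin d) (Fin d) ℝ :=
  if p.1 ⬝ᵥ p.1 ≤ ρ ∧ p.2 ⬝ᵥ p.2 ≤ ρ then noiseMatrix p.1 p.2 b else 0

theorem measurableSet_trunc (ρ : ℝ) : MeasurableSet
    {p : (Fin d → ℝ) × (Fin d → ℝ) | p.1 ⬝ᵥ p.1 ≤ ρ ∧ p.2 ⬝ᵥ p.2 ≤ ρ} := by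
  have : {p : (Fin d → ℝ) × (Fin d → ℝ) | p.1 ⬝ᵥ p.1 ≤ ρ ∧ p.2 ⬝ᵥ p.2 ≤ ρ} =
      {p | p.1 ⬝ᵥ p.1 ≤ ρ} ∩ {p | p.2 ⬝ᵥ p.2 ≤ ρ} := rfl
  rw [this]
  refine (measurableSet_le ?_ measurable_const).inter (measurableSet_le ?_ measurable_const)
  · simp only [dotProduct]; fun_prop
  · simp only [dotProduct]; fun_prop

theorem measurable_truncNoise_apply (ρ : ℝ) (b : Fin d → ℝ) (i j : Fin d) :
    Measurable fun p => truncNoise ρ b p i j := by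
  have e : (fun p => truncNoise ρ b p i j) =
      {p : (Fin d → ℝ) × (Fin d → ℝ) | p.1 ⬝ᵥ p.1 ≤ ρ ∧ p.2 ⬝ᵥ p.2 ≤ ρ}.indicator
        fun p => noiseMatrix p.1 p.2 b i j := by
    ext p
    by_cases h : p.1 ⬝ᵥ p.1 ≤ ρ ∧ p.2 ⬝ᵥ p.2 ≤ ρ <;> simp [truncNoise, h]
  rw [e]
  refine Measurable.indicator ?_ (measurableSet_trunc ρ)
  simp only [noiseMatrix, Matrix.add_apply, Matrix.vecMulVec_apply]
  fun_prop

theorem measurable_dilation_truncNoise (ρ : ℝ) (b : Fin d → ℝ) :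
    Measurable fun p => dilation (truncNoise ρ b p) := by
  refine Matrix.measurable_iff.2 ?_
  rintro (a | a) (b' | b')
  · simp [dilation]
  · simpa [dilation] using measurable_truncNoise_apply ρ b a b'
  · simpa [dilation] using measurable_truncNoise_apply ρ b b' a
  · simp [dilation]

theorem truncNoise_mulVec_sq_le_of_le {ρ T : ℝ} (hT : 0 ≤ T) (hρ : 0 ≤ ρ) {b : Fin d → ℝ}
    (hb : b ⬝ᵥ b ≤ T) (p : (Fin d → ℝ) × (Fin d → ℝ)) (v : Fin d → ℝ) :
    (truncNoise ρ b p *ᵥ v) ⬝ᵥ (truncNoise ρ b p *ᵥ v) ≤ 3 * (2 * T * ρ + ρ ^ 2) * (v ⬝ᵥ v) ∧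
    ((truncNoise ρ b p)ᵀ *ᵥ v) ⬝ᵥ ((truncNoise ρ b p)ᵀ *ᵥ v) ≤
      3 * (2 * T * ρ + ρ ^ 2) * (v ⬝ᵥ v) := by
  rw [truncNoise]
  split_ifs with h
  · rw [transpose_noiseMatrix]
    exact ⟨noiseMatrix_mulVec_sq_le_of_le h.1 h.2 hb v,
      noiseMatrix_mulVec_sq_le_of_le h.2 h.1 hb v⟩
  · have := dotProduct_self_nonneg' v
    simp only [Matrix.transpose_zero, Matrix.zero_mulVec, dotProduct_zero, and_self]
    positivity

theorem truncNoise_mulVec_sq_le (ρ : ℝ) (b : Fin d → ℝ) (g h v : Fin d → ℝ) :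
    (truncNoise ρ b (g, h) *ᵥ v) ⬝ᵥ (truncNoise ρ b (g, h) *ᵥ v) ≤
      3 * ((b ⬝ᵥ v) ^ 2 * (g ⬝ᵥ g) + (h ⬝ᵥ v) ^ 2 * (b ⬝ᵥ b) + (h ⬝ᵥ v) ^ 2 * (g ⬝ᵥ g)) ∧
    ((truncNoise ρ b (g, h))ᵀ *ᵥ v) ⬝ᵥ ((truncNoise ρ b (g, h))ᵀ *ᵥ v) ≤
      3 * ((b ⬝ᵥ v) ^ 2 * (h ⬝ᵥ h) + (g ⬝ᵥ v) ^ 2 * (b ⬝ᵥ b) + (g ⬝ᵥ v) ^ 2 * (h ⬝ᵥ h)) := by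
  rw [truncNoise]
  split_ifs with hp
  · rw [transpose_noiseMatrix]
    exact ⟨noiseMatrix_mulVec_sq_le _ _ b v, noiseMatrix_mulVec_sq_le _ _ b v⟩
  · have h1 := dotProduct_self_nonneg' g
    have h2 := dotProduct_self_nonneg' h
    have h3 := dotProduct_self_nonneg' b
    simp only [Matrix.transpose_zero, Matrix.zero_mulVec, dotProduct_zero]
    constructor <;> positivity

theorem posSemidef_sub_dilation_truncNoise_sq {ρ T : ℝ} (hT : 0 ≤ T) (hρ : 0 ≤ ρ)
    {b : Fin d → ℝ} (hb : b ⬝ᵥ b ≤ T) (p : (Fin d → ℝ) × (Fin d → ℝ)) :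
    ((3 * (2 * T * ρ + ρ ^ 2)) • (1 : Matrix (Fin d ⊕ Fin d) (Fin d ⊕ Fin d) ℝ) -
      dilation (truncNoise ρ b p) * dilation (truncNoise ρ b p)).PosSemidef := by
  refine posSemidef_smul_one_sub_of_le
    (isHermitian_dilation _).mul_self_posSemidef.isHermitian fun w => ?_
  rw [dotProduct_dilation_sq, dotProduct_self_sum, mul_add]
  exact add_le_add (truncNoise_mulVec_sq_le_of_le hT hρ hb p _).1
    (truncNoise_mulVec_sq_le_of_le hT hρ hb p _).2

variable {Ω : Type*} [MeasurableSpace Ω] {μ : Measure Ω}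

theorem isBddMeas_dilation_truncNoise {ρ T : ℝ} (hT : 0 ≤ T) (hρ : 0 ≤ ρ) {b : Fin d → ℝ}
    (hb : b ⬝ᵥ b ≤ T) {g h : Ω → Fin d → ℝ} (hg : Measurable g) (hh : Measurable h) :
    IsBddMeas fun ω => dilation (truncNoise ρ b (g ω, h ω)) :=
  ⟨(measurable_dilation_truncNoise ρ b).comp (hg.prodMk hh), _, fun _ i j =>
    abs_apply_le_of_posSemidef (isHermitian_dilation _)
      (posSemidef_sub_dilation_truncNoise_sq hT hρ hb _) i j⟩

variable [IsProbabilityMeasure μ] {c K : ℝ}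

/-- Truncation only decreases the squares, so the moments of the untruncated noise and of its
transpose bound the two blocks. The dependence on `b · w` is kept explicit, since summed over
clients it is controlled by `T ‖w‖²`. -/
theorem integral_dilation_truncNoise_sq_le {ρ T : ℝ} (hT : 0 ≤ T) (hρ : 0 ≤ ρ) {b : Fin d → ℝ}
    (hb : b ⬝ᵥ b ≤ T) {g h : Ω → Fin d → ℝ} (hg : IsSubExpVec g c K μ) (hh : IsSubExpVec h c K μ)
    (hind : IndepFun g h μ) (hc : 0 < c) (hK : 0 ≤ K) (w : Fin d ⊕ Fin d → ℝ) :
    w ⬝ᵥ (meanMatrix (fun ω => dilation (truncNoise ρ b (g ω, h ω)) *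
        dilation (truncNoise ρ b (g ω, h ω))) μ *ᵥ w) ≤
      3 * (((b ⬝ᵥ (w ∘ Sum.inr)) ^ 2 + (b ⬝ᵥ (w ∘ Sum.inl)) ^ 2) * (d * (2 / c ^ 2 * K)) +
        (2 / c ^ 2 * K) * (w ⬝ᵥ w) * (b ⬝ᵥ b) +
        (2 / c ^ 2 * K) * (w ⬝ᵥ w) * (d * (2 / c ^ 2 * K))) := by
  have hbdd := isBddMeas_dilation_truncNoise hT hρ hb hg.measurable hh.measurable
  rw [(hbdd.mul hbdd).dotProduct_meanMatrix_mulVec]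
  obtain ⟨i1, l1⟩ := hg.integral_noiseMatrix_mulVec_sq_le hh hind hc hK b (w ∘ Sum.inr)
  obtain ⟨i2, l2⟩ := hh.integral_noiseMatrix_mulVec_sq_le hg hind.symm hc hK b (w ∘ Sum.inl)
  have := integral_mono_of_nonneg (μ := μ)
    (f := fun ω => w ⬝ᵥ ((dilation (truncNoise ρ b (g ω, h ω)) *
        dilation (truncNoise ρ b (g ω, h ω))) *ᵥ w))
    (.of_forall fun ω => by
      simpa using (isHermitian_dilation
        (truncNoise ρ b (g ω, h ω))).mul_self_posSemidef.dotProduct_mulVec_nonneg w)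
    (i1.add i2) (.of_forall fun ω => by
      simp only [dotProduct_dilation_sq]
      exact add_le_add (truncNoise_mulVec_sq_le ρ b (g ω) (h ω) _).1
        (truncNoise_mulVec_sq_le ρ b (g ω) (h ω) _).2)
  refine this.trans ?_
  simp only [Pi.add_apply]
  rw [integral_add i1 i2, dotProduct_self_sum w]
  linarith

/-- The full noise is centered, so the truncated mean is minus the mean over the discarded event.
There `|x| ≤ (θ + x²/θ) / 2`, with `θ` left free to balance the probability of that event against
the second moment. -/
theorem abs_meanMatrix_truncNoise_le {ρ T : ℝ} {b : Fin d → ℝ}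
    (hb : b ⬝ᵥ b ≤ T) {g h : Ω → Fin d → ℝ} (hg : IsSubExpVec g c K μ) (hh : IsSubExpVec h c K μ)
    (hind : IndepFun g h μ) (hc : 0 < c) (hK : 0 ≤ K) {θ : ℝ} (hθ : 0 < θ) (i j : Fin d) :
    |meanMatrix (fun ω => truncNoise ρ b (g ω, h ω)) μ i j| ≤
      (θ * μ.real {ω | ¬ (g ω ⬝ᵥ g ω ≤ ρ ∧ h ω ⬝ᵥ h ω ≤ ρ)} +
        3 * (2 * (2 / c ^ 2 * K) * T + (2 / c ^ 2 * K) ^ 2) / θ) / 2 := by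
  obtain ⟨i1, m1, i2, l2⟩ := hg.noiseMatrix_apply_moments hh hind hc hK b hb i j
  set G : Set Ω := {ω | ¬ (g ω ⬝ᵥ g ω ≤ ρ ∧ h ω ⬝ᵥ h ω ≤ ρ)} with hG
  have hGm : MeasurableSet G :=
    (((hg.measurable.prodMk hh.measurable) (measurableSet_trunc ρ))).compl
  have e : ∀ ω, truncNoise ρ b (g ω, h ω) i j =
      noiseMatrix (g ω) (h ω) b i j - G.indicator (fun ω => noiseMatrix (g ω) (h ω) b i j) ω := by
    intro ω
    by_cases hω : g ω ⬝ᵥ g ω ≤ ρ ∧ h ω ⬝ᵥ h ω ≤ ρ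
    · have : ω ∉ G := by simp only [hG, Set.mem_ofPred_eq, not_not]; exact hω
      simp [truncNoise, hω, this]
    · have : ω ∈ G := hω
      simp [truncNoise, hω, this]
  simp only [meanMatrix, Matrix.of_apply, e]
  rw [integral_sub i1 (i1.indicator hGm), m1, zero_sub, abs_neg]
  refine (abs_integral_le_integral_abs).trans ?_
  have i4 : Integrable (fun ω => θ * G.indicator 1 ω) μ :=
    ((integrable_const (1 : ℝ)).indicator hGm).const_mul θ
  have i3 : Integrable (fun ω => (θ * G.indicator 1 ω +
      noiseMatrix (g ω) (h ω) b i j ^ 2 / θ) / 2) μ :=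
    (i4.add (i2.div_const θ)).div_const 2
  have hle : ∀ ω, |G.indicator (fun ω => noiseMatrix (g ω) (h ω) b i j) ω| ≤
      (θ * G.indicator 1 ω + noiseMatrix (g ω) (h ω) b i j ^ 2 / θ) / 2 := by
    intro ω
    by_cases hω : ω ∈ G
    · simp only [Set.indicator_of_mem hω, Pi.one_apply, mul_one]
      set x := noiseMatrix (g ω) (h ω) b i j
      have h1 : θ * (x ^ 2 / θ) = x ^ 2 := by field_simp
      have h2 : 0 ≤ (θ - |x|) ^ 2 := sq_nonneg _
      have h3 : 2 * θ * |x| ≤ θ * (θ + x ^ 2 / θ) := by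
        rw [mul_add, h1, ← sq_abs x]; nlinarith
      have h4 : 2 * |x| ≤ θ + x ^ 2 / θ := le_of_mul_le_mul_left (by linarith) hθ
      linarith
    · simp only [Set.indicator_of_notMem hω, abs_zero, mul_zero, zero_add]
      positivity
  refine (integral_mono (i1.indicator hGm).abs i3 hle).trans ?_
  rw [integral_div, integral_add i4 (i2.div_const θ), integral_const_mul, integral_div, integral_indicator_one hGm]
  gcongr

variable {M : ℕ}

/-- Moment bound for the centered truncated noise. -/
theorem integral_trace_dilation_truncNoise_pow_le {g h : Fin M → Ω → Fin d → ℝ}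
    {b : Fin M → Fin d → ℝ} {ρ T : ℝ} (hT : 0 ≤ T) (hρ : 0 ≤ ρ) (hc : 0 < c) (hK : 0 ≤ K)
    (hg : ∀ i, IsSubExpVec (g i) c K μ) (hh : ∀ i, IsSubExpVec (h i) c K μ)
    (hgh : ∀ i, IndepFun (g i) (h i) μ)
    (hind : ∀ i, IndepFun (fun ω => (g i ω, h i ω))
      (fun ω (j : {j // j ≠ i}) => (g j ω, h j ω)) μ)
    (hb : ∀ i, b i ⬝ᵥ b i ≤ T) (hbs : ∑ i, b i ⬝ᵥ b i ≤ T * d)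
    (hbv : ∀ v : Fin d → ℝ, ∑ i, (b i ⬝ᵥ v) ^ 2 ≤ T * (v ⬝ᵥ v)) {p : ℕ} (hp : Even p)
    (hp0 : p ≠ 0) :
    Integrable (fun ω => (dilation (∑ i, truncNoise ρ (b i) (g i ω, h i ω) -
      ∑ i, meanMatrix (fun ω => truncNoise ρ (b i) (g i ω, h i ω)) μ) ^ (2 * p)).trace) μ ∧
    ∫ ω, (dilation (∑ i, truncNoise ρ (b i) (g i ω, h i ω) -
      ∑ i, meanMatrix (fun ω => truncNoise ρ (b i) (g i ω, h i ω)) μ) ^ (2 * p)).trace ∂μ ≤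
      (2 * d) * (16 * p * (p * (4 * (3 * (2 * T * ρ + ρ ^ 2))) +
        3 * (2 * (2 / c ^ 2 * K) * (d * T) + (2 / c ^ 2 * K) ^ 2 * (M * d)))) ^ p := by
  have hbdd : ∀ i, IsBddMeas fun ω => dilation (truncNoise ρ (b i) (g i ω, h i ω)) := fun i =>
    isBddMeas_dilation_truncNoise hT hρ (hb i) (hg i).measurable (hh i).measurable
  set κ := 2 / c ^ 2 * K with hκ
  have hκ0 : 0 ≤ κ := by positivity
  have e : ∀ ω, dilation (∑ i, truncNoise ρ (b i) (g i ω, h i ω) -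
      ∑ i, meanMatrix (fun ω => truncNoise ρ (b i) (g i ω, h i ω)) μ) =
      ∑ i, (dilation (truncNoise ρ (b i) (g i ω, h i ω)) -
        meanMatrix (fun ω => dilation (truncNoise ρ (b i) (g i ω, h i ω))) μ) := by
    intro ω
    simp only [meanMatrix_dilation]
    rw [Finset.sum_sub_distrib, dilation_sub, dilation_sum, dilation_sum]
  simp only [e]
  refine ⟨((IsBddMeas.sum _ fun i _ => (hbdd i).sub (.const _)).pow _).integrable_trace, ?_⟩
  -- The first parameter bounds every squared summand; the second is the total variance, where `hbv`
  -- controls the terms with `b · w` and `hbs` those with `‖b‖²`.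
  have h1 := integral_trace_sum_sub_meanMatrix_pow_le (μ := μ)
    (ρ := 3 * (2 * T * ρ + ρ ^ 2)) (v := 3 * (2 * κ * (d * T) + κ ^ 2 * (M * d))) hbdd
    (fun i ω => isHermitian_dilation _)
    (indepFun_comp_others (X := fun i ω => (g i ω, h i ω))
      (φ := fun i p => dilation (truncNoise ρ (b i) p)) hind
      fun i => measurable_dilation_truncNoise ρ (b i))
    (by positivity) (by positivity)
    (fun i ω => posSemidef_sub_dilation_truncNoise_sq hT hρ (hb i) _)
    (by
      refine posSemidef_smul_one_sub_of_le (isHermitian_sum fun i =>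
        IsBddMeas.isHermitian_meanMatrix fun ω =>
          (isHermitian_dilation _).mul_self_posSemidef.isHermitian) fun w => ?_
      rw [Matrix.sum_mulVec, dotProduct_sum]
      refine (Finset.sum_le_sum fun i _ => integral_dilation_truncNoise_sq_le hT hρ (hb i) (hg i)
        (hh i) (hgh i) hc hK w).trans ?_
      rw [← hκ, ← Finset.mul_sum, Finset.sum_add_distrib, Finset.sum_add_distrib,
        ← Finset.sum_mul, Finset.sum_add_distrib, ← Finset.mul_sum, Finset.sum_const,
        Finset.card_univ, Fintype.card_fin, nsmul_eq_mul]
      have a1 := hbv (w ∘ Sum.inr)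
      have a2 := hbv (w ∘ Sum.inl)
      have a3 := dotProduct_self_sum w
      have a4 := dotProduct_self_nonneg' w
      have a5 := mul_le_mul_of_nonneg_right (add_le_add a1 a2)
        (show (0 : ℝ) ≤ d * κ by positivity)
      have a6 := mul_le_mul_of_nonneg_left hbs (show 0 ≤ κ * (w ⬝ᵥ w) by positivity)
      rw [← mul_add, ← a3] at a5
      linarith) hp hp0
  refine h1.trans (le_of_eq ?_)
  simp only [Fintype.card_sum, Fintype.card_fin, Nat.cast_add]
  ring

end NoiseConcentration

/-! ### Choice of parameters and the high-probability noise bound. -/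

section NoiseConcentration

theorem Real.sqrt_add_le_add_sqrt_of_nonneg {x y : ℝ} (hx : 0 ≤ x) (hy : 0 ≤ y) :
    √(x + y) ≤ √x + √y := by
  rw [Real.sqrt_le_left (by positivity)]
  nlinarith [Real.sq_sqrt hx, Real.sq_sqrt hy, Real.sqrt_nonneg x, Real.sqrt_nonneg y,
    mul_nonneg (Real.sqrt_nonneg x) (Real.sqrt_nonneg y)]

/-- The power `L⁶` combines `L²` from the square of the moment order and `L⁴` from the squared
truncation level; its square root is the `log³` of the theorem. The term `d²` is replaced by `d T`,
which is where `d ≤ T` enters. -/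
theorem bernstein_parameters_le {c κ T L d M : ℝ} {p : ℕ} (hc : 0 < c) (hκ : 0 ≤ κ) (hL : 1 ≤ L)
    (hd : 0 ≤ d) (hM : 0 ≤ M) (hdT : d ≤ T) (hp : (p : ℝ) ≤ 14 * L) :
    16 * p * (p * (4 * (3 * (2 * T * (d * (14 / c * L) ^ 2) + (d * (14 / c * L) ^ 2) ^ 2))) +
        3 * (2 * κ * (d * T) + κ ^ 2 * (M * d))) ≤
      224 * (168 * (2 * (14 / c) ^ 2 + (14 / c) ^ 4) + 6 * κ + 3 * κ ^ 2) *
        (L ^ 6 * (d * T + M * d)) := by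
  set q := 14 / c with hq
  have hq0 : 0 < q := by positivity
  have hT : 0 ≤ T := hd.trans hdT
  have hdT0 : 0 ≤ d * T := by positivity
  have hMd : 0 ≤ M * d := by positivity
  have hL2 : L ^ 2 ≤ L ^ 4 := pow_le_pow_right₀ hL (by norm_num)
  have hL5 : L ≤ L ^ 6 := by simpa using pow_le_pow_right₀ hL (show 1 ≤ 6 by norm_num)
  have hL0 : 0 ≤ L := by linarith
  have r1 : 2 * T * (d * (q * L) ^ 2) + (d * (q * L) ^ 2) ^ 2 ≤
      (2 * q ^ 2 + q ^ 4) * (L ^ 4 * (d * T)) := by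
    have h1 : q ^ 2 * (d * T) * L ^ 2 ≤ q ^ 2 * (d * T) * L ^ 4 := by gcongr
    have h2 : q ^ 4 * L ^ 4 * (d * d) ≤ q ^ 4 * L ^ 4 * (d * T) := by gcongr
    calc _ = 2 * (q ^ 2 * (d * T) * L ^ 2) + q ^ 4 * L ^ 4 * (d * d) := by ring
      _ ≤ 2 * (q ^ 2 * (d * T) * L ^ 4) + q ^ 4 * L ^ 4 * (d * T) := by linarith
      _ = _ := by ring
  have r2 : (p : ℝ) * (4 * (3 * (2 * T * (d * (q * L) ^ 2) + (d * (q * L) ^ 2) ^ 2))) ≤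
      14 * L * (4 * (3 * ((2 * q ^ 2 + q ^ 4) * (L ^ 4 * (d * T))))) := by gcongr
  have h0 : 0 ≤ 14 * L * (4 * (3 * ((2 * q ^ 2 + q ^ 4) * (L ^ 4 * (d * T))))) +
      3 * (2 * κ * (d * T) + κ ^ 2 * (M * d)) := by positivity
  calc _ ≤ 16 * (14 * L) * (14 * L * (4 * (3 * ((2 * q ^ 2 + q ^ 4) * (L ^ 4 * (d * T))))) +
        3 * (2 * κ * (d * T) + κ ^ 2 * (M * d))) := by gcongr
    _ = 224 * (168 * (2 * q ^ 2 + q ^ 4)) * (L ^ 6 * (d * T)) +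
        224 * (6 * κ) * (L * (d * T)) + 224 * (3 * κ ^ 2) * (L * (M * d)) := by ring
    _ ≤ 224 * (168 * (2 * q ^ 2 + q ^ 4)) * (L ^ 6 * (d * T + M * d)) +
        224 * (6 * κ) * (L ^ 6 * (d * T + M * d)) +
        224 * (3 * κ ^ 2) * (L ^ 6 * (d * T + M * d)) := by
        gcongr
        · linarith
        · linarith
        · linarith
    _ = _ := by ring

variable {Ω : Type*} [MeasurableSpace Ω] {μ : Measure Ω} [IsProbabilityMeasure μ]

/-- Markov's inequality for a power. -/
theorem measureReal_pow_lt_le {f : Ω → ℝ} (hf : 0 ≤ f) (hint : Integrable f μ) {Q S m : ℝ} {p : ℕ}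
    (hS : 0 < S) (hm : 0 ≤ m) (hQ0 : 0 ≤ Q) (hQ : 3 * Q ≤ S ^ 2) (hle : ∫ ω, f ω ∂μ ≤ m * Q ^ p) :
    μ.real {ω | S ^ (2 * p) < f ω} ≤ m * Real.exp (-p) := by
  have h1 := mul_meas_ge_le_integral_of_nonneg (μ := μ) (.of_forall hf) hint (S ^ (2 * p))
  have h2 : μ.real {ω | S ^ (2 * p) < f ω} ≤ μ.real {ω | S ^ (2 * p) ≤ f ω} :=
    measureReal_mono fun ω (hω : S ^ (2 * p) < f ω) => hω.le
  have hSp : 0 < S ^ (2 * p) := by positivity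
  -- Since `e < 3`, each of the `p` factors gains `1/e`.
  have he : Real.exp 1 * Q ≤ S ^ 2 := by
    have := Real.exp_one_lt_d9
    nlinarith
  have h3 : Real.exp p * Q ^ p ≤ S ^ (2 * p) := by
    have := pow_le_pow_left₀ (mul_nonneg (Real.exp_pos 1).le hQ0) he p
    rwa [mul_pow, ← Real.exp_nat_mul, mul_one, ← pow_mul] at this
  have h4 : Q ^ p ≤ S ^ (2 * p) * Real.exp (-p) := by
    rw [Real.exp_neg, ← div_eq_mul_inv, le_div_iff₀ (Real.exp_pos _)]
    linarith
  refine h2.trans (le_of_mul_le_mul_left ?_ hSp)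
  calc _ ≤ m * Q ^ p := h1.trans hle
    _ ≤ m * (S ^ (2 * p) * Real.exp (-p)) := by gcongr
    _ = _ := by ring

set_option maxHeartbeats 1000000 in
open scoped Matrix.Norms.L2Operator in
/-- High-probability bound on the total noise. -/
theorem exists_noise_concentration {c K : ℝ} (hc : 0 < c) (hK : 0 ≤ K) :
    ∃ C : ℝ, 0 < C ∧ ∀ (Ω : Type*) [MeasurableSpace Ω] (μ : Measure Ω) [IsProbabilityMeasure μ]
      (M d D : ℕ) (g h : Fin M → Ω → Fin d → ℝ) (b : Fin M → Fin d → ℝ) (T : ℝ),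
      0 < d → M ≤ D → d ≤ D → 3 ≤ D → (d : ℝ) ≤ T →
      (∀ i, IsSubExpVec (g i) c K μ) → (∀ i, IsSubExpVec (h i) c K μ) →
      (∀ i, IndepFun (g i) (h i) μ) →
      (∀ i, IndepFun (fun ω => (g i ω, h i ω))
        (fun ω (j : {j // j ≠ i}) => (g j ω, h j ω)) μ) →
      (∀ i, b i ⬝ᵥ b i ≤ T) → ∑ i, b i ⬝ᵥ b i ≤ T * d →
      (∀ v : Fin d → ℝ, ∑ i, (b i ⬝ᵥ v) ^ 2 ≤ T * (v ⬝ᵥ v)) →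
      ∃ A : Set Ω, MeasurableSet A ∧ 1 - C * (D : ℝ) ^ (-10 : ℤ) ≤ μ.real A ∧
        ∀ ω ∈ A, ‖∑ i, noiseMatrix (g i ω) (h i ω) (b i)‖ ≤
          C * ((√(d * T) + √(M * d)) * Real.log D ^ 3) := by
  set κ := 2 / c ^ 2 * K with hκ
  have hκ0 : 0 ≤ κ := by positivity
  set C₁ := 224 * (168 * (2 * (14 / c) ^ 2 + (14 / c) ^ 4) + 6 * κ + 3 * κ ^ 2) with hC₁
  have hC₁0 : 0 < C₁ := by positivity
  set C₂ := (2 * K + 3 * (2 * κ + κ ^ 2)) / 2 with hC₂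
  have hC₂0 : 0 ≤ C₂ := by positivity
  -- The three parts pay for the deviation, the truncation bias and the failure probability.
  refine ⟨√(3 * C₁) + C₂ + (2 * K + 2), by positivity, ?_⟩
  intro Ω _ μ _ M d D g h b T hd hMD hdD hD hdT hg hh hgh hind hb hbs hbv
  have hdR : (1 : ℝ) ≤ d := by exact_mod_cast hd
  have hDR : (3 : ℝ) ≤ D := by exact_mod_cast hD
  have hMDR : (M : ℝ) ≤ D := by exact_mod_cast hMD
  have hdDR : (d : ℝ) ≤ D := by exact_mod_cast hdD
  have hD0 : (0 : ℝ) < D := by linarith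
  have hpw : ∀ {a b : ℕ}, a ≤ b → ((D : ℝ) ^ b)⁻¹ ≤ ((D : ℝ) ^ a)⁻¹ := fun hab =>
    inv_anti₀ (by positivity) (pow_le_pow_right₀ (by linarith) hab)
  have hT1 : 1 ≤ T := hdR.trans hdT
  have hT0 : 0 ≤ T := by linarith
  set L := Real.log D with hL
  have hL1 : 1 ≤ L := by
    rw [hL, Real.le_log_iff_exp_le hD0]
    linarith [Real.exp_one_lt_d9]
  -- Then `exp (-c r) = D⁻¹⁴`, which leaves room for the union over coordinates and clients.
  set r := 14 / c * L with hr
  set ρ := d * r ^ 2 with hρ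
  have hr0 : 0 ≤ r := by positivity
  have hρ0 : 0 ≤ ρ := by positivity
  -- An even moment of order at least `12 L`, so that `exp (-p) ≤ D⁻¹²` absorbs the dimension factor
  -- `2d` of the trace.
  set p := 2 * ⌈6 * L⌉₊ with hp
  have hp1 : 12 * L ≤ p := by
    have := Nat.le_ceil (6 * L)
    rw [hp]; push_cast; linarith
  have hp2 : (p : ℝ) ≤ 14 * L := by
    have := (Nat.ceil_lt_add_one (show 0 ≤ 6 * L by linarith)).le
    rw [hp]; push_cast; linarith
  have hp0 : p ≠ 0 := by
    intro h0
    rw [h0] at hp1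
    norm_num at hp1
    linarith
  obtain ⟨iZ, lZ⟩ := integral_trace_dilation_truncNoise_pow_le (ρ := ρ) hT0 hρ0 hc hK hg hh hgh
    hind hb hbs hbv (even_two_mul _) hp0
  set X : Fin M → Ω → Matrix (Fin d) (Fin d) ℝ := fun i ω => truncNoise ρ (b i) (g i ω, h i ω)
    with hX
  set Z : Ω → ℝ := fun ω => (dilation (∑ i, X i ω - ∑ i, meanMatrix (X i) μ) ^ (2 * p)).trace
    with hZ
  set S := √(3 * C₁) * (L ^ 3 * √(d * T + M * d)) with hS
  have hin : 0 < d * T + M * d := by positivity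
  have hS0 : 0 < S := by
    have : 0 < √(d * T + M * d) := Real.sqrt_pos.2 hin
    have : 0 < L := by linarith
    positivity
  have hS2 : S ^ 2 = 3 * (C₁ * (L ^ 6 * (d * T + M * d))) := by
    rw [hS, mul_pow, mul_pow, Real.sq_sqrt (by positivity), Real.sq_sqrt hin.le]
    ring
  have hZ0 : 0 ≤ Z := fun ω => by
    have := Matrix.PosSemidef.one.trace_mul_pow_two_mul_nonneg
      (isHermitian_dilation (∑ i, X i ω - ∑ i, meanMatrix (X i) μ)) p
    simpa using this
  have hZm : MeasurableSet {ω | S ^ (2 * p) < Z ω} := by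
    refine measurableSet_lt measurable_const ?_
    have hb' : IsBddMeas fun ω => dilation (∑ i, X i ω - ∑ i, meanMatrix (X i) μ) := by
      simp only [dilation_sub, dilation_sum]
      exact (IsBddMeas.sum _ fun i _ => isBddMeas_dilation_truncNoise hT0 hρ0 (hb i)
        (hg i).measurable (hh i).measurable).sub (.const _)
    simp only [hZ, Matrix.trace, Matrix.diag_apply]
    exact Finset.measurable_fun_sum _ fun a _ =>
      Matrix.measurable_iff.1 (hb'.pow (2 * p)).measurable a a
  have hF := measureReal_pow_lt_le hZ0 iZ (Q := C₁ * (L ^ 6 * (d * T + M * d))) (S := S)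
    (m := 2 * d) (p := p) hS0 (by positivity) (by positivity) hS2.ge
    (lZ.trans (mul_le_mul_of_nonneg_left (pow_le_pow_left₀ (by positivity)
      (bernstein_parameters_le hc hκ0 hL1 d.cast_nonneg M.cast_nonneg hdT hp2) p)
      (by positivity)))
  set G : Fin M → Set Ω := fun i => {ω | ¬ (g i ω ⬝ᵥ g i ω ≤ ρ ∧ h i ω ⬝ᵥ h i ω ≤ ρ)} with hG
  have hGm : ∀ i, MeasurableSet (G i) := fun i =>
    (((hg i).measurable.prodMk (hh i).measurable) (measurableSet_trunc ρ)).compl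
  have hexp : Real.exp (-(c * r)) = ((D : ℝ) ^ 14)⁻¹ := by
    have : c * r = (14 : ℕ) * L := by rw [hr]; push_cast; field_simp
    rw [this, Real.exp_neg, Real.exp_nat_mul, hL, Real.exp_log hD0]
  have hGp : ∀ i, μ.real (G i) ≤ 2 * K * (d * ((D : ℝ) ^ 14)⁻¹) := by
    intro i
    have hsub : G i ⊆ {ω | ρ < g i ω ⬝ᵥ g i ω} ∪ {ω | ρ < h i ω ⬝ᵥ h i ω} := by
      intro ω hω
      have hω' : ¬ (g i ω ⬝ᵥ g i ω ≤ ρ ∧ h i ω ⬝ᵥ h i ω ≤ ρ) := hω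
      rw [not_and_or, not_le, not_le] at hω'
      exact hω'
    have h1 := (hg i).measureReal_gt_le hc r
    have h2 := (hh i).measureReal_gt_le hc r
    rw [hexp] at h1 h2
    calc _ ≤ _ := measureReal_mono hsub
      _ ≤ _ := measureReal_union_le _ _
      _ ≤ _ := add_le_add h1 h2
      _ = _ := by ring
  -- Take `θ = √T D⁴`. Each entry is then of order `√T D⁻⁴` or smaller, negligible even after the
  -- sum over `M` clients and the factor `d` from entries to operator norm.
  have hbias : ∀ i a a', |meanMatrix (X i) μ a a'| ≤
      √T * (2 * K * (d * ((D : ℝ) ^ 10)⁻¹) + 3 * (2 * κ + κ ^ 2) * ((D : ℝ) ^ 4)⁻¹) / 2 := by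
    intro i a a'
    have hsT : 0 < √T := Real.sqrt_pos.2 (by linarith)
    refine (abs_meanMatrix_truncNoise_le (hb i) (hg i) (hh i) (hgh i) hc hK
      (θ := √T * (D : ℝ) ^ 4) (by positivity) a a').trans ?_
    have e1 : √T * (D : ℝ) ^ 4 * μ.real (G i) ≤ √T * (2 * K * (d * ((D : ℝ) ^ 10)⁻¹)) := by
      calc _ ≤ √T * (D : ℝ) ^ 4 * (2 * K * (d * ((D : ℝ) ^ 14)⁻¹)) := by
            gcongr
            exact hGp i
        _ = _ := by field_simp
    have e2 : 3 * (2 * κ * T + κ ^ 2) / (√T * (D : ℝ) ^ 4) ≤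
        √T * (3 * (2 * κ + κ ^ 2) * ((D : ℝ) ^ 4)⁻¹) := by
      rw [div_le_iff₀ (by positivity)]
      calc _ ≤ 3 * (2 * κ + κ ^ 2) * T := by nlinarith [sq_nonneg κ]
        _ = 3 * (2 * κ + κ ^ 2) * (√T * √T) := by rw [Real.mul_self_sqrt hT0]
        _ = _ := by field_simp
    rw [mul_add (√T)]
    exact div_le_div_of_nonneg_right (add_le_add e1 e2) (by norm_num)
  have hmean : ‖∑ i, meanMatrix (X i) μ‖ ≤ C₂ * √T := by
    refine (l2_opNorm_le_card_mul (e := M * (√T * (2 * K * (d * ((D : ℝ) ^ 10)⁻¹) +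
      3 * (2 * κ + κ ^ 2) * ((D : ℝ) ^ 4)⁻¹) / 2)) (by positivity) fun a a' => ?_).trans ?_
    · rw [Matrix.sum_apply]
      refine (Finset.abs_sum_le_sum_abs _ _).trans ((Finset.sum_le_sum fun i _ =>
        hbias i a a').trans (le_of_eq ?_))
      simp
    · rw [Fintype.card_fin]
      have hD1 : (1 : ℝ) ≤ D := by linarith
      have f1 : (d : ℝ) * M * (d * ((D : ℝ) ^ 10)⁻¹) ≤ 1 := by
        rw [← mul_assoc, ← div_eq_mul_inv, div_le_one (by positivity)]
        calc (d : ℝ) * M * d ≤ D * D * D := by gcongr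
          _ = (D : ℝ) ^ 3 := by ring
          _ ≤ (D : ℝ) ^ 10 := pow_le_pow_right₀ hD1 (by norm_num)
      have f2 : (d : ℝ) * M * ((D : ℝ) ^ 4)⁻¹ ≤ 1 := by
        rw [← div_eq_mul_inv, div_le_one (by positivity)]
        calc (d : ℝ) * M ≤ D * D := by gcongr
          _ = (D : ℝ) ^ 2 := by ring
          _ ≤ (D : ℝ) ^ 4 := pow_le_pow_right₀ hD1 (by norm_num)
      calc _ = √T * (2 * K * (d * M * (d * ((D : ℝ) ^ 10)⁻¹)) +
            3 * (2 * κ + κ ^ 2) * (d * M * ((D : ℝ) ^ 4)⁻¹)) / 2 := by ring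
        _ ≤ √T * (2 * K * 1 + 3 * (2 * κ + κ ^ 2) * 1) / 2 := by gcongr
        _ = _ := by rw [hC₂]; ring
  -- The excluded events are a large centered trace moment and an active truncation for some client.
  -- Outside them the truncated and true noise coincide.
  refine ⟨({ω | S ^ (2 * p) < Z ω} ∪ ⋃ i, G i)ᶜ, (hZm.union (.iUnion hGm)).compl, ?_, ?_⟩
  · rw [probReal_compl_eq_one_sub (hZm.union (.iUnion hGm))]
    have hD1 : (1 : ℝ) ≤ D := by linarith
    have e0 : (D : ℝ) ^ (-10 : ℤ) = ((D : ℝ) ^ 10)⁻¹ := by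
      rw [zpow_neg]; norm_cast
    have e1 : μ.real {ω | S ^ (2 * p) < Z ω} ≤ 2 * ((D : ℝ) ^ 10)⁻¹ := by
      refine hF.trans ?_
      have : Real.exp (-(p : ℝ)) ≤ ((D : ℝ) ^ 12)⁻¹ := by
        calc _ ≤ Real.exp (-((12 : ℕ) * L)) := by
              rw [Real.exp_le_exp]; push_cast; linarith
          _ = _ := by rw [Real.exp_neg, Real.exp_nat_mul, hL, Real.exp_log hD0]
      calc _ ≤ 2 * (D : ℝ) * ((D : ℝ) ^ 12)⁻¹ := by gcongr
        _ = 2 * ((D : ℝ) ^ 11)⁻¹ := by field_simp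
        _ ≤ _ := mul_le_mul_of_nonneg_left (hpw (by norm_num)) zero_le_two
    have e2 : μ.real (⋃ i, G i) ≤ 2 * K * ((D : ℝ) ^ 10)⁻¹ := by
      calc _ ≤ ∑ i, μ.real (G i) := measureReal_iUnion_fintype_le _
        _ ≤ ∑ _i : Fin M, 2 * K * (d * ((D : ℝ) ^ 14)⁻¹) := Finset.sum_le_sum fun i _ => hGp i
        _ = 2 * K * (M * d * ((D : ℝ) ^ 14)⁻¹) := by simp; ring
        _ ≤ 2 * K * (D * D * ((D : ℝ) ^ 14)⁻¹) := by gcongr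
        _ = 2 * K * ((D : ℝ) ^ 12)⁻¹ := by field_simp
        _ ≤ _ := mul_le_mul_of_nonneg_left (hpw (by norm_num)) (by positivity)
    have e3 := measureReal_union_le (μ := μ) {ω | S ^ (2 * p) < Z ω} (⋃ i, G i)
    have e4 : 0 ≤ (√(3 * C₁) + C₂) * ((D : ℝ) ^ 10)⁻¹ := by positivity
    rw [e0]
    linarith
  · intro ω hω
    simp only [Set.mem_compl_iff, Set.mem_union, Set.mem_iUnion, not_or, not_exists] at hω
    obtain ⟨hω1, hω2⟩ := hω
    have hω1' : Z ω ≤ S ^ (2 * p) := not_lt.1 hω1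
    have hXn : ∀ i, X i ω = noiseMatrix (g i ω) (h i ω) (b i) := by
      intro i
      have : g i ω ⬝ᵥ g i ω ≤ ρ ∧ h i ω ⬝ᵥ h i ω ≤ ρ := by
        by_contra hcon
        exact hω2 i hcon
      simp only [hX, truncNoise, this, and_self, if_true]
    have hdev : ‖∑ i, X i ω - ∑ i, meanMatrix (X i) μ‖ ≤ S :=
      Matrix.l2_opNorm_le_of_forall hS0.le
        (l2_opNorm_le_of_trace_dilation_pow_le hS0.le hp0 hω1')
    have htot : ‖∑ i, X i ω‖ ≤ S + C₂ * √T := by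
      calc _ = ‖(∑ i, X i ω - ∑ i, meanMatrix (X i) μ) + ∑ i, meanMatrix (X i) μ‖ := by
            rw [sub_add_cancel]
        _ ≤ _ := (norm_add_le _ _).trans (add_le_add hdev hmean)
    simp only [hXn] at htot
    refine htot.trans ?_
    have hL3 : 1 ≤ L ^ 3 := one_le_pow₀ hL1
    have s1 : √(d * T + M * d) ≤ √(d * T) + √(M * d) :=
      Real.sqrt_add_le_add_sqrt_of_nonneg (by positivity) (by positivity)
    have s2 : √T ≤ √(d * T) := Real.sqrt_le_sqrt (by nlinarith)
    have s3 : 0 ≤ √(M * d : ℝ) := Real.sqrt_nonneg _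
    have s4 : √T ≤ (√(d * T) + √(M * d)) * L ^ 3 := by
      have : 0 ≤ √(d * T) + √(M * d : ℝ) := by positivity
      nlinarith
    have s5 : S ≤ √(3 * C₁) * ((√(d * T) + √(M * d)) * L ^ 3) := by
      rw [hS, mul_comm (L ^ 3)]
      gcongr
    have s6 : 0 ≤ (2 * K + 2) * ((√(d * T) + √(M * d)) * L ^ 3) := by positivity
    have s7 := mul_le_mul_of_nonneg_left s4 hC₂0
    linarith

end NoiseConcentration

/-! ### From single samples to the noise of half samples. -/

section Samples

variable {Ω : Type*} [MeasurableSpace Ω] {μ : Measure Ω} [IsProbabilityMeasure μ] {d : ℕ}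

theorem inner_toLp_eq_dotProduct (u : Fin d → ℝ) (x : EuclideanSpace ℝ (Fin d)) :
    inner ℝ (WithLp.toLp 2 u) x = x.ofLp ⬝ᵥ u := by
  simp [EuclideanSpace.inner_eq_star_dotProduct]

theorem norm_toLp_eq_one {u : Fin d → ℝ} (hu : u ⬝ᵥ u = 1) : ‖WithLp.toLp 2 u‖ = 1 := by
  rw [← sq_eq_sq₀ (norm_nonneg _) zero_le_one, norm_toLp_sq_eq_dotProduct, hu, one_pow]

theorem IsSubG.memLp {X : Ω → ℝ} {v : ℝ≥0} (h : IsSubG X v μ) (p : ℝ≥0) : MemLp X p μ := by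
  have := (HasSubgaussianMGF.memLp h p).add (memLp_const (∫ ω', X ω' ∂μ))
  simpa [Pi.add_def] using this

theorem IsCondCenteredSubG.hasSubgaussianMGF {W : Ω → ℝ} {x : Ω → EuclideanSpace ℝ (Fin d)}
    {v : ℝ≥0} (h : IsCondCenteredSubG W x v μ) (hx : Measurable x) :
    HasSubgaussianMGF W v μ := by
  refine ⟨h.integrable_exp, fun t => ?_⟩
  have hm : MeasurableSpace.comap x inferInstance ≤ ‹MeasurableSpace Ω› := hx.comap_le
  rw [mgf, ← integral_condExp hm]
  refine (integral_mono_ae integrable_condExp (integrable_const _) (h.condMGF_le t)).trans ?_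
  simp

/-- Pull `f (x)` out of the conditional expectation given `x`. The label noise thus does not
contribute to the mean of `y x`, although it may depend on `x`. -/
theorem IsCondCenteredSubG.integral_mul_eq_zero {W : Ω → ℝ} {x : Ω → EuclideanSpace ℝ (Fin d)}
    {v : ℝ≥0} (h : IsCondCenteredSubG W x v μ) (hx : Measurable x)
    {f : EuclideanSpace ℝ (Fin d) → ℝ} (hf : Measurable f)
    (hint : Integrable (fun ω => W ω * f (x ω)) μ) : ∫ ω, W ω * f (x ω) ∂μ = 0 := by
  have hm : MeasurableSpace.comap x inferInstance ≤ ‹MeasurableSpace Ω› := hx.comap_le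
  have hW : Integrable W μ := (h.hasSubgaussianMGF hx).integrable
  have hmeas : StronglyMeasurable[MeasurableSpace.comap x inferInstance] fun ω => f (x ω) :=
    (hf.comp (comap_measurable x)).stronglyMeasurable
  have h1 := condExp_mul_of_stronglyMeasurable_right (μ := μ) hmeas hint hW
  rw [← integral_condExp hm]
  have h2 : μ[fun ω => W ω * f (x ω) | MeasurableSpace.comap x inferInstance] =ᵐ[μ] 0 := by
    refine h1.trans ?_
    filter_upwards [h.condMean_eq_zero] with ω hω
    simp [hω]
  rw [integral_congr_ae h2]
  simp

omit [IsProbabilityMeasure μ] in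
theorem integrable_euclidean_of_apply {f : Ω → EuclideanSpace ℝ (Fin d)}
    (h : ∀ a, Integrable (fun ω => f ω a) μ) : Integrable f μ := by
  have e : f = fun ω => ∑ a, f ω a • EuclideanSpace.basisFun (Fin d) ℝ a := by
    ext1 ω
    exact ((EuclideanSpace.basisFun (Fin d) ℝ).sum_repr (f ω)).symm
  rw [e]
  exact integrable_finsetSum _ fun a _ => (h a).smul_const _

omit [IsProbabilityMeasure μ] in
theorem integral_dotProduct_eq {f : Ω → EuclideanSpace ℝ (Fin d)}
    (h : ∀ a, Integrable (fun ω => f ω a) μ) (u : Fin d → ℝ) :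
    ∫ ω, (f ω).ofLp ⬝ᵥ u ∂μ = (∫ ω, f ω ∂μ).ofLp ⬝ᵥ u := by
  simp only [← inner_toLp_eq_dotProduct]
  exact integral_inner (integrable_euclidean_of_apply h) _

theorem exp_add_add_le (p q r : ℝ) :
    Real.exp (p + q + r) ≤ Real.exp (3 * p) + Real.exp (3 * q) + Real.exp (3 * r) := by
  have hp := Real.exp_pos (3 * p)
  have hq := Real.exp_pos (3 * q)
  have hr := Real.exp_pos (3 * r)
  rcases le_total p q with h1 | h1 <;> rcases le_total q r with h2 | h2 <;>
    rcases le_total p r with h3 | h3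
  all_goals first
    | (have : Real.exp (p + q + r) ≤ Real.exp (3 * p) := Real.exp_le_exp.2 (by linarith)
       linarith)
    | (have : Real.exp (p + q + r) ≤ Real.exp (3 * q) := Real.exp_le_exp.2 (by linarith)
       linarith)
    | (have : Real.exp (p + q + r) ≤ Real.exp (3 * r) := Real.exp_le_exp.2 (by linarith)
       linarith)

/-- A product of shifted variables is exponentially dominated by the squares of the
centered variables. -/
theorem exp_mul_abs_add_mul_sub_le {e f b m m' a c : ℝ} (he : |e| ≤ m) (hf : |f| ≤ m')
    (hb : |b| ≤ a) (hc0 : 0 ≤ c) (hc1 : c ≤ 1) (z w s : ℝ) :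
    Real.exp (c * |(z + w) * s - b|) ≤
      Real.exp (2 * m ^ 2 + m' ^ 2 + a) * (Real.exp (3 * (c * 2) * (z - e) ^ 2) +
        Real.exp (3 * c * w ^ 2) + Real.exp (3 * c * (s - f) ^ 2)) := by
  have q1 : z ^ 2 ≤ 2 * (z - e) ^ 2 + 2 * m ^ 2 := by
    have : e ^ 2 ≤ m ^ 2 := sq_le_sq' (by linarith [neg_abs_le e]) ((le_abs_self _).trans he)
    nlinarith [sq_nonneg (z - 2 * e)]
  have q2 : s ^ 2 ≤ 2 * (s - f) ^ 2 + 2 * m' ^ 2 := by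
    have : f ^ 2 ≤ m' ^ 2 := sq_le_sq' (by linarith [neg_abs_le f]) ((le_abs_self _).trans hf)
    nlinarith [sq_nonneg (s - 2 * f)]
  -- From `|(z + w) s| ≤ ((z + w)² + s²) / 2` and `(z + w)² ≤ 2 z² + 2 w²`.
  have q3 : |(z + w) * s - b| ≤ z ^ 2 + w ^ 2 + s ^ 2 / 2 + a := by
    refine (abs_sub _ _).trans (add_le_add ?_ hb)
    rw [abs_le]
    constructor <;> nlinarith [sq_nonneg (z + w + s), sq_nonneg (z + w - s), sq_nonneg (z - w)]
  have hA : 0 ≤ 2 * m ^ 2 + m' ^ 2 + a := by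
    have := (abs_nonneg _).trans hb
    positivity
  have q4 : c * |(z + w) * s - b| ≤ (2 * m ^ 2 + m' ^ 2 + a) +
      (c * 2 * (z - e) ^ 2 + c * w ^ 2 + c * (s - f) ^ 2) := by
    have := mul_le_mul_of_nonneg_right hc1 hA
    have := mul_le_mul_of_nonneg_left (q3.trans (b := _) (c := 2 * (z - e) ^ 2 + w ^ 2 +
      (s - f) ^ 2 + (2 * m ^ 2 + m' ^ 2 + a)) (by linarith)) hc0
    linarith
  refine (Real.exp_le_exp.2 q4).trans ?_
  rw [Real.exp_add]
  refine mul_le_mul_of_nonneg_left ?_ (Real.exp_pos _).le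
  refine (exp_add_add_le _ _ _).trans (le_of_eq ?_)
  simp only [mul_assoc]

set_option maxHeartbeats 800000 in
/-- One sample: the marginals of `y x - B α` are centered and sub-exponential. -/
theorem isSubExp_sample {x : Ω → EuclideanSpace ℝ (Fin d)} {ζ ξ : Ω → ℝ} {vx vζ vξ : ℝ≥0}
    {mx mζ a V : ℝ} {β : Fin d → ℝ} (hxm : Measurable x) (hζm : Measurable ζ) (hξm : Measurable ξ)
    (hx : IsSubGVec x vx μ) (hmx : ‖∫ ω, x ω ∂μ‖ ≤ mx) (hζ : IsSubG ζ vζ μ)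
    (hmζ : |∫ ω, ζ ω ∂μ| ≤ mζ) (hcross : ∫ ω, ζ ω • x ω ∂μ = WithLp.toLp 2 β)
    (hξ : IsCondCenteredSubG ξ x vξ μ) (hβ : ‖WithLp.toLp 2 β‖ ≤ a) (hV : 1 ≤ V) (hxV : vx ≤ V)
    (hζV : vζ ≤ V) (hξV : vξ ≤ V) (u : Fin d → ℝ) (hu : u ⬝ᵥ u = 1) :
    IsSubExp (fun ω => (ζ ω + ξ ω) * ((x ω).ofLp ⬝ᵥ u) - β ⬝ᵥ u) (1 / (24 * V))
        (6 * Real.exp (2 * mζ ^ 2 + mx ^ 2 + a)) μ ∧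
      ∫ ω, (ζ ω + ξ ω) * ((x ω).ofLp ⬝ᵥ u) - β ⬝ᵥ u ∂μ = 0 := by
  have hsub : ∀ w : Fin d → ℝ, w ⬝ᵥ w = 1 → IsSubG (fun ω => (x ω).ofLp ⬝ᵥ w) vx μ := by
    intro w hw
    have := hx (WithLp.toLp 2 w) (norm_toLp_eq_one hw)
    simpa only [inner_toLp_eq_dotProduct] using this
  have hxa : ∀ b, MemLp (fun ω => x ω b) 2 μ := by
    intro b
    have := (hsub (Pi.single b 1) (by simp)).memLp 2
    simpa using this
  have hζ2 : MemLp ζ 2 μ := by simpa using hζ.memLp 2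
  have hξs := hξ.hasSubgaussianMGF hxm
  have hξ2 : MemLp ξ 2 μ := by simpa using hξs.memLp 2
  have hux2 : MemLp (fun ω => (x ω).ofLp ⬝ᵥ u) 2 μ := by simpa using (hsub u hu).memLp 2
  have huxm : Measurable fun ω => (x ω).ofLp ⬝ᵥ u := by
    simp only [dotProduct]
    fun_prop
  have iζ : Integrable (fun ω => ζ ω * ((x ω).ofLp ⬝ᵥ u)) μ := hζ2.integrable_mul hux2
  have iξ : Integrable (fun ω => ξ ω * ((x ω).ofLp ⬝ᵥ u)) μ := hξ2.integrable_mul hux2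
  have mζu : ∫ ω, ζ ω * ((x ω).ofLp ⬝ᵥ u) ∂μ = β ⬝ᵥ u := by
    have h1 := integral_dotProduct_eq (f := fun ω => ζ ω • x ω) (μ := μ)
      (fun b => hζ2.integrable_mul (hxa b)) u
    rw [hcross] at h1
    rw [← h1]
    simp [smul_dotProduct]
  have mξu : ∫ ω, ξ ω * ((x ω).ofLp ⬝ᵥ u) ∂μ = 0 :=
    hξ.integral_mul_eq_zero hxm (f := fun z => z.ofLp ⬝ᵥ u)
      (by simp only [dotProduct]; fun_prop) iξ
  have habs : ∀ w : EuclideanSpace ℝ (Fin d), |w.ofLp ⬝ᵥ u| ≤ ‖w‖ := by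
    intro w
    rw [← inner_toLp_eq_dotProduct]
    refine (abs_real_inner_le_norm _ _).trans ?_
    rw [norm_toLp_eq_one hu, one_mul]
  refine ⟨?_, ?_⟩
  · set eζ := ∫ ω, ζ ω ∂μ
    set ex := ∫ ω, (x ω).ofLp ⬝ᵥ u ∂μ with hex
    have hex' : |ex| ≤ mx := by
      rw [hex, integral_dotProduct_eq fun b => (hxa b).integrable one_le_two]
      exact (habs _).trans hmx
    -- The largest coefficient in front of a centered square is `6c`, and `6 c V = 1/4` is the limit
    -- allowed by `HasSubgaussianMGF.integral_exp_sq_le`. Three exponential moments of at most 2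
    -- give the factor 6.
    set c := 1 / (24 * V) with hc
    have hc0 : 0 < c := by positivity
    have hc1 : c ≤ 1 := by
      rw [hc, div_le_one (by positivity)]; linarith
    have hVc : V * c = 1 / 24 := by rw [hc]; field_simp
    obtain ⟨i1, l1⟩ := HasSubgaussianMGF.integral_exp_sq_le hζ (hζm.sub_const _)
      (c := 3 * (c * 2)) (by positivity) (by nlinarith)
    obtain ⟨i2, l2⟩ := hξs.integral_exp_sq_le hξm (c := 3 * c) (by positivity) (by nlinarith)
    obtain ⟨i3, l3⟩ := HasSubgaussianMGF.integral_exp_sq_le (hsub u hu) (huxm.sub_const _)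
      (c := 3 * c) (by positivity) (by nlinarith)
    have hβu : |β ⬝ᵥ u| ≤ a := (habs (WithLp.toLp 2 β)).trans hβ
    have hbound : ∀ ω, Real.exp (c * |(ζ ω + ξ ω) * ((x ω).ofLp ⬝ᵥ u) - β ⬝ᵥ u|) ≤
        Real.exp (2 * mζ ^ 2 + mx ^ 2 + a) * (Real.exp (3 * (c * 2) * (ζ ω - eζ) ^ 2) +
          Real.exp (3 * c * ξ ω ^ 2) + Real.exp (3 * c * ((x ω).ofLp ⬝ᵥ u - ex) ^ 2)) :=
      fun ω => exp_mul_abs_add_mul_sub_le hmζ hex' hβu hc0.le hc1 _ _ _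
    have hmeas : Measurable fun ω => (ζ ω + ξ ω) * ((x ω).ofLp ⬝ᵥ u) - β ⬝ᵥ u :=
      ((hζm.add hξm).mul huxm).sub_const _
    have ib := ((i1.add i2).add i3).const_mul (Real.exp (2 * mζ ^ 2 + mx ^ 2 + a))
    have hint : Integrable
        (fun ω => Real.exp (c * |(ζ ω + ξ ω) * ((x ω).ofLp ⬝ᵥ u) - β ⬝ᵥ u|)) μ :=
      ib.mono' ((continuous_abs.measurable.comp hmeas).const_mul c).exp.aestronglyMeasurable
        (.of_forall fun ω => by
          rw [Real.norm_of_nonneg (Real.exp_pos _).le]; exact hbound ω)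
    refine ⟨hmeas, hint, (integral_mono hint ib hbound).trans ?_⟩
    simp only [Pi.add_apply]
    rw [integral_const_mul, integral_add (by exact i1.add i2) i3, integral_add i1 i2, mul_comm 6]
    refine mul_le_mul_of_nonneg_left ?_ (Real.exp_pos _).le
    linarith
  · simp only [add_mul]
    rw [integral_sub (by exact iζ.add iξ) (integrable_const _), integral_add iζ iξ, mζu, mξu]
    simp

/-- The normalized noise `√n ((2 / n) ∑_{j ∈ s} (ζⱼ + ξⱼ) xⱼ - β)` of a half sample. -/
noncomputable def halfNoise {n : ℕ} (s : Finset (Fin n)) (β : Fin d → ℝ)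
    (t : Fin n → EuclideanSpace ℝ (Fin d) × ℝ × ℝ) : Fin d → ℝ :=
  √(n : ℝ) • (((2 / (n : ℝ)) • ∑ j ∈ s, ((t j).2.1 + (t j).2.2) • (t j).1).ofLp - β)

theorem measurable_halfNoise {n : ℕ} (s : Finset (Fin n)) (β : Fin d → ℝ) :
    Measurable (halfNoise s β) := by
  refine measurable_pi_lambda _ fun a => ?_
  simp only [halfNoise, Pi.smul_apply, Pi.sub_apply, PiLp.smul_apply, WithLp.ofLp_sum,
    Finset.sum_apply]
  fun_prop

/-- A half contains `n / 2` samples, so the subtracted `β` distributes as one copy per sample and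
`√n · (2 / n) = 2 / √n`. -/
theorem halfNoise_dotProduct {n : ℕ} {s : Finset (Fin n)} (hs : 2 * s.card = n) (hn : 0 < n)
    (β : Fin d → ℝ) (t : Fin n → EuclideanSpace ℝ (Fin d) × ℝ × ℝ) (u : Fin d → ℝ) :
    halfNoise s β t ⬝ᵥ u = 2 * ((√(n : ℝ))⁻¹ *
      ∑ j ∈ s, (((t j).2.1 + (t j).2.2) * ((t j).1.ofLp ⬝ᵥ u) - β ⬝ᵥ u)) := by
  have hn' : (0 : ℝ) < n := by exact_mod_cast hn
  have hs' : (2 : ℝ) * s.card = n := by exact_mod_cast hs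
  have hsq : √(n : ℝ) * √(n : ℝ) = n := Real.mul_self_sqrt hn'.le
  have hsq0 : 0 < √(n : ℝ) := Real.sqrt_pos.2 hn'
  rw [halfNoise, smul_dotProduct, sub_dotProduct, Finset.sum_sub_distrib, Finset.sum_const,
    WithLp.ofLp_smul, smul_dotProduct, WithLp.ofLp_sum, sum_dotProduct]
  simp only [WithLp.ofLp_smul, smul_dotProduct, smul_eq_mul, nsmul_eq_mul]
  generalize ∑ j ∈ s, ((t j).2.1 + (t j).2.2) * ((t j).1.ofLp ⬝ᵥ u) = Y
  have hc : (s.card : ℝ) = n / 2 := by linarith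
  rw [hc]
  field_simp
  rw [pow_two, hsq]

/-- The noise of a half sample is centered and sub-exponential in every direction. -/
theorem isSubExpVec_halfNoise {n : ℕ} {s : Finset (Fin n)} (hs : 2 * s.card = n) (hn : 0 < n)
    {β : Fin d → ℝ} {t : Fin n → Ω → EuclideanSpace ℝ (Fin d) × ℝ × ℝ} {c K : ℝ} (hc : 0 < c)
    (hK : 0 ≤ K) (hind : iIndepFun t μ)
    (h : ∀ j, ∀ u : Fin d → ℝ, u ⬝ᵥ u = 1 →
      IsSubExp (fun ω => ((t j ω).2.1 + (t j ω).2.2) * ((t j ω).1.ofLp ⬝ᵥ u) - β ⬝ᵥ u) c K μ ∧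
      ∫ ω, ((t j ω).2.1 + (t j ω).2.2) * ((t j ω).1.ofLp ⬝ᵥ u) - β ⬝ᵥ u ∂μ = 0) :
    IsSubExpVec (fun ω => halfNoise s β fun j => t j ω) (c / 4) (2 * Real.exp (2 * K)) μ := by
  refine ⟨fun u hu => ?_, fun u hu => ?_⟩
  · simp only [halfNoise_dotProduct hs hn]
    have hind' := hind.comp (fun _ (p : EuclideanSpace ℝ (Fin d) × ℝ × ℝ) =>
      (p.2.1 + p.2.2) * (p.1.ofLp ⬝ᵥ u) - β ⬝ᵥ u)
      (fun _ => by simp only [dotProduct]; fun_prop)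
    -- The rate is halved by the sum and halved again by the factor 2, hence `c / 4`.
    have h1 := IsSubExp.sum_div_sqrt (fun j => (h j u hu).1) hc (fun j => (h j u hu).2) hind' s hn
      (by omega) hK
    refine ⟨h1.measurable.const_mul 2, ?_, ?_⟩
    · convert h1.integrable using 3 with ω
      rw [abs_mul, abs_two]; ring
    · convert h1.le using 4 with ω
      rw [abs_mul, abs_two]; ring
  · simp only [halfNoise_dotProduct hs hn]
    rw [integral_const_mul, integral_const_mul, integral_finsetSum _ fun j _ =>
      ((h j u hu).1.memLp_two hc).integrable one_le_two,
      Finset.sum_eq_zero fun j _ => (h j u hu).2]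
    simp

omit [IsProbabilityMeasure μ] in
/-- Functions of disjoint blocks of an independent family are independent. -/
theorem ProbabilityTheory.iIndepFun.indepFun_of_disjoint_support {ι E F F' : Type*} [MeasurableSpace E] [Inhabited E]
    [MeasurableSpace F] [MeasurableSpace F'] {t : ι → Ω → E} (hind : iIndepFun t μ)
    (ht : ∀ p, Measurable (t p)) {S S' : Finset ι} (hS : Disjoint S S') {φ : (ι → E) → F}
    {ψ : (ι → E) → F'} (hφ : Measurable φ) (hψ : Measurable ψ)
    (hφS : ∀ f f' : ι → E, (∀ p ∈ S, f p = f' p) → φ f = φ f')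
    (hψS : ∀ f f' : ι → E, (∀ p ∈ S', f p = f' p) → ψ f = ψ f') :
    IndepFun (fun ω => φ fun p => t p ω) (fun ω => ψ fun p => t p ω) μ := by
  classical
  -- Restrict to the block and refill outside it with a default value, which the statistic does not
  -- see.
  let ext (R : Finset ι) (f : R → E) (p : ι) : E := if h : p ∈ R then f ⟨p, h⟩ else default
  have hext : ∀ R : Finset ι, Measurable (ext R) := by
    intro R
    refine measurable_pi_lambda _ fun p => ?_
    by_cases h : p ∈ R
    · simpa [ext, h] using measurable_pi_apply _
    · simp [ext, h]
  have h1 := (hind.indepFun_finset S S' hS ht).comp (hφ.comp (hext S)) (hψ.comp (hext S'))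
  convert h1 using 1
  · ext1 ω
    exact hφS _ _ fun p hp => by simp [ext, hp]
  · ext1 ω
    exact hψS _ _ fun p hp => by simp [ext, hp]

end Samples

/-! ### Splitting the samples, and the decomposition into signal and noise. -/

theorem halfNoise_congr {d n : ℕ} (s : Finset (Fin n)) (β : Fin d → ℝ)
    {t t' : Fin n → EuclideanSpace ℝ (Fin d) × ℝ × ℝ} (h : ∀ j ∈ s, t j = t' j) :
    halfNoise s β t = halfNoise s β t' := by
  rw [halfNoise, halfNoise, Finset.sum_congr rfl fun j hj => by rw [h j hj]]

/-- The indices of the first half of the samples. -/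
def firstHalf (n : ℕ) : Finset (Fin n) := {j | j.val < n / 2}

/-- The indices of the second half of the samples. -/
def secondHalf (n : ℕ) : Finset (Fin n) := {j | n / 2 ≤ j.val}

theorem two_mul_card_firstHalf {n : ℕ} (h : Even n) : 2 * (firstHalf n).card = n := by
  rw [firstHalf, Fin.card_filter_val_lt]
  obtain ⟨m, rfl⟩ := h
  omega

theorem disjoint_firstHalf_secondHalf (n : ℕ) : Disjoint (firstHalf n) (secondHalf n) := by
  simp only [firstHalf, secondHalf, Finset.disjoint_filter]
  intros
  omega

theorem two_mul_card_secondHalf {n : ℕ} (h : Even n) : 2 * (secondHalf n).card = n := by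
  have h1 := two_mul_card_firstHalf h
  have h2 : (firstHalf n).card + (secondHalf n).card = n := by
    rw [← Finset.card_union_of_disjoint (disjoint_firstHalf_secondHalf n)]
    have : firstHalf n ∪ secondHalf n = Finset.univ := by
      ext j
      simp only [firstHalf, secondHalf, Finset.mem_union, Finset.mem_filter, Finset.mem_univ,
        true_and, iff_true]
      omega
    simp [this]
  omega

theorem smul_mul_diversityMatrix_mul_transpose {M d k : ℕ} {n : Fin M → ℕ}
    (hN : 0 < totalSamples n) (α : Fin M → EuclideanSpace ℝ (Fin k))
    (B : Matrix (Fin d) (Fin k) ℝ) :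
    (totalSamples n : ℝ) • (B * diversityMatrix n α * Bᵀ) =
      ∑ i, (n i : ℝ) • Matrix.vecMulVec (B *ᵥ (α i).ofLp) (B *ᵥ (α i).ofLp) := by
  have hN' : (totalSamples n : ℝ) ≠ 0 := by exact_mod_cast hN.ne'
  rw [diversityMatrix, Matrix.mul_smul, Matrix.smul_mul, smul_smul, mul_inv_cancel₀ hN', one_smul,
    Matrix.mul_sum, Matrix.sum_mul]
  refine Finset.sum_congr rfl fun i _ => ?_
  rw [Matrix.mul_smul, Matrix.smul_mul, Matrix.mul_vecMulVec, Matrix.vecMulVec_mul,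
    Matrix.vecMul_transpose]

/-- The two-replica matrix is its mean plus a sum of independent noise matrices. -/
theorem replicaMatrix_sub_eq_sum_noiseMatrix {M d k : ℕ} {n : Fin M → ℕ}
    (hN : 0 < totalSamples n) (α : Fin M → EuclideanSpace ℝ (Fin k))
    (B : Matrix (Fin d) (Fin k) ℝ)
    (t : (i : Fin M) → Fin (n i) → EuclideanSpace ℝ (Fin d) × ℝ × ℝ) :
    replicaMatrix n (fun i j => (t i j).2.1 + (t i j).2.2) (fun i j => (t i j).1) -
        (totalSamples n : ℝ) • (B * diversityMatrix n α * Bᵀ) =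
      ∑ i, noiseMatrix (halfNoise (firstHalf (n i)) (B *ᵥ (α i).ofLp) (t i))
        (halfNoise (secondHalf (n i)) (B *ᵥ (α i).ofLp) (t i))
        (√(n i : ℝ) • (B *ᵥ (α i).ofLp)) := by
  rw [smul_mul_diversityMatrix_mul_transpose hN, replicaMatrix, ← Finset.sum_sub_distrib]
  refine Finset.sum_congr rfl fun i _ => ?_
  have e1 : halfNoise (firstHalf (n i)) (B *ᵥ (α i).ofLp) (t i) = √(n i : ℝ) •
      ((firstHalfAverage (fun j => (t i j).2.1 + (t i j).2.2) fun j => (t i j).1).ofLp -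
        B *ᵥ (α i).ofLp) := rfl
  have e2 : halfNoise (secondHalf (n i)) (B *ᵥ (α i).ofLp) (t i) = √(n i : ℝ) •
      ((secondHalfAverage (fun j => (t i j).2.1 + (t i j).2.2) fun j => (t i j).1).ofLp -
        B *ᵥ (α i).ofLp) := rfl
  rw [e1, e2]
  generalize (firstHalfAverage (fun j => (t i j).2.1 + (t i j).2.2) fun j => (t i j).1).ofLp = p
  generalize (secondHalfAverage (fun j => (t i j).2.1 + (t i j).2.2) fun j => (t i j).1).ofLp = q
  have hs : √(n i : ℝ) * √(n i : ℝ) = n i := Real.mul_self_sqrt (Nat.cast_nonneg _)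
  ext r s
  simp only [noiseMatrix, Matrix.sub_apply, Matrix.add_apply, Matrix.smul_apply,
    Matrix.vecMulVec_apply, Pi.smul_apply, Pi.sub_apply, smul_eq_mul]
  generalize √(n i : ℝ) = w at hs
  rw [← hs]
  ring

theorem mulVec_dotProduct_mulVec_of_transpose_mul_self {d k : ℕ} {B : Matrix (Fin d) (Fin k) ℝ}
    (hB : Bᵀ * B = 1) (v : Fin k → ℝ) : (B *ᵥ v) ⬝ᵥ (B *ᵥ v) = v ⬝ᵥ v := by
  rw [← norm_toLp_sq_eq_dotProduct, norm_toLp_mulVec_of_transpose_mul_self hB,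
    norm_toLp_sq_eq_dotProduct]

theorem transpose_mulVec_dotProduct_le {d k : ℕ} {B : Matrix (Fin d) (Fin k) ℝ}
    (hB : Bᵀ * B = 1) (v : Fin d → ℝ) : (Bᵀ *ᵥ v) ⬝ᵥ (Bᵀ *ᵥ v) ≤ v ⬝ᵥ v := by
  rw [← mulVec_dotProduct_mulVec_of_transpose_mul_self hB, Matrix.mulVec_mulVec,
    ← norm_toLp_sq_eq_dotProduct, ← norm_toLp_sq_eq_dotProduct]
  have := Matrix.norm_toLp_mulVec_le (l2_opNorm_projection_le hB) v
  rw [one_mul] at this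
  gcongr

theorem le_of_transpose_mul_self {d k : ℕ} {B : Matrix (Fin d) (Fin k) ℝ} (hB : Bᵀ * B = 1) :
    k ≤ d := by
  by_contra! h
  obtain ⟨v, hv, hBv⟩ := Matrix.exists_ne_zero_mulVec_eq_zero h B
  apply hv
  rw [← Matrix.one_mulVec v, ← hB, ← Matrix.mulVec_mulVec, hBv, Matrix.mulVec_zero]

section Weights

variable {M d k : ℕ} {n : Fin M → ℕ} {α : Fin M → EuclideanSpace ℝ (Fin k)}
  {B : Matrix (Fin d) (Fin k) ℝ}

theorem signal_dotProduct_self (hB : Bᵀ * B = 1) (i : Fin M) :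
    (√(n i : ℝ) • (B *ᵥ (α i).ofLp)) ⬝ᵥ (√(n i : ℝ) • (B *ᵥ (α i).ofLp)) =
      n i * ‖α i‖ ^ 2 := by
  rw [smul_dotProduct, dotProduct_smul, mulVec_dotProduct_mulVec_of_transpose_mul_self hB,
    ← norm_toLp_sq_eq_dotProduct, smul_smul, smul_eq_mul, Real.mul_self_sqrt (Nat.cast_nonneg _)]

theorem signal_dotProduct_sq (i : Fin M) (v : Fin d → ℝ) :
    ((√(n i : ℝ) • (B *ᵥ (α i).ofLp)) ⬝ᵥ v) ^ 2 =
      n i * ((α i).ofLp ⬝ᵥ (Bᵀ *ᵥ v)) ^ 2 := by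
  rw [smul_dotProduct, smul_eq_mul, mul_pow, Real.sq_sqrt (Nat.cast_nonneg _),
    Matrix.mulVec_transpose, dotProduct_comm, Matrix.dotProduct_mulVec, dotProduct_comm]

end Weights

/-- With no samples the convention `0⁻¹ = 0` makes the diversity matrix zero, so all its eigenvalues
vanish. -/
theorem totalSamples_pos_of_eigenvalue_pos {M k : ℕ} {n : Fin M → ℕ}
    {α : Fin M → EuclideanSpace ℝ (Fin k)} {r : Fin k} (h : 0 < diversityEigenvalue n α r) :
    0 < totalSamples n := by
  by_contra! h0
  have hD : diversityMatrix n α = 0 := by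
    rw [diversityMatrix, Nat.le_zero.1 h0]
    simp
  have h1 : (diversityMatrix_isHermitian n α).eigenvalues = 0 :=
    (Matrix.IsHermitian.eigenvalues_eq_zero_iff _).2 hD
  have h2 := congrFun h1 (Fintype.equivOfCardEq (Fintype.card_fin _)
    (Fin.cast (Fintype.card_fin k).symm r))
  simp only [Matrix.IsHermitian.eigenvalues, Equiv.symm_apply_apply] at h2
  exact h.ne' h2

/-! ### Independence within a client and across clients. -/

section Independence

variable {Ω E F F' : Type*} [MeasurableSpace Ω] {μ : Measure Ω} [MeasurableSpace E] [Inhabited E]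
  [MeasurableSpace F] [MeasurableSpace F'] {M : ℕ} {n : Fin M → ℕ}
  {t : (i : Fin M) → Fin (n i) → Ω → E}

/-- Statistics of disjoint sets of samples of one client are independent. -/
theorem indepFun_within_block (hind : iIndepFun (fun p : (i : Fin M) × Fin (n i) => t p.1 p.2) μ)
    (ht : ∀ i j, Measurable (t i j)) (i : Fin M) {S S' : Finset (Fin (n i))} (hS : Disjoint S S')
    {φ : (Fin (n i) → E) → F} {ψ : (Fin (n i) → E) → F'} (hφ : Measurable φ) (hψ : Measurable ψ)
    (hφS : ∀ f f' : Fin (n i) → E, (∀ p ∈ S, f p = f' p) → φ f = φ f')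
    (hψS : ∀ f f' : Fin (n i) → E, (∀ p ∈ S', f p = f' p) → ψ f = ψ f') :
    IndepFun (fun ω => φ fun j => t i j ω) (fun ω => ψ fun j => t i j ω) μ :=
  (hind.precomp (sigma_mk_injective (i := i))).indepFun_of_disjoint_support (ht i) hS hφ hψ hφS hψS

/-- A statistic of one client is independent of the statistics of all the other clients. -/
theorem indepFun_block_others (hind : iIndepFun (fun p : (i : Fin M) × Fin (n i) => t p.1 p.2) μ)
    (ht : ∀ i j, Measurable (t i j)) {φ : (i : Fin M) → (Fin (n i) → E) → F}
    (hφ : ∀ i, Measurable (φ i)) (i : Fin M) :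
    IndepFun (fun ω => φ i fun j => t i j ω)
      (fun ω (l : {l // l ≠ i}) => φ l fun j => t l j ω) μ := by
  refine hind.indepFun_of_disjoint_support (fun p => ht p.1 p.2)
    (S := {p | p.1 = i}) (S' := {p | p.1 ≠ i}) (Finset.disjoint_filter_filter_not _ _ _)
    (φ := fun f => φ i fun j => f ⟨i, j⟩)
    (ψ := fun f (l : {l // l ≠ i}) => φ l fun j => f ⟨l, j⟩) ?_ ?_ ?_ ?_
  · exact (hφ i).comp (measurable_pi_lambda _ fun j => measurable_pi_apply _)
  · exact measurable_pi_lambda _ fun l =>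
      (hφ l).comp (measurable_pi_lambda _ fun j => measurable_pi_apply _)
  · intro f f' h
    have : (fun j => f ⟨i, j⟩) = fun j => f' ⟨i, j⟩ := funext fun j => h ⟨i, j⟩ (by simp)
    simp only [this]
  · intro f f' h
    ext1 l
    have : (fun j => f ⟨l, j⟩) = fun j => f' ⟨l, j⟩ :=
      funext fun j => h ⟨l, j⟩ (by simp [l.2])
    simp only [this]

end Independence

/-! ### Concentration of the two-replica matrix and the main theorem. -/

theorem card_le_totalSamples {M : ℕ} {n : Fin M → ℕ} (hn : ∀ i, 0 < n i) :
    M ≤ totalSamples n := by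
  calc M = ∑ _i : Fin M, 1 := by simp
    _ ≤ _ := Finset.sum_le_sum fun i _ => hn i

open scoped Matrix.Norms.L2Operator in
/-- Concentration of the two-replica matrix around its mean, when the dimension is at most
`N λ₁`. -/
theorem exists_replicaMatrix_concentration (vx vζ vξ : ℝ≥0) (mx mζ a : ℝ) :
    ∃ C : ℝ, 0 < C ∧
      ∀ (Ω : Type*) [MeasurableSpace Ω] (μ : Measure Ω) [IsProbabilityMeasure μ]
        (M d k : ℕ) (hk : 0 < k) (n : Fin M → ℕ)
        (x : (i : Fin M) → Fin (n i) → Ω → EuclideanSpace ℝ (Fin d))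
        (ζ ξ : (i : Fin M) → Fin (n i) → Ω → ℝ)
        (B : Matrix (Fin d) (Fin k) ℝ) (α : Fin M → EuclideanSpace ℝ (Fin k)),
        (∀ i, 2 ≤ n i ∧ Even (n i)) →
        Bᵀ * B = 1 →
        (∀ i, ‖α i‖ ≤ a) →
        (∀ i j, Measurable (x i j) ∧ Measurable (ζ i j) ∧ Measurable (ξ i j)) →
        iIndepFun (fun (p : (i : Fin M) × Fin (n i)) (ω : Ω) =>
          (x p.1 p.2 ω, ζ p.1 p.2 ω, ξ p.1 p.2 ω)) μ →
        (∀ i j, IsSubGVec (x i j) vx μ ∧ ‖∫ ω, x i j ω ∂μ‖ ≤ mx) →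
        (∀ i j, IsSubG (ζ i j) (vζ * ‖α i‖₊ ^ 2) μ ∧ |∫ ω, ζ i j ω ∂μ| ≤ mζ) →
        (∀ i j, ∫ ω, ζ i j ω • x i j ω ∂μ = WithLp.toLp 2 (B *ᵥ (α i).ofLp)) →
        (∀ i j, IsCondCenteredSubG (ξ i j) (x i j) vξ μ) →
        3 ≤ d + totalSamples n → 0 < totalSamples n →
        0 ≤ diversityEigenvalue n α ⟨0, hk⟩ →
        (d : ℝ) ≤ totalSamples n * diversityEigenvalue n α ⟨0, hk⟩ →
        ∃ A : Set Ω, MeasurableSet A ∧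
          1 - C * ((d + totalSamples n : ℕ) : ℝ) ^ (-10 : ℤ) ≤ μ.real A ∧
          ∀ ω ∈ A, ‖replicaMatrix n (fun i j => ζ i j ω + ξ i j ω) (fun i j => x i j ω) -
              (totalSamples n : ℝ) • (B * diversityMatrix n α * Bᵀ)‖ ≤
            C * ((√(d * (totalSamples n * diversityEigenvalue n α ⟨0, hk⟩)) + √(M * d)) *
              Real.log (d + totalSamples n : ℕ) ^ 3) := by
  -- A common upper bound for all three variance proxies, using `‖αᵢ‖ ≤ a`; the summand 1 ensures `V
  -- ≥ 1`.
  set V : ℝ := vx + vζ * a ^ 2 + vξ + 1 with hV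
  have hV1 : 1 ≤ V := by
    have : 0 ≤ (vx : ℝ) + vζ * a ^ 2 + vξ := by positivity
    linarith
  have hc : 0 < 1 / (24 * V) / 4 := by positivity
  obtain ⟨C, hC, H⟩ := exists_noise_concentration hc
    (K := 2 * Real.exp (2 * (6 * Real.exp (2 * mζ ^ 2 + mx ^ 2 + a)))) (by positivity)
  refine ⟨C, hC, ?_⟩
  intro Ω _ μ _ M d k hk n x ζ ξ B α hn hB hα hmeas hind hx hζ hcross hξ hD hN hl hdT
  have hn0 : ∀ i, 0 < n i := fun i => by have := (hn i).1; omega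
  let t : (i : Fin M) → Fin (n i) → Ω → EuclideanSpace ℝ (Fin d) × ℝ × ℝ :=
    fun i j ω => (x i j ω, ζ i j ω, ξ i j ω)
  have ht : ∀ i j, Measurable (t i j) := fun i j =>
    (hmeas i j).1.prodMk ((hmeas i j).2.1.prodMk (hmeas i j).2.2)
  have hind' : iIndepFun (fun p : (i : Fin M) × Fin (n i) => t p.1 p.2) μ := hind
  have hsample : ∀ i j, ∀ u : Fin d → ℝ, u ⬝ᵥ u = 1 →
      IsSubExp (fun ω => ((t i j ω).2.1 + (t i j ω).2.2) * ((t i j ω).1.ofLp ⬝ᵥ u) -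
        (B *ᵥ (α i).ofLp) ⬝ᵥ u) (1 / (24 * V)) (6 * Real.exp (2 * mζ ^ 2 + mx ^ 2 + a)) μ ∧
      ∫ ω, ((t i j ω).2.1 + (t i j ω).2.2) * ((t i j ω).1.ofLp ⬝ᵥ u) -
        (B *ᵥ (α i).ofLp) ⬝ᵥ u ∂μ = 0 := by
    intro i j u hu
    have h1 : (vx : ℝ) ≤ V := by
      have : 0 ≤ (vζ : ℝ) * a ^ 2 + vξ := by positivity
      linarith
    have h2 : ((vζ * ‖α i‖₊ ^ 2 : ℝ≥0) : ℝ) ≤ V := by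
      have h3 : (vζ : ℝ) * ‖α i‖ ^ 2 ≤ vζ * a ^ 2 := by gcongr; exact hα i
      have : 0 ≤ (vx : ℝ) + vξ := by positivity
      push_cast
      linarith
    have h3 : (vξ : ℝ) ≤ V := by
      have : 0 ≤ (vx : ℝ) + vζ * a ^ 2 := by positivity
      linarith
    refine isSubExp_sample (hmeas i j).1 (hmeas i j).2.1 (hmeas i j).2.2 (hx i j).1 (hx i j).2
      (hζ i j).1 (hζ i j).2 (hcross i j) (hξ i j) ?_ hV1 h1 h2 h3 u hu
    rw [norm_toLp_mulVec_of_transpose_mul_self hB]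
    exact hα i
  have hhalf : ∀ i (s : Finset (Fin (n i))), 2 * s.card = n i →
      IsSubExpVec (fun ω => halfNoise s (B *ᵥ (α i).ofLp) fun j => t i j ω) (1 / (24 * V) / 4)
        (2 * Real.exp (2 * (6 * Real.exp (2 * mζ ^ 2 + mx ^ 2 + a)))) μ := fun i s hs =>
    isSubExpVec_halfNoise hs (hn0 i) (by positivity) (by positivity)
      (hind'.precomp (sigma_mk_injective (i := i))) (hsample i)
  have hMN := card_le_totalSamples hn0
  have hB0 := le_of_transpose_mul_self hB
  have hself : ∀ i, (√(n i : ℝ) • (B *ᵥ (α i).ofLp)) ⬝ᵥ (√(n i : ℝ) • (B *ᵥ (α i).ofLp)) =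
      n i * ‖α i‖ ^ 2 := signal_dotProduct_self hB
  obtain ⟨A, hA, hAp, hAω⟩ := H Ω μ M d (d + totalSamples n)
    (fun i ω => halfNoise (firstHalf (n i)) (B *ᵥ (α i).ofLp) fun j => t i j ω)
    (fun i ω => halfNoise (secondHalf (n i)) (B *ᵥ (α i).ofLp) fun j => t i j ω)
    (fun i => √(n i : ℝ) • (B *ᵥ (α i).ofLp))
    (totalSamples n * diversityEigenvalue n α ⟨0, hk⟩) (by omega) (by omega) (by omega) hD hdT
    (fun i => hhalf i _ (two_mul_card_firstHalf (hn i).2))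
    (fun i => hhalf i _ (two_mul_card_secondHalf (hn i).2))
    (fun i => indepFun_within_block hind' ht i (disjoint_firstHalf_secondHalf (n i))
      (measurable_halfNoise _ _) (measurable_halfNoise _ _)
      (fun _ _ h => halfNoise_congr _ _ h) (fun _ _ h => halfNoise_congr _ _ h))
    (fun i => indepFun_block_others hind' ht
      (φ := fun i f => (halfNoise (firstHalf (n i)) (B *ᵥ (α i).ofLp) f,
        halfNoise (secondHalf (n i)) (B *ᵥ (α i).ofLp) f))
      (fun i => (measurable_halfNoise _ _).prodMk (measurable_halfNoise _ _)) i)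
    (fun i => by rw [hself]; exact mul_norm_sq_le hk hN i)
    (by
      simp only [hself]
      refine (sum_mul_norm_sq_le hk hN).trans ?_
      -- The trace of `D` brings a factor `k`, at most `d` because `B` has orthonormal columns.
      have : (k : ℝ) ≤ d := by exact_mod_cast hB0
      rw [mul_assoc, mul_comm _ (d : ℝ)]
      gcongr)
    (fun v => by
      simp only [signal_dotProduct_sq]
      refine (sum_mul_dotProduct_sq_le hk hN _).trans ?_
      exact mul_le_mul_of_nonneg_left (transpose_mulVec_dotProduct_le hB v) (by positivity))
  refine ⟨A, hA, hAp, fun ω hω => ?_⟩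
  have e := replicaMatrix_sub_eq_sum_noiseMatrix hN α B fun i j => t i j ω
  exact e ▸ hAω ω hω

theorem mainTheorem4 (vx vζ vξ : ℝ≥0) (mx mζ a : ℝ) :
    ∃ C : ℝ, 0 < C ∧
      ∀ (Ω : Type*) [MeasurableSpace Ω] (μ : Measure Ω) [IsProbabilityMeasure μ]
        (M d k : ℕ) (hk : 0 < k) (n : Fin M → ℕ)
        (x : (i : Fin M) → Fin (n i) → Ω → EuclideanSpace ℝ (Fin d))
        (ζ ξ : (i : Fin M) → Fin (n i) → Ω → ℝ)
        (B : Matrix (Fin d) (Fin k) ℝ) (α : Fin M → EuclideanSpace ℝ (Fin k)),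
        (∀ i, 2 ≤ n i ∧ Even (n i)) →
        Bᵀ * B = 1 →
        (∀ i, ‖α i‖ ≤ a) →
        (∀ i j, Measurable (x i j) ∧ Measurable (ζ i j) ∧ Measurable (ξ i j)) →
        iIndepFun (fun (p : (i : Fin M) × Fin (n i)) (ω : Ω) =>
          (x p.1 p.2 ω, ζ p.1 p.2 ω, ξ p.1 p.2 ω)) μ →
        (∀ i j, IsSubGVec (x i j) vx μ ∧ ‖∫ ω, x i j ω ∂μ‖ ≤ mx) →
        (∀ i j, IsSubG (ζ i j) (vζ * ‖α i‖₊ ^ 2) μ ∧ |∫ ω, ζ i j ω ∂μ| ≤ mζ) →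
        (∀ i j, ∫ ω, ζ i j ω • x i j ω ∂μ = WithLp.toLp 2 (B *ᵥ (α i).ofLp)) →
        (∀ i j, IsCondCenteredSubG (ξ i j) (x i j) vξ μ) →
        0 < diversityEigenvalue n α ⟨k - 1, Nat.sub_one_lt_of_lt hk⟩ →
        ∃ A : Set Ω, MeasurableSet A ∧
          1 - C * ((d : ℝ) + totalSamples n) ^ (-10 : ℤ) ≤ μ.real A ∧
          ∀ ω ∈ A, ∀ Bhat : Matrix (Fin d) (Fin k) ℝ,
            (IsTopRightSingular
                (replicaMatrix n (fun i j => ζ i j ω + ξ i j ω) (fun i j => x i j ω)) Bhat ∨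
              IsTopLeftSingular
                (replicaMatrix n (fun i j => ζ i j ω + ξ i j ω) (fun i j => x i j ω)) Bhat) →
            sinThetaDist Bhat B ≤
              C * ((Real.sqrt (d * diversityEigenvalue n α ⟨0, hk⟩ /
                      (totalSamples n *
                        diversityEigenvalue n α ⟨k - 1, Nat.sub_one_lt_of_lt hk⟩ ^ 2)) +
                    Real.sqrt (M * d /
                      ((totalSamples n : ℝ) ^ 2 *
                        diversityEigenvalue n α ⟨k - 1, Nat.sub_one_lt_of_lt hk⟩ ^ 2))) *
                  Real.log (d + totalSamples n) ^ 3) := by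
  obtain ⟨C, hC, H⟩ := exists_replicaMatrix_concentration vx vζ vξ mx mζ a
  -- The 4 comes from Wedin's theorem, the 2 from the trivial bound on the distance.
  refine ⟨4 * C + 2, by positivity, ?_⟩
  intro Ω _ μ _ M d k hk n x ζ ξ B α hn hB hα hmeas hind hx hζ hcross hξ hlk
  have hN := totalSamples_pos_of_eigenvalue_pos hlk
  have hB0 := le_of_transpose_mul_self hB
  have hl := diversityEigenvalue_last_le_first n α hk
  have hN2 : 2 ≤ totalSamples n := by
    obtain ⟨i, -, hi⟩ := Finset.exists_ne_zero_of_sum_ne_zero (s := Finset.univ) hN.ne'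
    exact (hn i).1.trans (Finset.single_le_sum (f := n) (fun _ _ => Nat.zero_le _)
      (Finset.mem_univ i))
  have hcast : ((d + totalSamples n : ℕ) : ℝ) = (d : ℝ) + totalSamples n := by push_cast; rfl
  have hD : (3 : ℝ) ≤ (d : ℝ) + totalSamples n := by
    rw [← hcast]; exact_mod_cast (by omega : 3 ≤ d + totalSamples n)
  have hL : 1 ≤ Real.log (d + totalSamples n) ^ 3 := by
    refine one_le_pow₀ ?_
    rw [Real.le_log_iff_exp_le (by linarith)]
    exact Real.exp_one_lt_three.le.trans hD
  set lk := diversityEigenvalue n α ⟨k - 1, Nat.sub_one_lt_of_lt hk⟩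
  set l1 := diversityEigenvalue n α ⟨0, hk⟩
  have hl1 : 0 < l1 := hlk.trans_le hl
  set L := Real.log (d + totalSamples n) with hLdef
  have hNR : (0 : ℝ) < totalSamples n := by exact_mod_cast hN
  set N := (totalSamples n : ℝ)
  -- In the first case the first square root is at least 1 and the logarithm is at least 1, so the
  -- trivial bound holds everywhere.
  rcases le_or_gt (N * lk ^ 2) (d * l1) with hbig | hsmall
  · refine ⟨Set.univ, MeasurableSet.univ, ?_, fun ω _ Bhat hBhat => ?_⟩
    · have : 0 ≤ (4 * C + 2) * ((d : ℝ) + N) ^ (-10 : ℤ) := by positivity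
      simp only [probReal_univ]
      linarith
    · have hBhat' : Bhatᵀ * Bhat = 1 := by
        rcases hBhat with h | h
        · exact h.transpose_mul_self
        · exact h.isTopRightSingular_transpose.transpose_mul_self
      have h1 : 1 ≤ √(d * l1 / (N * lk ^ 2)) := by
        rw [Real.one_le_sqrt, one_le_div (by positivity)]
        exact hbig
      have h2 : 1 ≤ (√(d * l1 / (N * lk ^ 2)) + √(M * d / (N ^ 2 * lk ^ 2))) * L ^ 3 :=
        one_le_mul_of_one_le_of_one_le (le_add_of_le_of_nonneg h1 (Real.sqrt_nonneg _)) hL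
      have h3 := mul_le_mul_of_nonneg_left h2 (by positivity : 0 ≤ 4 * C + 2)
      have h4 := sinThetaDist_le_two hBhat' hB
      linarith
  · have hdT : (d : ℝ) ≤ N * l1 := by
      -- Here `d λ₁ < N λ_k² ≤ N λ_k λ₁`; cancelling `λ₁` yields the dimension condition of the
      -- concentration bound.
      have h1 : (d : ℝ) * l1 < N * lk * l1 := by nlinarith [mul_pos hNR hlk]
      have h2 := lt_of_mul_lt_mul_right h1 hl1.le
      nlinarith
    obtain ⟨A, hA, hAp, hAω⟩ := H Ω μ M d k hk n x ζ ξ B α hn hB hα hmeas hind hx hζ hcross hξ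
      (by omega) hN hl1.le hdT
    rw [hcast] at hAp hAω
    refine ⟨A, hA, ?_, fun ω hω Bhat hBhat => ?_⟩
    · have : 0 ≤ (3 * C + 2) * ((d : ℝ) + N) ^ (-10 : ℤ) := by positivity
      linarith
    · refine (sinThetaDist_le_of_norm_sub_le hk hN hB hlk (hAω ω hω) hBhat).trans ?_
      have e1 : √(d * l1 / (N * lk ^ 2)) = √(d * (N * l1)) / (N * lk) := by
        rw [← Real.sqrt_sq (by positivity : 0 ≤ N * lk), ← Real.sqrt_div' _ (by positivity)]
        congr 1
        field_simp
      have e2 : √(M * d / (N ^ 2 * lk ^ 2)) = √(M * d) / (N * lk) := by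
        rw [← mul_pow, Real.sqrt_div' _ (by positivity), Real.sqrt_sq (by positivity)]
      rw [e1, e2]
      have e3 : 4 * (C * ((√(d * (N * l1)) + √(M * d)) * L ^ 3)) / (N * lk) =
          4 * C * ((√(d * (N * l1)) / (N * lk) + √(M * d) / (N * lk)) * L ^ 3) := by
        ring
      exact e3.trans_le (mul_le_mul_of_nonneg_right (by linarith) (by positivity))
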